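/- Fix a (possibly infinite) alphabet $\Sigma$. A pomset over $\Sigma$ is an isomorphism class of finite $\Sigma$-labelled posets; $1$ is the empty pomset. $U\parallel V$ is the disjoint union, and $U\cdot V$ is the disjoint union in which additionally every point of $U$ lies below every point of $V$. Series-parallel pomsets are those generated from $1$ and the single letters by $\cdot$ and $\parallel$. A word is a totally ordered pomset. Terms are generated by $$e,f ::= 0 \mid 1 \mid a\in\Sigma \mid e+f \mid e\cdot f \mid e\parallel f \mid e^*$$ and $[\![e]\!]$ is the usual pomset language of $e$ (with $[\![0]\!]=\emptyset$, $[\![1]\!]=\{1\}$, $[\![a]\!]=\{a\}$, $+$ interpreted as union, $\cdot$ and $\parallel$ pointwise, and $[\![e^*]\!]=\bigcup_n[\![e]\!]^n$). Kleene algebra (KA) terms are the terms without $\parallel$. A hypothesis is an inequation $e\le f$ between terms. For a set $H$ of hypotheses, $\equiv^H$ is the smallest congruence on terms satisfying: the Kleene algebra axioms ($+$ is associative, commutative and idempotent with unit $0$; $\cdot$ is associative with two-sided unit $1$ and two-sided zero $0$, and distributes over $+$ on both sides; $1+e\cdot e^*\equiv e^*\equiv 1+e^*\cdot e$; $e+f\cdot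 g\leqq g$ implies $f^*\cdot e\leqq g$; $e+f\cdot g\leqq f$ implies $e\cdot g^*\leqq f$); the axioms that $\parallel$ is associative and commutative with unit $1$ and zero $0$ and distributes over $+$; and $e\leqq f$ for every $e\le f$ in $H$. Here $e\leqq f$ means $e+f\equiv f$; for $\equiv^H$ it is written $e\leqq^H f$. The relation $\equiv^H_{\mathsf{KA}}$ is the smallest congruence on KA terms satisfying the Kleene algebra axioms and the hypotheses of $H$ between KA terms. $H$ implies $H'$ if $e\leqq^H f$ for every $e\le f$ in $H'$. A context is a pomset over $\Sigma\cup\{*\}$ (with $*\notin\Sigma$) with exactly one point labelled $*$; $C[U]$ is obtained by replacing that point by $U$, each point of $U$ being ordered relative to the other points of $C$ as $*$ was, and $C[L]=\{C[U]: U\in L\}$. The $H$-closure $L{\downarrow}^H$ of a pomset language $L$ is the least language containing $L$ such that, for all $e\le f$ in $H$ and all series-parallel contexts $C$, if $C[[\![f]\!]]\subseteq L{\downarrow}^H$ then $C[[\![e]\!]]\subseteq L{\downarrow}^H$. For a language $L$ of words, the sequential closure $L{\downarrow}^H_{\mathsf{seq}}$ is defined in the same way using only totally ordered (series-parallel) contexts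 $C$. $H$ sequentially reduces to $H'$ if $H$ implies $H'$ and there is a map $r$ from KA terms to KA terms such that, for every KA term $e$, $e\equiv^H_{\mathsf{KA}} r(e)$ and $[\![e]\!]{\downarrow}^H_{\mathsf{seq}}=[\![r(e)]\!]{\downarrow}^{H'}_{\mathsf{seq}}$. $H$ strongly reduces to $H'$ if $H$ implies $H'$ and there is a map $r$ from terms to terms such that, for all terms $e,f$: $e\equiv^H r(e)$; if $[\![e]\!]{\downarrow}^H=[\![f]\!]{\downarrow}^H$ then $[\![r(e)]\!]{\downarrow}^{H'}=[\![r(f)]\!]{\downarrow}^{H'}$; and $[\![e]\!]{\downarrow}^H=[\![r(e)]\!]{\downarrow}^{H'}$. $H$ is grounded if for every $e\le f$ in $H$, both $e$ and $f$ are KA terms and $[\![f]\!]=\{W\}$ for some nonempty word $W$. **Lemma.** Let $H$ and $H'$ be sets of hypotheses. If $H$ sequentially reduces to $H'$, and both $H$ and $H'$ are grounded, then $H$ strongly reduces to $H'$. -/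

import Mathlib

universe u

/-! Pomsets -/

/-- A labelled poset over `α`: a finite carrier, a partial order on it, and a labelling. -/
structure LPoset (α : Type u) : Type (max 1 u) where
  carrier : Type
  [ord : PartialOrder carrier]
  [fin : Finite carrier]
  label : carrier → α

attribute [instance] LPoset.ord LPoset.fin

namespace LPoset

variable {α : Type u}

/-- Isomorphism of labelled posets: an order isomorphism that preserves labels. -/
def Iso (u v : LPoset α) : Prop :=
  ∃ h : u.carrier ≃o v.carrier, ∀ s, v.label (h s) = u.label s

theorem Iso.refl (u : LPoset α) : Iso u u := ⟨OrderIso.refl _, fun _ => rfl⟩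

theorem Iso.symm {u v : LPoset α} : Iso u v → Iso v u := by
  rintro ⟨h, hl⟩
  exact ⟨h.symm, fun s => by rw [← hl (h.symm s), h.apply_symm_apply]⟩

theorem Iso.trans {u v w : LPoset α} : Iso u v → Iso v w → Iso u w := by
  rintro ⟨h, hl⟩ ⟨k, kl⟩
  exact ⟨h.trans k, fun s => by rw [OrderIso.trans_apply, kl, hl]⟩

instance setoid (α : Type u) : Setoid (LPoset α) :=
  ⟨Iso, Iso.refl, Iso.symm, Iso.trans⟩

/-- The labelled poset without points. -/
def empty : LPoset α where
  carrier := Empty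
  label := Empty.elim

/-- The labelled poset with a single point, labelled `a`. -/
def letter (a : α) : LPoset α where
  carrier := Unit
  label := fun _ => a

/-- Parallel composition: the disjoint union (the order on `⊕` is the disjoint one). -/
def par (u v : LPoset α) : LPoset α where
  carrier := u.carrier ⊕ v.carrier
  label := Sum.elim u.label v.label

/-- Sequential composition: every point of `u` lies below every point of `v`
(the lexicographic order on the disjoint union). -/
def seq (u v : LPoset α) : LPoset α where
  carrier := u.carrier ⊕ₗ v.carrier
  fin := inferInstanceAs (Finite (u.carrier ⊕ v.carrier))
  label := fun s => Sum.elim u.label v.label (ofLex s)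

theorem par_congr {u u' v v' : LPoset α} : Iso u u' → Iso v v' → Iso (par u v) (par u' v') := by
  rintro ⟨h, hl⟩ ⟨k, kl⟩
  refine ⟨⟨Equiv.sumCongr h.toEquiv k.toEquiv, ?_⟩, ?_⟩
  · rintro (a | a) (b | b)
    · exact Sum.inl_le_inl_iff.trans (h.le_iff_le.trans Sum.inl_le_inl_iff.symm)
    · exact iff_of_false Sum.not_inl_le_inr Sum.not_inl_le_inr
    · exact iff_of_false Sum.not_inr_le_inl Sum.not_inr_le_inl
    · exact Sum.inr_le_inr_iff.trans (k.le_iff_le.trans Sum.inr_le_inr_iff.symm)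
  · rintro (a | a)
    · exact hl a
    · exact kl a

theorem seq_congr {u u' v v' : LPoset α} : Iso u u' → Iso v v' → Iso (seq u v) (seq u' v') := by
  rintro ⟨h, hl⟩ ⟨k, kl⟩
  refine ⟨OrderIso.sumLexCongr h k, ?_⟩
  rintro (a | a)
  · exact hl a
  · exact kl a

/-- The points of `c[u]`: the points of `c` whose label is not the gap `none`, together with
a copy of the points of `u` for each point of `c` with label `none`. When `c` is a context there
is exactly one such point. -/
def PlugCarrier (c : LPoset (Option α)) (u : LPoset α) : Type :=
  {s : c.carrier // c.label s ≠ none} ⊕ ({s : c.carrier // c.label s = none} × u.carrier)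

instance (c : LPoset (Option α)) (u : LPoset α) : Finite (PlugCarrier c u) :=
  inferInstanceAs (Finite
    ({s : c.carrier // c.label s ≠ none} ⊕ ({s : c.carrier // c.label s = none} × u.carrier)))

/-- The order of `c[u]`: two points that were not inserted are compared in `c`; an inserted point
is compared with the other points as its gap is in `c`; two points inserted into the same gap
are compared in `u`. (The case of two different gaps does not arise for contexts.) -/
def plugLE (c : LPoset (Option α)) (u : LPoset α) : PlugCarrier c u → PlugCarrier c u → Prop
  | .inl s, .inl t => s.1 ≤ t.1
  | .inl s, .inr q => s.1 ≤ q.1.1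
  | .inr p, .inl t => p.1.1 ≤ t.1
  | .inr p, .inr q => p.1.1 < q.1.1 ∨ (p.1.1 = q.1.1 ∧ p.2 ≤ q.2)

/-- The labelled poset `c[u]`, obtained by inserting `u` into the gap of `c`. -/
def plug (c : LPoset (Option α)) (u : LPoset α) : LPoset α where
  carrier := PlugCarrier c u
  ord :=
    { le := plugLE c u
      le_refl := by
        rintro (s | p)
        · exact le_refl s.1
        · exact Or.inr ⟨rfl, le_refl _⟩
      le_trans := by
        rintro (s | p) (t | q) (w | r) h k <;> simp only [plugLE] at h k ⊢
        · exact h.trans k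
        · exact h.trans k
        · exact h.trans k
        · rcases k with k | ⟨k, -⟩
          · exact h.trans k.le
          · exact h.trans k.le
        · exact h.trans k
        · have hw : p.1.1 ≠ t.1 := fun e => t.2 (e ▸ p.1.2)
          exact Or.inl ((lt_of_le_of_ne h hw).trans_le k)
        · rcases h with h | ⟨h, -⟩
          · exact h.le.trans k
          · exact h.le.trans k
        · rcases h with h | ⟨h, h'⟩
          · rcases k with k | ⟨k, -⟩
            · exact Or.inl (h.trans k)
            · exact Or.inl (h.trans_le k.le)
          · rcases k with k | ⟨k, k'⟩
            · exact Or.inl (h.le.trans_lt k)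
            · exact Or.inr ⟨h.trans k, h'.trans k'⟩
      le_antisymm := by
        rintro (s | p) (t | q) h k <;> simp only [plugLE] at h k
        · exact congrArg Sum.inl (Subtype.ext (le_antisymm h k))
        · exact absurd q.1.2 (le_antisymm h k ▸ s.2)
        · exact absurd p.1.2 (le_antisymm k h ▸ t.2)
        · rcases h with h | ⟨h, h'⟩
          · rcases k with k | ⟨k, -⟩
            · exact absurd (h.trans k) (lt_irrefl _)
            · exact absurd (h.trans_le k.le) (lt_irrefl _)
          · rcases k with k | ⟨-, k'⟩
            · exact absurd (h.le.trans_lt k) (lt_irrefl _)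
            · exact congrArg Sum.inr (Prod.ext (Subtype.ext h) (le_antisymm h' k')) }
  label
    | .inl s => (c.label s.1).get (Option.isSome_iff_ne_none.mpr s.2)
    | .inr p => u.label p.2

theorem plug_congr {c c' : LPoset (Option α)} {u u' : LPoset α} :
    Iso c c' → Iso u u' → Iso (plug c u) (plug c' u') := by
  rintro ⟨h, hl⟩ ⟨k, kl⟩
  refine ⟨⟨Equiv.sumCongr
      (h.toEquiv.subtypeEquiv fun s => by
        rw [← hl s]; exact Iff.rfl)
      (Equiv.prodCongr (h.toEquiv.subtypeEquiv fun s => by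
        rw [← hl s]; exact Iff.rfl) k.toEquiv), ?_⟩, ?_⟩
  · rintro (s | p) (t | q)
    · exact h.le_iff_le
    · exact h.le_iff_le
    · exact h.le_iff_le
    · exact or_congr h.lt_iff_lt (and_congr h.injective.eq_iff k.le_iff_le)
  · rintro (s | p)
    · exact Option.some_injective _ (by
        refine (Option.some_get _).trans ((hl s.1).trans (Option.some_get _).symm))
    · exact kl p.2

end LPoset

/-- Pomsets over `α`: labelled posets up to isomorphism. -/
def Pom (α : Type u) : Type (max 1 u) := Quotient (LPoset.setoid α)

namespace Pom

variable {α : Type u}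

/-- The empty pomset `1`. -/
def one : Pom α := Quotient.mk _ LPoset.empty

/-- The one-letter pomset. -/
def letter (a : α) : Pom α := Quotient.mk _ (LPoset.letter a)

/-- Sequential composition `U · V`. -/
def seq : Pom α → Pom α → Pom α :=
  Quotient.map₂ LPoset.seq fun _ _ h _ _ k => LPoset.seq_congr h k

/-- Parallel composition `U ∥ V`. -/
def par : Pom α → Pom α → Pom α :=
  Quotient.map₂ LPoset.par fun _ _ h _ _ k => LPoset.par_congr h k

/-- `C[U]`, where the letter `none` of `Option α` is the gap. -/
def plug : Pom (Option α) → Pom α → Pom α :=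
  Quotient.map₂ LPoset.plug fun _ _ h _ _ k => LPoset.plug_congr h k

/-- Words are the totally ordered pomsets. -/
def IsWord : Pom α → Prop :=
  Quotient.lift (fun u : LPoset α => ∀ s t : u.carrier, s ≤ t ∨ t ≤ s) (by
    have key : ∀ u v : LPoset α, LPoset.Iso u v →
        (∀ s t : u.carrier, s ≤ t ∨ t ≤ s) → ∀ s t : v.carrier, s ≤ t ∨ t ≤ s := by
      rintro u v ⟨h, -⟩ H s t
      simpa using H (h.symm s) (h.symm t)
    exact fun u v h => propext ⟨key u v h, key v u h.symm⟩)

/-- Contexts: pomsets with exactly one point labelled by the gap `none`. -/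
def IsContext : Pom (Option α) → Prop :=
  Quotient.lift (fun c : LPoset (Option α) => ∃! s : c.carrier, c.label s = none) (by
    have key : ∀ u v : LPoset (Option α), LPoset.Iso u v →
        (∃! s : u.carrier, u.label s = none) → ∃! s : v.carrier, v.label s = none := by
      rintro u v ⟨h, hl⟩ ⟨s, hs, hu⟩
      refine ⟨h s, (hl s).trans hs, fun t ht => ?_⟩
      have := hu (h.symm t) (by simpa [ht] using (hl (h.symm t)).symm)
      simpa using congrArg h this
    exact fun u v h => propext ⟨key u v h, key v u h.symm⟩)

/-- Series-parallel pomsets. -/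
inductive SP : Pom α → Prop
  | one : SP one
  | letter (a : α) : SP (letter a)
  | seq {U V : Pom α} : SP U → SP V → SP (seq U V)
  | par {U V : Pom α} : SP U → SP V → SP (par U V)

/-- Series-parallel contexts. -/
def IsSPContext (C : Pom (Option α)) : Prop := IsContext C ∧ SP C

/-- Sequential contexts: totally ordered series-parallel contexts. -/
def IsSeqContext (C : Pom (Option α)) : Prop := IsSPContext C ∧ IsWord C

/-- Pointwise sequential composition of languages. -/
def seqL (L K : Set (Pom α)) : Set (Pom α) := Set.image2 seq L K

/-- Pointwise parallel composition of languages. -/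
def parL (L K : Set (Pom α)) : Set (Pom α) := Set.image2 par L K

/-- Powers of a language. -/
def powL (L : Set (Pom α)) : ℕ → Set (Pom α)
  | 0 => {one}
  | n + 1 => seqL (powL L n) L

/-- Kleene star of a language. -/
def starL (L : Set (Pom α)) : Set (Pom α) := ⋃ n : ℕ, powL L n

end Pom

/-! Terms and their semantics -/

/-- Terms of concurrent Kleene algebra. -/
inductive Term (α : Type u) : Type u
  | zero : Term α
  | one : Term α
  | letter : α → Term α
  | add : Term α → Term α → Term α
  | seq : Term α → Term α → Term α
  | par : Term α → Term α → Term α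
  | star : Term α → Term α

/-- Terms of Kleene algebra. -/
inductive KATerm (α : Type u) : Type u
  | zero : KATerm α
  | one : KATerm α
  | letter : α → KATerm α
  | add : KATerm α → KATerm α → KATerm α
  | seq : KATerm α → KATerm α → KATerm α
  | star : KATerm α → KATerm α

/-- The inclusion of Kleene algebra terms in all terms; its range consists of the terms in which
`par` does not occur. -/
def KATerm.toTerm {α : Type u} : KATerm α → Term α
  | .zero => .zero
  | .one => .one
  | .letter a => .letter a
  | .add e f => .add e.toTerm f.toTerm
  | .seq e f => .seq e.toTerm f.toTerm
  | .star e => .star e.toTerm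

/-- Pomset language semantics. -/
def Term.sem {α : Type u} : Term α → Set (Pom α)
  | .zero => ∅
  | .one => {Pom.one}
  | .letter a => {Pom.letter a}
  | .add e f => e.sem ∪ f.sem
  | .seq e f => Pom.seqL e.sem f.sem
  | .par e f => Pom.parL e.sem f.sem
  | .star e => Pom.starL e.sem

/-! Hypotheses, provable equivalence and closure -/

/-- Sets of hypotheses; `(e, f)` stands for the hypothesis `e ≤ f`. -/
abbrev Hyps (α : Type u) : Type u := Set (Term α × Term α)

section Equivalence

open Term

/-- `TermEquiv H` is the smallest congruence on terms that satisfies the axioms of concurrent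
Kleene algebra (without the exchange law) and the hypotheses in `H`. Here `e ≤ f` abbreviates
`e + f ≡ f`. -/
inductive TermEquiv {α : Type u} (H : Hyps α) : Term α → Term α → Prop
  | refl (e) : TermEquiv H e e
  | symm {e f} : TermEquiv H e f → TermEquiv H f e
  | trans {e f g} : TermEquiv H e f → TermEquiv H f g → TermEquiv H e g
  | congr_add {e e' f f'} :
      TermEquiv H e e' → TermEquiv H f f' → TermEquiv H (add e f) (add e' f')
  | congr_seq {e e' f f'} :
      TermEquiv H e e' → TermEquiv H f f' → TermEquiv H (seq e f) (seq e' f')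
  | congr_par {e e' f f'} :
      TermEquiv H e e' → TermEquiv H f f' → TermEquiv H (par e f) (par e' f')
  | congr_star {e e'} : TermEquiv H e e' → TermEquiv H (star e) (star e')
  | add_zero (e) : TermEquiv H (add e zero) e
  | add_idem (e) : TermEquiv H (add e e) e
  | add_comm (e f) : TermEquiv H (add e f) (add f e)
  | add_assoc (e f g) : TermEquiv H (add e (add f g)) (add (add e f) g)
  | seq_assoc (e f g) : TermEquiv H (seq e (seq f g)) (seq (seq e f) g)
  | seq_add (e f g) : TermEquiv H (seq e (add f g)) (add (seq e f) (seq e g))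
  | add_seq (e f g) : TermEquiv H (seq (add e f) g) (add (seq e g) (seq f g))
  | seq_one (e) : TermEquiv H (seq e one) e
  | one_seq (e) : TermEquiv H (seq one e) e
  | seq_zero (e) : TermEquiv H (seq e zero) zero
  | zero_seq (e) : TermEquiv H (seq zero e) zero
  | par_comm (e f) : TermEquiv H (par e f) (par f e)
  | par_one (e) : TermEquiv H (par e one) e
  | par_zero (e) : TermEquiv H (par e zero) zero
  | par_assoc (e f g) : TermEquiv H (par e (par f g)) (par (par e f) g)
  | par_add (e f g) : TermEquiv H (par e (add f g)) (add (par e f) (par e g))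
  | star_unfold_left (e) : TermEquiv H (add one (seq e (star e))) (star e)
  | star_unfold_right (e) : TermEquiv H (add one (seq (star e) e)) (star e)
  | lfp_left {e f g} : TermEquiv H (add (add e (seq f g)) g) g →
      TermEquiv H (add (seq (star f) e) g) g
  | lfp_right {e f g} : TermEquiv H (add (add e (seq f g)) f) f →
      TermEquiv H (add (seq e (star g)) f) f
  | hyp {e f} : (e, f) ∈ H → TermEquiv H (add e f) f

end Equivalence

section KAEquivalence

open KATerm

/-- `KAEquiv H` is the smallest congruence on Kleene algebra terms that satisfies the axioms of
Kleene algebra and the hypotheses in `H` between Kleene algebra terms. -/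
inductive KAEquiv {α : Type u} (H : Hyps α) : KATerm α → KATerm α → Prop
  | refl (e) : KAEquiv H e e
  | symm {e f} : KAEquiv H e f → KAEquiv H f e
  | trans {e f g} : KAEquiv H e f → KAEquiv H f g → KAEquiv H e g
  | congr_add {e e' f f'} : KAEquiv H e e' → KAEquiv H f f' → KAEquiv H (add e f) (add e' f')
  | congr_seq {e e' f f'} : KAEquiv H e e' → KAEquiv H f f' → KAEquiv H (seq e f) (seq e' f')
  | congr_star {e e'} : KAEquiv H e e' → KAEquiv H (star e) (star e')
  | add_zero (e) : KAEquiv H (add e zero) e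
  | add_idem (e) : KAEquiv H (add e e) e
  | add_comm (e f) : KAEquiv H (add e f) (add f e)
  | add_assoc (e f g) : KAEquiv H (add e (add f g)) (add (add e f) g)
  | seq_assoc (e f g) : KAEquiv H (seq e (seq f g)) (seq (seq e f) g)
  | seq_add (e f g) : KAEquiv H (seq e (add f g)) (add (seq e f) (seq e g))
  | add_seq (e f g) : KAEquiv H (seq (add e f) g) (add (seq e g) (seq f g))
  | seq_one (e) : KAEquiv H (seq e one) e
  | one_seq (e) : KAEquiv H (seq one e) e
  | seq_zero (e) : KAEquiv H (seq e zero) zero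
  | zero_seq (e) : KAEquiv H (seq zero e) zero
  | star_unfold_left (e) : KAEquiv H (add one (seq e (star e))) (star e)
  | star_unfold_right (e) : KAEquiv H (add one (seq (star e) e)) (star e)
  | lfp_left {e f g} : KAEquiv H (add (add e (seq f g)) g) g →
      KAEquiv H (add (seq (star f) e) g) g
  | lfp_right {e f g} : KAEquiv H (add (add e (seq f g)) f) f →
      KAEquiv H (add (seq e (star g)) f) f
  | hyp {e f} : (e.toTerm, f.toTerm) ∈ H → KAEquiv H (add e f) f

end KAEquivalence

/-- The natural order `e ≤ f` of `TermEquiv H`. -/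
def TermLE {α : Type u} (H : Hyps α) (e f : Term α) : Prop := TermEquiv H (Term.add e f) f

/-- `H` implies `H'`: every hypothesis in `H'` is provable from `H`. -/
def Implies {α : Type u} (H H' : Hyps α) : Prop := ∀ e f, (e, f) ∈ H' → TermLE H e f

/-- The `H`-closure of a pomset language. -/
inductive Closure {α : Type u} (H : Hyps α) (L : Set (Pom α)) : Set (Pom α)
  | base {U : Pom α} : U ∈ L → Closure H L U
  | step {e f : Term α} {C : Pom (Option α)} {U : Pom α} :
      (e, f) ∈ H → Pom.IsSPContext C → (∀ V ∈ f.sem, Closure H L (Pom.plug C V)) →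
      U ∈ e.sem → Closure H L (Pom.plug C U)

/-- The sequential `H`-closure of a language of words; only sequential contexts are used. -/
inductive SeqClosure {α : Type u} (H : Hyps α) (L : Set (Pom α)) : Set (Pom α)
  | base {U : Pom α} : U ∈ L → SeqClosure H L U
  | step {e f : Term α} {C : Pom (Option α)} {U : Pom α} :
      (e, f) ∈ H → Pom.IsSeqContext C → (∀ V ∈ f.sem, SeqClosure H L (Pom.plug C V)) →
      U ∈ e.sem → SeqClosure H L (Pom.plug C U)

/-! Reductions -/

/-- `r` is a reduction from `H` to `H'`. -/
structure IsReduction {α : Type u} (H H' : Hyps α) (r : Term α → Term α) : Prop where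
  imp : Implies H H'
  equiv : ∀ e, TermEquiv H e (r e)
  closure : ∀ e f, Closure H e.sem = Closure H f.sem →
    Closure H' (r e).sem = Closure H' (r f).sem

/-- `r` is a strong reduction from `H` to `H'`. -/
structure IsStrongReduction {α : Type u} (H H' : Hyps α) (r : Term α → Term α) : Prop
    extends IsReduction H H' r where
  closure_eq : ∀ e, Closure H e.sem = Closure H' (r e).sem

/-- `H` strongly reduces to `H'`. -/
def StronglyReduces {α : Type u} (H H' : Hyps α) : Prop := ∃ r, IsStrongReduction H H' r

/-- `r` is a sequential reduction from `H` to `H'`. -/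
structure IsSeqReduction {α : Type u} (H H' : Hyps α) (r : KATerm α → KATerm α) : Prop where
  imp : Implies H H'
  equiv : ∀ e, KAEquiv H e (r e)
  closure_eq : ∀ e, SeqClosure H e.toTerm.sem = SeqClosure H' (r e).toTerm.sem

/-- `H` sequentially reduces to `H'`. -/
def SequentiallyReduces {α : Type u} (H H' : Hyps α) : Prop := ∃ r, IsSeqReduction H H' r

/-- The hypothesis `e ≤ f` is grounded: `e` and `f` are Kleene algebra terms, and the semantics
of `f` is a single nonempty word. -/
def GroundedHyp {α : Type u} (e f : Term α) : Prop :=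
  e ∈ Set.range KATerm.toTerm ∧ f ∈ Set.range KATerm.toTerm ∧
    ∃ W : Pom α, W.IsWord ∧ W ≠ Pom.one ∧ f.sem = {W}

/-- A set of hypotheses is grounded if all its members are. -/
def Grounded {α : Type u} (H : Hyps α) : Prop := ∀ e f, (e, f) ∈ H → GroundedHyp e f

/-! ### Labelled posets: induced parts, laws of the compositions, plugging -/

namespace LPoset

variable {α : Type u}

/-! A term is represented by a finite automaton with two kinds of transitions: words, labelled by
Kleene algebra terms, and parallel compositions of two terms that are already in normal form.
Kleene's algorithm on the word transitions alone yields Kleene algebra terms for the segments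
between parallel transitions. The sequential reduction is applied to these, and a second pass of
Kleene's algorithm, now with the parallel transitions, yields the normal form (`ParAut.normal`). It
is provably equivalent to the original term `e`, because the sequential reduction respects provable
equivalence (`ParAut.Represents.mk_normal`). Soundness (`TermEquiv.closure_sem_eq`), together with
the fact that `H` implies `H'`, then places its `H'`-closure inside the `H`-closure of `e`.

The converse inclusion passes through runs: words from sequentially closed segments, alternating
with proper parallel compositions of elements of closed languages. The point is that runs are closed
under arbitrary steps of `H` (`ParAut.Run.step`). A step replaces a nonempty word `W`. By Levi's
lemma, and because a proper sequential composition is connected, `W` cannot reach across the border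
of a proper parallel composition; it lies within a segment or within one parallel component
(`Pom.plug_eq_seq`, `Pom.plug_eq_par`). In a segment the step is sequential, and the sequential
reduction transfers the segment to `H'`. In a component the step stays in a closed language, for
which the normal form is known by induction.

The obstacle is that a step may erase a component: `1 ∥ V = V`, and `V` then merges with its
neighbours. Hence the automaton must be saturated: if one component can vanish, empty transitions
lead into and out of a copy of the automaton for the other one. These transitions are provably
sound, because `1` in the closure of `f` gives a proof of `1 ≤ f`. This is a case of
`PomTerm.mk_le_of_mem_closure`: since the right-hand side of a grounded hypothesis denotes a single
word and lies provably below it, every closure step can be replayed as a proof. -/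

theorem iso_of_surjective {u v : LPoset α} (f : u.carrier → v.carrier)
    (hs : Function.Surjective f) (hle : ∀ a b, f a ≤ f b ↔ a ≤ b)
    (hl : ∀ a, v.label (f a) = u.label a) : Iso u v :=
  ⟨RelIso.ofSurjective (OrderEmbedding.ofMapLEIff f hle) hs, hl⟩

/-- Naming the order of `seq u v` explicitly fixes the lexicographic order, as opposed to the
disjoint order of a bare sum. -/
theorem seq_inl_le_inl {u v : LPoset α} (a b : u.carrier) :
    (seq u v).ord.le (Sum.inl a) (Sum.inl b) ↔ a ≤ b := Sum.Lex.inl_le_inl_iff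

theorem seq_inr_le_inr {u v : LPoset α} (a b : v.carrier) :
    (seq u v).ord.le (Sum.inr a) (Sum.inr b) ↔ a ≤ b := Sum.Lex.inr_le_inr_iff

theorem par_inl_le_inl {u v : LPoset α} (a b : u.carrier) :
    (par u v).ord.le (Sum.inl a) (Sum.inl b) ↔ a ≤ b := Sum.inl_le_inl_iff

theorem par_inr_le_inr {u v : LPoset α} (a b : v.carrier) :
    (par u v).ord.le (Sum.inr a) (Sum.inr b) ↔ a ≤ b := Sum.inr_le_inr_iff

/-- The labelled poset induced on a set of points. -/
def restrict (x : LPoset α) (S : Set x.carrier) : LPoset α where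
  carrier := S
  label s := x.label s

theorem restrict_univ (x : LPoset α) : Iso (restrict x Set.univ) x :=
  iso_of_surjective (fun s => s.1) (fun s => ⟨⟨s, trivial⟩, rfl⟩) (fun _ _ => Iff.rfl) fun _ => rfl

theorem seq_restrict {x : LPoset α} {S T : Set x.carrier} (hd : Disjoint S T)
    (hle : ∀ a ∈ S, ∀ b ∈ T, a ≤ b) :
    Iso (seq (restrict x S) (restrict x T)) (restrict x (S ∪ T)) := by
  have hne : ∀ a ∈ S, ∀ b ∈ T, ¬ b ≤ a := fun a ha b hb h =>
    Set.disjoint_left.mp hd ha ((le_antisymm (hle a ha b hb) h) ▸ hb)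
  refine iso_of_surjective
    (fun s => Sum.elim (fun a : S => (⟨a.1, Or.inl a.2⟩ : (S ∪ T : Set _)))
      (fun b : T => ⟨b.1, Or.inr b.2⟩) (ofLex s)) ?_ ?_ ?_
  · rintro ⟨a, ha | ha⟩
    · exact ⟨toLex (Sum.inl ⟨a, ha⟩), rfl⟩
    · exact ⟨toLex (Sum.inr ⟨a, ha⟩), rfl⟩
  · rintro (a | a) (b | b)
    · exact (seq_inl_le_inl a b).symm
    · exact iff_of_true (hle _ a.2 _ b.2) (Sum.Lex.inl_le_inr _ _)
    · exact iff_of_false (hne _ b.2 _ a.2) Sum.Lex.not_inr_le_inl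
    · exact (seq_inr_le_inr a b).symm
  · rintro (a | a) <;> rfl

theorem par_restrict {x : LPoset α} {S T : Set x.carrier}
    (hst : ∀ a ∈ S, ∀ b ∈ T, ¬ a ≤ b ∧ ¬ b ≤ a) :
    Iso (par (restrict x S) (restrict x T)) (restrict x (S ∪ T)) := by
  refine iso_of_surjective
    (fun s => Sum.elim (fun a : S => (⟨a.1, Or.inl a.2⟩ : (S ∪ T : Set _)))
      (fun b : T => ⟨b.1, Or.inr b.2⟩) s) ?_ ?_ ?_
  · rintro ⟨a, ha | ha⟩
    · exact ⟨Sum.inl ⟨a, ha⟩, rfl⟩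
    · exact ⟨Sum.inr ⟨a, ha⟩, rfl⟩
  · rintro (a | a) (b | b)
    · exact (par_inl_le_inl a b).symm
    · exact iff_of_false (hst _ a.2 _ b.2).1 Sum.not_inl_le_inr
    · exact iff_of_false (hst _ b.2 _ a.2).2 Sum.not_inr_le_inl
    · exact (par_inr_le_inr a b).symm
  · rintro (a | a) <;> rfl

/-- Turns a factorisation into a cut of one fixed carrier, so that two factorisations of the same
pomset can be compared as sets of points. -/
theorem exists_restrict_of_iso_seq {x a b : LPoset α} (h : Iso x (seq a b)) :
    ∃ S T : Set x.carrier, S ∪ T = Set.univ ∧ Disjoint S T ∧ (∀ s ∈ S, ∀ t ∈ T, s ≤ t) ∧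
      Iso a (restrict x S) ∧ Iso b (restrict x T) := by
  obtain ⟨h, hl⟩ := h
  refine ⟨Set.range fun s => h.symm (toLex (Sum.inl s)),
    Set.range fun s => h.symm (toLex (Sum.inr s)), ?_, ?_, ?_, ?_, ?_⟩
  · refine Set.eq_univ_of_forall fun s => ?_
    obtain ⟨t, rfl⟩ := h.symm.surjective s
    rcases t with t | t
    · exact Or.inl ⟨t, rfl⟩
    · exact Or.inr ⟨t, rfl⟩
  · rw [Set.disjoint_left]
    rintro _ ⟨s, rfl⟩ ⟨t, ht⟩
    exact Sum.inr_ne_inl (toLex.injective (h.symm.injective ht))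
  · rintro _ ⟨s, rfl⟩ _ ⟨t, rfl⟩
    exact h.symm.le_iff_le.mpr (Sum.Lex.inl_le_inr _ _)
  · refine iso_of_surjective (fun s => ⟨h.symm (toLex (Sum.inl s)), s, rfl⟩) ?_ ?_ ?_
    · rintro ⟨_, s, rfl⟩
      exact ⟨s, rfl⟩
    · exact fun s t => h.symm.le_iff_le.trans Sum.Lex.inl_le_inl_iff
    · intro s
      exact (hl _).symm.trans (congrArg (seq a b).label (h.apply_symm_apply _))
  · refine iso_of_surjective (fun s => ⟨h.symm (toLex (Sum.inr s)), s, rfl⟩) ?_ ?_ ?_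
    · rintro ⟨_, s, rfl⟩
      exact ⟨s, rfl⟩
    · exact fun s t => h.symm.le_iff_le.trans Sum.Lex.inr_le_inr_iff
    · intro s
      exact (hl _).symm.trans (congrArg (seq a b).label (h.apply_symm_apply _))

theorem exists_restrict_of_iso_par {x a b : LPoset α} (h : Iso x (par a b)) :
    ∃ S T : Set x.carrier, S ∪ T = Set.univ ∧ (∀ s ∈ S, ∀ t ∈ T, ¬ s ≤ t ∧ ¬ t ≤ s) ∧
      Iso a (restrict x S) ∧ Iso b (restrict x T) := by
  obtain ⟨h, hl⟩ := h
  refine ⟨Set.range fun s => h.symm (Sum.inl s : a.carrier ⊕ b.carrier),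
    Set.range fun s => h.symm (Sum.inr s : a.carrier ⊕ b.carrier), ?_, ?_, ?_, ?_⟩
  · refine Set.eq_univ_of_forall fun s => ?_
    obtain ⟨t, rfl⟩ := h.symm.surjective s
    rcases t with t | t
    · exact Or.inl ⟨t, rfl⟩
    · exact Or.inr ⟨t, rfl⟩
  · rintro _ ⟨s, rfl⟩ _ ⟨t, rfl⟩
    exact ⟨fun k => Sum.not_inl_le_inr (h.symm.le_iff_le.mp k),
      fun k => Sum.not_inr_le_inl (h.symm.le_iff_le.mp k)⟩
  · refine iso_of_surjective (fun s => ⟨h.symm (Sum.inl s : a.carrier ⊕ b.carrier), s, rfl⟩)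
      ?_ ?_ ?_
    · rintro ⟨_, s, rfl⟩
      exact ⟨s, rfl⟩
    · exact fun s t => h.symm.le_iff_le.trans Sum.inl_le_inl_iff
    · intro s
      exact (hl _).symm.trans (congrArg (par a b).label (h.apply_symm_apply _))
  · refine iso_of_surjective (fun s => ⟨h.symm (Sum.inr s : a.carrier ⊕ b.carrier), s, rfl⟩)
      ?_ ?_ ?_
    · rintro ⟨_, s, rfl⟩
      exact ⟨s, rfl⟩
    · exact fun s t => h.symm.le_iff_le.trans Sum.inr_le_inr_iff
    · intro s
      exact (hl _).symm.trans (congrArg (par a b).label (h.apply_symm_apply _))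

theorem seq_assoc (u v w : LPoset α) : Iso (seq (seq u v) w) (seq u (seq v w)) :=
  ⟨OrderIso.sumLexAssoc _ _ _, by rintro ((a | a) | a) <;> rfl⟩

theorem par_assoc (u v w : LPoset α) : Iso (par (par u v) w) (par u (par v w)) :=
  ⟨OrderIso.sumAssoc _ _ _, by rintro ((a | a) | a) <;> rfl⟩

theorem par_comm (u v : LPoset α) : Iso (par u v) (par v u) :=
  ⟨OrderIso.sumComm _ _, by rintro (a | a) <;> rfl⟩

theorem empty_seq (u : LPoset α) : Iso u (seq empty u) :=
  iso_of_surjective (fun s => toLex (Sum.inr s))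
    (by rintro (⟨⟨⟩⟩ | a); exact ⟨a, rfl⟩) (fun _ _ => Sum.Lex.inr_le_inr_iff) fun _ => rfl

theorem seq_empty (u : LPoset α) : Iso u (seq u empty) :=
  iso_of_surjective (fun s => toLex (Sum.inl s))
    (by rintro (a | ⟨⟨⟩⟩); exact ⟨a, rfl⟩) (fun _ _ => Sum.Lex.inl_le_inl_iff) fun _ => rfl

theorem par_empty (u : LPoset α) : Iso u (par u empty) :=
  iso_of_surjective (fun s => (Sum.inl s : u.carrier ⊕ Empty))
    (by rintro (a | ⟨⟨⟩⟩); exact ⟨a, rfl⟩) (fun _ _ => Sum.inl_le_inl_iff) fun _ => rfl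

/-- Relabelling. -/
def map {β : Type u} (g : α → β) (u : LPoset α) : LPoset β where
  carrier := u.carrier
  label s := g (u.label s)

theorem map_congr {β : Type u} (g : α → β) {u v : LPoset α} : Iso u v → Iso (map g u) (map g v) :=
  fun ⟨h, hl⟩ => ⟨h, fun s => congrArg g (hl s)⟩

theorem plug_empty (u : LPoset α) : Iso (plug empty u) empty :=
  iso_of_surjective (fun s => (by rcases s with ⟨⟨⟩, _⟩ | ⟨⟨⟨⟩, _⟩, _⟩))
    (by rintro ⟨⟩) (by rintro (⟨⟨⟩, _⟩ | ⟨⟨⟨⟩, _⟩, _⟩)) (by rintro (⟨⟨⟩, _⟩ | ⟨⟨⟨⟩, _⟩, _⟩))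

theorem plug_gap (u : LPoset α) : Iso u (plug (letter none) u) :=
  iso_of_surjective (v := plug (letter none) u) (fun s => Sum.inr (⟨(), rfl⟩, s))
    (by
      rintro (⟨_, h⟩ | ⟨⟨⟨⟩, _⟩, s⟩)
      · exact absurd rfl h
      · exact ⟨s, rfl⟩)
    (fun _ _ => ⟨fun h => h.elim (fun h => absurd h (lt_irrefl _)) And.right,
      fun h => Or.inr ⟨rfl, h⟩⟩) fun _ => rfl

theorem plug_letter (a : α) (u : LPoset α) : Iso (letter a) (plug (letter (some a)) u) :=
  iso_of_surjective (v := plug (letter (some a)) u) (fun _ => Sum.inl ⟨(), Option.some_ne_none a⟩)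
    (by
      rintro (⟨⟨⟩, h⟩ | ⟨⟨_, h⟩, s⟩)
      · exact ⟨(), rfl⟩
      · exact absurd h (Option.some_ne_none a))
    (fun a b => iff_of_true (le_refl _) trivial) fun _ => rfl

/-- Because `plug` inserts a copy at every gap, it is a homomorphism for all `c` and `d`, with any
number of gaps. This is what makes induction over contexts possible. -/
theorem plug_seq (c d : LPoset (Option α)) (u : LPoset α) :
    Iso (seq (plug c u) (plug d u)) (plug (seq c d) u) := by
  refine iso_of_surjective (u := seq (plug c u) (plug d u)) (v := plug (seq c d) u) (fun s =>
    match ofLex s with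
    | .inl (.inl s) => .inl ⟨toLex (.inl s.1), s.2⟩
    | .inl (.inr s) => .inr (⟨toLex (.inl s.1.1), s.1.2⟩, s.2)
    | .inr (.inl s) => .inl ⟨toLex (.inr s.1), s.2⟩
    | .inr (.inr s) => .inr (⟨toLex (.inr s.1.1), s.1.2⟩, s.2)) ?_ ?_ ?_
  · rintro (⟨s | s, h⟩ | ⟨⟨s | s, h⟩, t⟩)
    · exact ⟨toLex (.inl (.inl ⟨s, h⟩)), rfl⟩
    · exact ⟨toLex (.inr (.inl ⟨s, h⟩)), rfl⟩
    · exact ⟨toLex (.inl (.inr (⟨s, h⟩, t))), rfl⟩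
    · exact ⟨toLex (.inr (.inr (⟨s, h⟩, t))), rfl⟩
  · have e1 : ∀ s t : c.carrier, (toLex (Sum.inl s) : c.carrier ⊕ₗ d.carrier) = toLex (.inl t) ↔
      s = t := fun s t => by simp
    have e2 : ∀ s t : d.carrier, (toLex (Sum.inr s) : c.carrier ⊕ₗ d.carrier) = toLex (.inr t) ↔
      s = t := fun s t => by simp
    rintro ((s | s) | (s | s)) ((t | t) | (t | t))
    · exact Sum.Lex.inl_le_inl_iff.trans
        (seq_inl_le_inl (u := plug c u) (v := plug d u) (.inl s) (.inl t)).symm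
    · exact Sum.Lex.inl_le_inl_iff.trans
        (seq_inl_le_inl (u := plug c u) (v := plug d u) (.inl s) (.inr t)).symm
    · exact iff_of_true (Sum.Lex.inl_le_inr _ _) (Sum.Lex.inl_le_inr _ _)
    · exact iff_of_true (Sum.Lex.inl_le_inr _ _) (Sum.Lex.inl_le_inr _ _)
    · exact Sum.Lex.inl_le_inl_iff.trans
        (seq_inl_le_inl (u := plug c u) (v := plug d u) (.inr s) (.inl t)).symm
    · exact (or_congr Sum.Lex.inl_lt_inl_iff (and_congr_left' (e1 _ _))).trans
        (seq_inl_le_inl (u := plug c u) (v := plug d u) (.inr s) (.inr t)).symm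
    · exact iff_of_true (Sum.Lex.inl_le_inr _ _) (Sum.Lex.inl_le_inr _ _)
    · exact iff_of_true (Or.inl (Sum.Lex.inl_lt_inr _ _)) (Sum.Lex.inl_le_inr _ _)
    · exact iff_of_false Sum.Lex.not_inr_le_inl Sum.Lex.not_inr_le_inl
    · exact iff_of_false Sum.Lex.not_inr_le_inl Sum.Lex.not_inr_le_inl
    · exact Sum.Lex.inr_le_inr_iff.trans
        (seq_inr_le_inr (u := plug c u) (v := plug d u) (.inl s) (.inl t)).symm
    · exact Sum.Lex.inr_le_inr_iff.trans
        (seq_inr_le_inr (u := plug c u) (v := plug d u) (.inl s) (.inr t)).symm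
    · exact iff_of_false Sum.Lex.not_inr_le_inl Sum.Lex.not_inr_le_inl
    · refine iff_of_false ?_ Sum.Lex.not_inr_le_inl
      rintro (h | ⟨h, -⟩)
      · exact Sum.Lex.not_inr_lt_inl h
      · exact Sum.inr_ne_inl (toLex.injective h)
    · exact Sum.Lex.inr_le_inr_iff.trans
        (seq_inr_le_inr (u := plug c u) (v := plug d u) (.inr s) (.inl t)).symm
    · exact (or_congr Sum.Lex.inr_lt_inr_iff (and_congr_left' (e2 _ _))).trans
        (seq_inr_le_inr (u := plug c u) (v := plug d u) (.inr s) (.inr t)).symm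
  · rintro ((s | s) | (s | s)) <;> rfl

theorem plug_par (c d : LPoset (Option α)) (u : LPoset α) :
    Iso (par (plug c u) (plug d u)) (plug (par c d) u) := by
  refine iso_of_surjective (u := par (plug c u) (plug d u)) (v := plug (par c d) u) (fun s =>
    match s with
    | .inl (.inl s) => .inl ⟨.inl s.1, s.2⟩
    | .inl (.inr s) => .inr (⟨.inl s.1.1, s.1.2⟩, s.2)
    | .inr (.inl s) => .inl ⟨.inr s.1, s.2⟩
    | .inr (.inr s) => .inr (⟨.inr s.1.1, s.1.2⟩, s.2)) ?_ ?_ ?_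
  · rintro (⟨s | s, h⟩ | ⟨⟨s | s, h⟩, t⟩)
    · exact ⟨.inl (.inl ⟨s, h⟩), rfl⟩
    · exact ⟨.inr (.inl ⟨s, h⟩), rfl⟩
    · exact ⟨.inl (.inr (⟨s, h⟩, t)), rfl⟩
    · exact ⟨.inr (.inr (⟨s, h⟩, t)), rfl⟩
  · rintro ((s | s) | (s | s)) ((t | t) | (t | t))
    · exact Sum.inl_le_inl_iff.trans
        (par_inl_le_inl (u := plug c u) (v := plug d u) (.inl s) (.inl t)).symm
    · exact Sum.inl_le_inl_iff.trans
        (par_inl_le_inl (u := plug c u) (v := plug d u) (.inl s) (.inr t)).symm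
    · exact iff_of_false Sum.not_inl_le_inr Sum.not_inl_le_inr
    · exact iff_of_false Sum.not_inl_le_inr Sum.not_inl_le_inr
    · exact Sum.inl_le_inl_iff.trans
        (par_inl_le_inl (u := plug c u) (v := plug d u) (.inr s) (.inl t)).symm
    · exact (or_congr Sum.inl_lt_inl_iff (and_congr_left' Sum.inl_injective.eq_iff)).trans
        (par_inl_le_inl (u := plug c u) (v := plug d u) (.inr s) (.inr t)).symm
    · exact iff_of_false Sum.not_inl_le_inr Sum.not_inl_le_inr
    · refine iff_of_false ?_ Sum.not_inl_le_inr
      rintro (h | ⟨h, -⟩)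
      · exact Sum.not_inl_lt_inr h
      · exact Sum.inl_ne_inr h
    · exact iff_of_false Sum.not_inr_le_inl Sum.not_inr_le_inl
    · exact iff_of_false Sum.not_inr_le_inl Sum.not_inr_le_inl
    · exact Sum.inr_le_inr_iff.trans
        (par_inr_le_inr (u := plug c u) (v := plug d u) (.inl s) (.inl t)).symm
    · exact Sum.inr_le_inr_iff.trans
        (par_inr_le_inr (u := plug c u) (v := plug d u) (.inl s) (.inr t)).symm
    · exact iff_of_false Sum.not_inr_le_inl Sum.not_inr_le_inl
    · refine iff_of_false ?_ Sum.not_inr_le_inl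
      rintro (h | ⟨h, -⟩)
      · exact Sum.not_inr_lt_inl h
      · exact Sum.inr_ne_inl h
    · exact Sum.inr_le_inr_iff.trans
        (par_inr_le_inr (u := plug c u) (v := plug d u) (.inr s) (.inl t)).symm
    · exact (or_congr Sum.inr_lt_inr_iff (and_congr_left' Sum.inr_injective.eq_iff)).trans
        (par_inr_le_inr (u := plug c u) (v := plug d u) (.inr s) (.inr t)).symm
  · rintro ((s | s) | (s | s)) <;> rfl

end LPoset

/-! ### Pomsets: laws of the compositions -/

namespace Pom

variable {α : Type u}

/-- The isomorphism class of a labelled poset. -/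
def mk (x : LPoset α) : Pom α := Quotient.mk _ x

theorem mk_eq {x y : LPoset α} (h : LPoset.Iso x y) : mk x = mk y := Quotient.sound h

theorem iso_of_mk_eq {x y : LPoset α} (h : mk x = mk y) : LPoset.Iso x y := Quotient.exact h

theorem exists_mk (X : Pom α) : ∃ x, X = mk x := by
  induction X using Quotient.ind with | _ x => exact ⟨x, rfl⟩

theorem seq_assoc (U V W : Pom α) : seq (seq U V) W = seq U (seq V W) := by
  obtain ⟨u, rfl⟩ := exists_mk U
  obtain ⟨v, rfl⟩ := exists_mk V
  obtain ⟨w, rfl⟩ := exists_mk W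
  exact mk_eq (LPoset.seq_assoc u v w)

theorem par_assoc (U V W : Pom α) : par (par U V) W = par U (par V W) := by
  obtain ⟨u, rfl⟩ := exists_mk U
  obtain ⟨v, rfl⟩ := exists_mk V
  obtain ⟨w, rfl⟩ := exists_mk W
  exact mk_eq (LPoset.par_assoc u v w)

theorem par_comm (U V : Pom α) : par U V = par V U := by
  obtain ⟨u, rfl⟩ := exists_mk U
  obtain ⟨v, rfl⟩ := exists_mk V
  exact mk_eq (LPoset.par_comm u v)

theorem one_seq (U : Pom α) : seq one U = U := by
  obtain ⟨u, rfl⟩ := exists_mk U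
  exact mk_eq (LPoset.empty_seq u).symm

theorem seq_one (U : Pom α) : seq U one = U := by
  obtain ⟨u, rfl⟩ := exists_mk U
  exact mk_eq (LPoset.seq_empty u).symm

theorem par_one (U : Pom α) : par U one = U := by
  obtain ⟨u, rfl⟩ := exists_mk U
  exact mk_eq (LPoset.par_empty u).symm

theorem one_par (U : Pom α) : par one U = U := by rw [par_comm, par_one]

theorem plug_one (U : Pom α) : plug one U = one := by
  obtain ⟨u, rfl⟩ := exists_mk U
  exact mk_eq (LPoset.plug_empty u)

theorem plug_gap (U : Pom α) : plug (letter none) U = U := by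
  obtain ⟨u, rfl⟩ := exists_mk U
  exact mk_eq (LPoset.plug_gap u).symm

theorem plug_letter (a : α) (U : Pom α) : plug (letter (some a)) U = letter a := by
  obtain ⟨u, rfl⟩ := exists_mk U
  exact mk_eq (LPoset.plug_letter a u).symm

theorem plug_seq (C D : Pom (Option α)) (U : Pom α) :
    plug (seq C D) U = seq (plug C U) (plug D U) := by
  obtain ⟨u, rfl⟩ := exists_mk U
  obtain ⟨c, rfl⟩ := exists_mk C
  obtain ⟨d, rfl⟩ := exists_mk D
  exact mk_eq (LPoset.plug_seq c d u).symm

theorem plug_par (C D : Pom (Option α)) (U : Pom α) :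
    plug (par C D) U = par (plug C U) (plug D U) := by
  obtain ⟨u, rfl⟩ := exists_mk U
  obtain ⟨c, rfl⟩ := exists_mk C
  obtain ⟨d, rfl⟩ := exists_mk D
  exact mk_eq (LPoset.plug_par c d u).symm

/-! Factorisations of pomsets -/

theorem mk_restrict_eq_one {x : LPoset α} {S : Set x.carrier} :
    mk (x.restrict S) = one ↔ S = ∅ := by
  constructor
  · intro h
    obtain ⟨h, -⟩ := iso_of_mk_eq (y := LPoset.empty) h
    exact Set.eq_empty_of_forall_notMem fun s hs => (h ⟨s, hs⟩).elim
  · rintro rfl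
    exact mk_eq (LPoset.iso_of_surjective (v := LPoset.empty) (fun s => s.2.elim)
      (by rintro ⟨⟩) (fun s => s.2.elim) (fun s => s.2.elim))

theorem exists_restrict_of_seq {x : LPoset α} {A B : Pom α} (h : mk x = seq A B) :
    ∃ S T : Set x.carrier, S ∪ T = Set.univ ∧ Disjoint S T ∧ (∀ s ∈ S, ∀ t ∈ T, s ≤ t) ∧
      A = mk (x.restrict S) ∧ B = mk (x.restrict T) := by
  obtain ⟨a, rfl⟩ := exists_mk A
  obtain ⟨b, rfl⟩ := exists_mk B
  obtain ⟨S, T, h1, h2, h3, h4, h5⟩ := LPoset.exists_restrict_of_iso_seq (iso_of_mk_eq h)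
  exact ⟨S, T, h1, h2, h3, mk_eq h4, mk_eq h5⟩

theorem exists_restrict_of_par {x : LPoset α} {A B : Pom α} (h : mk x = par A B) :
    ∃ S T : Set x.carrier, S ∪ T = Set.univ ∧ (∀ s ∈ S, ∀ t ∈ T, ¬ s ≤ t ∧ ¬ t ≤ s) ∧
      A = mk (x.restrict S) ∧ B = mk (x.restrict T) := by
  obtain ⟨a, rfl⟩ := exists_mk A
  obtain ⟨b, rfl⟩ := exists_mk B
  obtain ⟨S, T, h1, h3, h4, h5⟩ := LPoset.exists_restrict_of_iso_par (iso_of_mk_eq h)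
  exact ⟨S, T, h1, h3, mk_eq h4, mk_eq h5⟩

theorem mk_restrict_union_seq {x : LPoset α} {S T R : Set x.carrier} (hR : S ∪ T = R)
    (hd : Disjoint S T) (hle : ∀ s ∈ S, ∀ t ∈ T, s ≤ t) :
    mk (x.restrict R) = seq (mk (x.restrict S)) (mk (x.restrict T)) := by
  subst hR
  exact (mk_eq (LPoset.seq_restrict hd hle)).symm

theorem mk_restrict_union_par {x : LPoset α} {S T R : Set x.carrier} (hR : S ∪ T = R)
    (hst : ∀ s ∈ S, ∀ t ∈ T, ¬ s ≤ t ∧ ¬ t ≤ s) :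
    mk (x.restrict R) = par (mk (x.restrict S)) (mk (x.restrict T)) := by
  subst hR
  exact (mk_eq (LPoset.par_restrict hst)).symm

/-- Levi's lemma for pomsets, in the case that the first cut comes first. -/
theorem levi_of_subset {x : LPoset α} {S T S' T' : Set x.carrier} (h1 : S ∪ T = Set.univ)
    (hd : Disjoint S T) (hle : ∀ s ∈ S, ∀ t ∈ T, s ≤ t) (h1' : S' ∪ T' = Set.univ)
    (hd' : Disjoint S' T') (hle' : ∀ s ∈ S', ∀ t ∈ T', s ≤ t) (hS : S ⊆ S') :
    ∃ M, mk (x.restrict S') = seq (mk (x.restrict S)) M ∧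
      mk (x.restrict T) = seq M (mk (x.restrict T')) := by
  have hST : ∀ a, a ∈ S ∨ a ∈ T := fun a => (h1 ▸ Set.mem_univ a : a ∈ S ∪ T)
  have hST' : ∀ a, a ∈ S' ∨ a ∈ T' := fun a => (h1' ▸ Set.mem_univ a : a ∈ S' ∪ T')
  rw [Set.disjoint_left] at hd hd'
  refine ⟨mk (x.restrict (S' ∩ T)), mk_restrict_union_seq ?_ ?_ ?_,
    mk_restrict_union_seq ?_ ?_ ?_⟩
  · ext a
    have := hST a
    have := @hS a
    simp only [Set.mem_union, Set.mem_inter_iff]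
    tauto
  · exact Set.disjoint_left.mpr fun a ha hb => hd ha hb.2
  · exact fun s hs t ht => hle s hs t ht.2
  · ext a
    have := hST' a
    have := @hS a
    have := hST a
    have := @hd' a
    simp only [Set.mem_union, Set.mem_inter_iff]
    tauto
  · exact Set.disjoint_left.mpr fun a ha hb => hd' ha.1 hb
  · exact fun s hs t ht => hle' s hs.1 t ht

/-- Two cuts of the same poset are nested: a point in the first lower part only and a point in the
second lower part only would lie below each other. -/
theorem levi {A B Y Z : Pom α} (h : seq A B = seq Y Z) :
    (∃ M, A = seq Y M ∧ Z = seq M B) ∨ ∃ M, Y = seq A M ∧ B = seq M Z := by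
  obtain ⟨x, hx⟩ := exists_mk (seq A B)
  obtain ⟨S, T, h1, hd, hle, rfl, rfl⟩ := exists_restrict_of_seq hx.symm
  obtain ⟨S', T', h1', hd', hle', rfl, rfl⟩ := exists_restrict_of_seq (hx.symm.trans h)
  by_cases hS : S ⊆ S'
  · exact Or.inr (levi_of_subset h1 hd hle h1' hd' hle' hS)
  · refine Or.inl (levi_of_subset h1' hd' hle' h1 hd hle ?_)
    obtain ⟨a, ha, ha'⟩ := Set.not_subset.mp hS
    have haT : a ∈ T' := ((h1' ▸ Set.mem_univ a : a ∈ S' ∪ T')).resolve_left ha'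
    intro b hb
    by_contra hbS
    have hbT : b ∈ T := ((h1 ▸ Set.mem_univ b : b ∈ S ∪ T)).resolve_left hbS
    exact hbS (le_antisymm (hle a ha b hbT) (hle' b hb a haT) ▸ ha)

/-- The four intersections of the two partitions are the common refinement. -/
theorem riesz {A B Y Z : Pom α} (h : par A B = par Y Z) :
    ∃ P Q R S, A = par P Q ∧ B = par R S ∧ Y = par P R ∧ Z = par Q S := by
  obtain ⟨x, hx⟩ := exists_mk (par A B)
  obtain ⟨S, T, h1, hst, rfl, rfl⟩ := exists_restrict_of_par hx.symm
  obtain ⟨S', T', h1', hst', rfl, rfl⟩ := exists_restrict_of_par (hx.symm.trans h)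
  refine ⟨mk (x.restrict (S ∩ S')), mk (x.restrict (S ∩ T')), mk (x.restrict (T ∩ S')),
    mk (x.restrict (T ∩ T')), mk_restrict_union_par ?_ ?_, mk_restrict_union_par ?_ ?_,
    mk_restrict_union_par ?_ ?_, mk_restrict_union_par ?_ ?_⟩
  · rw [← Set.inter_union_distrib_left, h1', Set.inter_univ]
  · exact fun s hs t ht => hst' s hs.2 t ht.2
  · rw [← Set.inter_union_distrib_left, h1', Set.inter_univ]
  · exact fun s hs t ht => hst' s hs.2 t ht.2
  · rw [← Set.union_inter_distrib_right, h1, Set.univ_inter]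
  · exact fun s hs t ht => hst s hs.1 t ht.1
  · rw [← Set.union_inter_distrib_right, h1, Set.univ_inter]
  · exact fun s hs t ht => hst s hs.1 t ht.1

/-- A proper sequential composition is connected: with `y` in the lower and `z` in the upper part,
every point is comparable to `y` or `z`, and `y ≤ z`. So all points fall into the same parallel
component. -/
theorem eq_one_of_par_eq_seq {A B Y Z : Pom α} (h : par A B = seq Y Z) :
    A = one ∨ B = one ∨ Y = one ∨ Z = one := by
  obtain ⟨x, hx⟩ := exists_mk (par A B)
  obtain ⟨S, T, h1, hst, rfl, rfl⟩ := exists_restrict_of_par hx.symm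
  obtain ⟨S', T', h1', -, hle', rfl, rfl⟩ := exists_restrict_of_seq (hx.symm.trans h)
  have hST : ∀ a, a ∈ S ∨ a ∈ T := fun a => (h1 ▸ Set.mem_univ a : a ∈ S ∪ T)
  have hST' : ∀ a, a ∈ S' ∨ a ∈ T' := fun a => (h1' ▸ Set.mem_univ a : a ∈ S' ∪ T')
  simp only [mk_restrict_eq_one]
  by_contra hne
  simp only [not_or, ← Ne.eq_def, ← Set.nonempty_iff_ne_empty] at hne
  obtain ⟨⟨a, ha⟩, ⟨b, hb⟩, ⟨y, hy⟩, ⟨z, hz⟩⟩ := hne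
  have hyz := hle' y hy z hz
  rcases hST y with hyS | hyT
  · have hzS : z ∈ S := (hST z).resolve_right fun h => (hst y hyS z h).1 hyz
    rcases hST' b with hb' | hb'
    · exact (hst z hzS b hb).2 (hle' b hb' z hz)
    · exact (hst y hyS b hb).1 (hle' y hy b hb')
  · have hzT : z ∈ T := (hST z).resolve_left fun h => (hst z h y hyT).2 hyz
    rcases hST' a with ha' | ha'
    · exact (hst a ha z hzT).1 (hle' a ha' z hz)
    · exact (hst a ha y hyT).2 (hle' y hy a ha')

theorem seq_eq_one {A B : Pom α} : seq A B = one ↔ A = one ∧ B = one := by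
  constructor
  · intro h
    obtain ⟨S, T, h1, -, -, rfl, rfl⟩ := exists_restrict_of_seq (x := LPoset.empty) h.symm
    simp only [mk_restrict_eq_one]
    exact ⟨Set.eq_empty_of_forall_notMem fun s => s.elim,
      Set.eq_empty_of_forall_notMem fun s => s.elim⟩
  · rintro ⟨rfl, rfl⟩
    exact one_seq _

theorem par_eq_one {A B : Pom α} : par A B = one ↔ A = one ∧ B = one := by
  constructor
  · intro h
    obtain ⟨S, T, h1, -, rfl, rfl⟩ := exists_restrict_of_par (x := LPoset.empty) h.symm
    simp only [mk_restrict_eq_one]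
    exact ⟨Set.eq_empty_of_forall_notMem fun s => s.elim,
      Set.eq_empty_of_forall_notMem fun s => s.elim⟩
  · rintro ⟨rfl, rfl⟩
    exact par_one _

theorem letter_ne_one (a : α) : letter a ≠ one := by
  intro h
  obtain ⟨h, -⟩ := iso_of_mk_eq (x := LPoset.letter a) (y := LPoset.empty) h
  exact (h ()).elim

theorem letter_eq_seq {a : α} {A B : Pom α} (h : letter a = seq A B) :
    A = letter a ∧ B = one ∨ A = one ∧ B = letter a := by
  obtain ⟨S, T, h1, hd, -, rfl, rfl⟩ := exists_restrict_of_seq (x := LPoset.letter a) h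
  have hu : ∀ R : Set (LPoset.letter a).carrier, () ∈ R → R = Set.univ :=
    fun R hR => Set.eq_univ_of_forall fun _ => hR
  have hl : mk ((LPoset.letter a).restrict Set.univ) = letter a := mk_eq (LPoset.restrict_univ _)
  rcases (h1 ▸ Set.mem_univ () : () ∈ S ∪ T) with hS | hT
  · obtain rfl := hu S hS
    exact Or.inl ⟨hl, mk_restrict_eq_one.mpr (Set.univ_disjoint.mp hd)⟩
  · obtain rfl := hu T hT
    exact Or.inr ⟨mk_restrict_eq_one.mpr (Set.disjoint_univ.mp hd), hl⟩

theorem letter_eq_par {a : α} {A B : Pom α} (h : letter a = par A B) :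
    A = letter a ∧ B = one ∨ A = one ∧ B = letter a := by
  obtain ⟨S, T, h1, hst, rfl, rfl⟩ := exists_restrict_of_par (x := LPoset.letter a) h
  have hu : ∀ R : Set (LPoset.letter a).carrier, () ∈ R → R = Set.univ :=
    fun R hR => Set.eq_univ_of_forall fun _ => hR
  have hl : mk ((LPoset.letter a).restrict Set.univ) = letter a := mk_eq (LPoset.restrict_univ _)
  rcases (h1 ▸ Set.mem_univ () : () ∈ S ∪ T) with hS | hT
  · obtain rfl := hu S hS
    exact Or.inl ⟨hl, mk_restrict_eq_one.mpr
      (Set.eq_empty_of_forall_notMem fun t ht => (hst t trivial t ht).1 (le_refl t))⟩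
  · obtain rfl := hu T hT
    exact Or.inr ⟨mk_restrict_eq_one.mpr
      (Set.eq_empty_of_forall_notMem fun t ht => (hst t ht t trivial).1 (le_refl t)), hl⟩

/-! Words -/

theorem isWord_one : IsWord (one : Pom α) := fun s => s.elim

theorem isWord_letter (a : α) : IsWord (letter a) := fun _ _ => Or.inl (le_refl _)

theorem isWord_seq {U V : Pom α} : IsWord (seq U V) ↔ IsWord U ∧ IsWord V := by
  obtain ⟨u, rfl⟩ := exists_mk U
  obtain ⟨v, rfl⟩ := exists_mk V
  constructor
  · intro h
    exact ⟨fun s t => (h (toLex (.inl s)) (toLex (.inl t))).imp Sum.Lex.inl_le_inl_iff.mp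
      Sum.Lex.inl_le_inl_iff.mp, fun s t => (h (toLex (.inr s)) (toLex (.inr t))).imp
      Sum.Lex.inr_le_inr_iff.mp Sum.Lex.inr_le_inr_iff.mp⟩
  · rintro ⟨hu, hv⟩ (s | s) (t | t)
    · exact (hu s t).imp Sum.Lex.inl_le_inl_iff.mpr Sum.Lex.inl_le_inl_iff.mpr
    · exact Or.inl (Sum.Lex.inl_le_inr _ _)
    · exact Or.inr (Sum.Lex.inl_le_inr _ _)
    · exact (hv s t).imp Sum.Lex.inr_le_inr_iff.mpr Sum.Lex.inr_le_inr_iff.mpr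

theorem eq_one_of_isWord_par {U V : Pom α} (h : IsWord (par U V)) : U = one ∨ V = one := by
  obtain ⟨x, hx⟩ := exists_mk (par U V)
  obtain ⟨S, T, h1, hst, rfl, rfl⟩ := exists_restrict_of_par hx.symm
  rw [hx] at h
  simp only [mk_restrict_eq_one]
  by_contra hne
  simp only [not_or, ← Ne.eq_def, ← Set.nonempty_iff_ne_empty] at hne
  obtain ⟨⟨a, ha⟩, ⟨b, hb⟩⟩ := hne
  exact (h a b).elim (hst a ha b hb).1 (hst a ha b hb).2

/-- No nonempty word is a proper prefix of a pomset that starts with a proper parallel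
composition. -/
theorem word_seq_ne_par_seq {W Z U V X : Pom α} (hW : IsWord W) (hW1 : W ≠ one) (hU : U ≠ one)
    (hV : V ≠ one) : seq W Z ≠ seq (par U V) X := by
  intro h
  rcases levi h with ⟨M, h, -⟩ | ⟨M, h, -⟩
  · rw [h, isWord_seq] at hW
    exact (eq_one_of_isWord_par hW.1).elim hU hV
  · rcases eq_one_of_par_eq_seq h with h' | h' | h' | rfl
    · exact hU h'
    · exact hV h'
    · exact hW1 h'
    · rw [seq_one] at h
      exact (eq_one_of_isWord_par (h ▸ hW)).elim hU hV

/-- One of the four factors must be empty, and only `Y` can be; but then the proper parallel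
composition would be the word `W`. -/
theorem seq_word_ne_par {W Y U V : Pom α} (hW : IsWord W) (hW1 : W ≠ one) (hU : U ≠ one)
    (hV : V ≠ one) : par U V ≠ seq Y W := by
  intro h
  rcases eq_one_of_par_eq_seq h with h' | h' | rfl | h'
  · exact hU h'
  · exact hV h'
  · rw [one_seq] at h
    exact (eq_one_of_isWord_par (h ▸ hW)).elim hU hV
  · exact hW1 h'

/-! Series-parallel pomsets -/

/-- Needed when a cut passes through the surroundings of a gap: both pieces must again be admissible
parts of a series-parallel context. -/
theorem SP.of_seq {X : Pom α} (hX : SP X) : ∀ {A B}, X = Pom.seq A B → SP A ∧ SP B := by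
  induction hX with
  | one =>
    intro A B h
    obtain ⟨rfl, rfl⟩ := seq_eq_one.mp h.symm
    exact ⟨SP.one, SP.one⟩
  | letter a =>
    intro A B h
    rcases letter_eq_seq h with ⟨rfl, rfl⟩ | ⟨rfl, rfl⟩
    · exact ⟨SP.letter a, SP.one⟩
    · exact ⟨SP.one, SP.letter a⟩
  | seq hU hV ihU ihV =>
    intro A B h
    rcases levi h with ⟨M, hA, rfl⟩ | ⟨M, rfl, hB⟩
    · exact ⟨(ihU hA).1, SP.seq (ihU hA).2 hV⟩
    · exact ⟨SP.seq hU (ihV hB).1, (ihV hB).2⟩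
  | par hU hV ihU ihV =>
    intro A B h
    rcases eq_one_of_par_eq_seq h with rfl | rfl | rfl | rfl
    · exact ihV (by rw [← h, one_par])
    · exact ihU (by rw [← h, par_one])
    · rw [one_seq] at h
      exact ⟨SP.one, h ▸ SP.par hU hV⟩
    · rw [seq_one] at h
      exact ⟨h ▸ SP.par hU hV, SP.one⟩

theorem SP.of_par {X : Pom α} (hX : SP X) : ∀ {A B}, X = Pom.par A B → SP A ∧ SP B := by
  induction hX with
  | one =>
    intro A B h
    obtain ⟨rfl, rfl⟩ := par_eq_one.mp h.symm
    exact ⟨SP.one, SP.one⟩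
  | letter a =>
    intro A B h
    rcases letter_eq_par h with ⟨rfl, rfl⟩ | ⟨rfl, rfl⟩
    · exact ⟨SP.letter a, SP.one⟩
    · exact ⟨SP.one, SP.letter a⟩
  | par hU hV ihU ihV =>
    intro A B h
    obtain ⟨P, Q, R, S, hU', hV', rfl, rfl⟩ := riesz h
    exact ⟨SP.par (ihU hU').1 (ihV hV').1, SP.par (ihU hU').2 (ihV hV').2⟩
  | seq hU hV ihU ihV =>
    intro A B h
    rcases eq_one_of_par_eq_seq h.symm with rfl | rfl | rfl | rfl
    · rw [one_par] at h
      exact ⟨SP.one, h ▸ SP.seq hU hV⟩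
    · rw [par_one] at h
      exact ⟨h ▸ SP.seq hU hV, SP.one⟩
    · exact ihV (by rw [← h, one_seq])
    · exact ihU (by rw [← h, seq_one])

end Pom

namespace Pom

variable {α : Type u}

/-! Contexts -/

/-- A pomset, regarded as one over the alphabet with a gap. -/
def lift : Pom α → Pom (Option α) :=
  Quotient.map (LPoset.map some) fun _ _ h => LPoset.map_congr some h

theorem lift_one : lift (one : Pom α) = one :=
  mk_eq (x := LPoset.map some LPoset.empty) (y := LPoset.empty)
    ⟨OrderIso.refl _, fun s => s.elim⟩

theorem lift_seq (U V : Pom α) : lift (seq U V) = seq (lift U) (lift V) := by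
  obtain ⟨u, rfl⟩ := exists_mk U
  obtain ⟨v, rfl⟩ := exists_mk V
  exact mk_eq (x := LPoset.map some (LPoset.seq u v))
    (y := LPoset.seq (LPoset.map some u) (LPoset.map some v))
    ⟨OrderIso.refl _, by rintro (s | s) <;> rfl⟩

theorem lift_par (U V : Pom α) : lift (par U V) = par (lift U) (lift V) := by
  obtain ⟨u, rfl⟩ := exists_mk U
  obtain ⟨v, rfl⟩ := exists_mk V
  exact mk_eq (x := LPoset.map some (LPoset.par u v))
    (y := LPoset.par (LPoset.map some u) (LPoset.map some v))
    ⟨OrderIso.refl _, by rintro (s | s) <;> rfl⟩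

theorem SP.lift {Z : Pom α} (hZ : SP Z) : SP (lift Z) := by
  induction hZ with
  | one => exact lift_one ▸ SP.one
  | letter a => exact (SP.letter (some a) : SP (Pom.letter (some a)))
  | seq _ _ ihU ihV => exact lift_seq _ _ ▸ SP.seq ihU ihV
  | par _ _ ihU ihV => exact lift_par _ _ ▸ SP.par ihU ihV

theorem plug_lift {Z : Pom α} (hZ : SP Z) (U : Pom α) : plug (lift Z) U = Z := by
  induction hZ with
  | one => rw [lift_one, plug_one]
  | letter a => exact plug_letter a U
  | seq _ _ ihU ihV => rw [lift_seq, plug_seq, ihU, ihV]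
  | par _ _ ihU ihV => rw [lift_par, plug_par, ihU, ihV]

theorem isWord_lift {Z : Pom α} : IsWord (lift Z) ↔ IsWord Z := by
  obtain ⟨z, rfl⟩ := exists_mk Z
  exact Iff.rfl

/-- The number of gaps. -/
noncomputable def gaps : Pom (Option α) → ℕ :=
  Quotient.lift (fun c : LPoset (Option α) => Nat.card {s : c.carrier // c.label s = none}) (by
    rintro c d ⟨h, hl⟩
    exact Nat.card_congr (h.toEquiv.subtypeEquiv fun s => by rw [← hl s]; exact Iff.rfl))

/-- Unlike unique existence, the count is additive under both compositions and so suits induction.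
-/
theorem isContext_iff_gaps {C : Pom (Option α)} : IsContext C ↔ gaps C = 1 := by
  obtain ⟨c, rfl⟩ := exists_mk C
  exact (unique_subtype_iff_existsUnique _).symm.trans
    (unique_iff_subsingleton_and_nonempty _ |>.trans Nat.card_eq_one_iff_unique.symm)

theorem gaps_one : gaps (one : Pom (Option α)) = 0 :=
  Nat.card_eq_zero.mpr (Or.inl ⟨fun s => s.1.elim⟩)

theorem gaps_letter_some (a : α) : gaps (letter (some a)) = 0 :=
  Nat.card_eq_zero.mpr (Or.inl ⟨fun s => absurd s.2 (Option.some_ne_none a)⟩)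

theorem gaps_seq (C D : Pom (Option α)) : gaps (seq C D) = gaps C + gaps D := by
  obtain ⟨c, rfl⟩ := exists_mk C
  obtain ⟨d, rfl⟩ := exists_mk D
  exact (Nat.card_congr (Equiv.subtypeSum
    (p := fun s => Sum.elim c.label d.label s = none))).trans Nat.card_sum

theorem gaps_par (C D : Pom (Option α)) : gaps (par C D) = gaps C + gaps D := by
  obtain ⟨c, rfl⟩ := exists_mk C
  obtain ⟨d, rfl⟩ := exists_mk D
  exact (Nat.card_congr (Equiv.subtypeSum
    (p := fun s => Sum.elim c.label d.label s = none))).trans Nat.card_sum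

/-- The inductive description of series-parallel contexts. -/
inductive SPCtx : Pom (Option α) → Prop
  | gap : SPCtx (letter none)
  | seq_right {C Z} : SPCtx C → SP Z → SPCtx (seq C (lift Z))
  | seq_left {Z C} : SP Z → SPCtx C → SPCtx (seq (lift Z) C)
  | par_right {C Z} : SPCtx C → SP Z → SPCtx (par C (lift Z))

/-- The two claims are proved together, since a composition with one gap has one factor with a gap
and one without. Commutativity of `par` makes a fifth constructor of `SPCtx` superfluous. -/
theorem spCtx_of_gaps {C : Pom (Option α)} (hC : SP C) :
    (gaps C = 0 → ∃ Z, SP Z ∧ C = lift Z) ∧ (gaps C = 1 → SPCtx C) := by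
  induction hC with
  | one => exact ⟨fun _ => ⟨one, SP.one, lift_one.symm⟩, by simp [gaps_one]⟩
  | letter a =>
    cases a with
    | none =>
      have h1 : gaps (letter none : Pom (Option α)) = 1 :=
        isContext_iff_gaps.mp ⟨(), rfl, fun _ _ => rfl⟩
      exact ⟨by simp [h1], fun _ => SPCtx.gap⟩
    | some a => exact ⟨fun _ => ⟨_, SP.letter a, rfl⟩, by simp [gaps_letter_some]⟩
  | seq hU hV ihU ihV =>
    rw [gaps_seq]
    constructor
    · intro h
      obtain ⟨Z, hZ, rfl⟩ := ihU.1 (by omega)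
      obtain ⟨Z', hZ', rfl⟩ := ihV.1 (by omega)
      exact ⟨_, SP.seq hZ hZ', (lift_seq _ _).symm⟩
    · intro h
      rcases Nat.add_eq_one_iff.mp h with ⟨h0, h1⟩ | ⟨h1, h0⟩
      · obtain ⟨Z, hZ, rfl⟩ := ihU.1 h0
        exact SPCtx.seq_left hZ (ihV.2 h1)
      · obtain ⟨Z, hZ, rfl⟩ := ihV.1 h0
        exact SPCtx.seq_right (ihU.2 h1) hZ
  | par hU hV ihU ihV =>
    rw [gaps_par]
    constructor
    · intro h
      obtain ⟨Z, hZ, rfl⟩ := ihU.1 (by omega)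
      obtain ⟨Z', hZ', rfl⟩ := ihV.1 (by omega)
      exact ⟨_, SP.par hZ hZ', (lift_par _ _).symm⟩
    · intro h
      rcases Nat.add_eq_one_iff.mp h with ⟨h0, h1⟩ | ⟨h1, h0⟩
      · obtain ⟨Z, hZ, rfl⟩ := ihU.1 h0
        rw [par_comm]
        exact SPCtx.par_right (ihV.2 h1) hZ
      · obtain ⟨Z, hZ, rfl⟩ := ihV.1 h0
        exact SPCtx.par_right (ihU.2 h1) hZ

theorem gaps_lift {Z : Pom α} (hZ : SP Z) : gaps (lift Z) = 0 := by
  induction hZ with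
  | one => rw [lift_one, gaps_one]
  | letter a => exact gaps_letter_some a
  | seq _ _ ihU ihV => rw [lift_seq, gaps_seq, ihU, ihV]
  | par _ _ ihU ihV => rw [lift_par, gaps_par, ihU, ihV]

theorem isSPContext_iff {C : Pom (Option α)} : IsSPContext C ↔ SPCtx C := by
  refine ⟨fun h => (spCtx_of_gaps h.2).2 (isContext_iff_gaps.mp h.1), fun h => ?_⟩
  rw [IsSPContext, isContext_iff_gaps]
  induction h with
  | gap => exact ⟨isContext_iff_gaps.mp ⟨(), rfl, fun _ _ => rfl⟩, SP.letter _⟩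
  | seq_right _ hZ ih => exact ⟨by rw [gaps_seq, ih.1, gaps_lift hZ], SP.seq ih.2 hZ.lift⟩
  | seq_left hZ _ ih => exact ⟨by rw [gaps_seq, ih.1, gaps_lift hZ], SP.seq hZ.lift ih.2⟩
  | par_right _ hZ ih => exact ⟨by rw [gaps_par, ih.1, gaps_lift hZ], SP.par ih.2 hZ.lift⟩

theorem SP.plug {C : Pom (Option α)} {U : Pom α} (hC : SPCtx C) (hU : SP U) :
    SP (plug C U) := by
  induction hC with
  | gap => rwa [plug_gap]
  | seq_right _ hZ ih => rw [plug_seq, plug_lift hZ]; exact SP.seq ih hZ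
  | seq_left hZ _ ih => rw [plug_seq, plug_lift hZ]; exact SP.seq hZ ih
  | par_right _ hZ ih => rw [plug_par, plug_lift hZ]; exact SP.par ih hZ

theorem plug_ne_one {C : Pom (Option α)} {W : Pom α} (hC : SPCtx C) (hW : W ≠ one) :
    plug C W ≠ one := by
  induction hC with
  | gap => rwa [plug_gap]
  | seq_right _ hZ ih => rw [plug_seq]; exact fun h => ih (seq_eq_one.mp h).1
  | seq_left hZ _ ih => rw [plug_seq]; exact fun h => ih (seq_eq_one.mp h).2
  | par_right _ hZ ih => rw [plug_par]; exact fun h => ih (par_eq_one.mp h).1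

/-- A series-parallel context that makes a word out of a nonempty pomset is totally ordered. -/
theorem isWord_of_isWord_plug {C : Pom (Option α)} {W : Pom α} (hC : SPCtx C) (hW : W ≠ one)
    (h : IsWord (plug C W)) : IsWord C := by
  induction hC with
  | gap => exact isWord_letter _
  | seq_right _ hZ ih =>
    rw [plug_seq, plug_lift hZ, isWord_seq] at h
    exact isWord_seq.mpr ⟨ih h.1, isWord_lift.mpr h.2⟩
  | seq_left hZ _ ih =>
    rw [plug_seq, plug_lift hZ, isWord_seq] at h
    exact isWord_seq.mpr ⟨isWord_lift.mpr h.1, ih h.2⟩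
  | par_right hC hZ ih =>
    rw [plug_par, plug_lift hZ] at h
    -- A word is not a proper parallel composition, and the component with the gap is nonempty, so
    -- the other one is empty.
    obtain rfl := (eq_one_of_isWord_par h).resolve_left (plug_ne_one hC hW)
    rw [lift_one, par_one]
    exact ih (by rwa [par_one] at h)

theorem isWord_plug {C : Pom (Option α)} {W : Pom α} (hC : SPCtx C) (hCW : IsWord C)
    (hW : IsWord W) : IsWord (plug C W) := by
  induction hC with
  | gap => rwa [plug_gap]
  | seq_right _ hZ ih =>
    rw [isWord_seq, isWord_lift] at hCW
    rw [plug_seq, plug_lift hZ]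
    exact isWord_seq.mpr ⟨ih hCW.1, hCW.2⟩
  | seq_left hZ _ ih =>
    rw [isWord_seq, isWord_lift] at hCW
    rw [plug_seq, plug_lift hZ]
    exact isWord_seq.mpr ⟨hCW.1, ih hCW.2⟩
  | par_right hC hZ ih =>
    rw [plug_par, plug_lift hZ]
    rcases eq_one_of_isWord_par hCW with rfl | h
    · exact absurd (isSPContext_iff.mpr hC).1 (by rw [isContext_iff_gaps, gaps_one]; simp)
    -- Plugging into `lift Z = one` gives back `Z`, which is therefore empty.
    · have hZ1 := plug_lift hZ W
      rw [h] at hCW hZ1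
      rw [← hZ1, plug_one, par_one]
      exact ih (by rwa [par_one] at hCW)

/-- If a nonempty word is plugged into a context and the result is a parallel composition, then
the gap lies in one of the two components. -/
theorem plug_eq_par {C : Pom (Option α)} {W : Pom α} (hC : SPCtx C) (hW : IsWord W)
    (hW1 : W ≠ one) : ∀ {U V : Pom α}, plug C W = par U V →
      (∃ D, SPCtx D ∧ plug D W = U ∧ ∀ X, plug C X = par (plug D X) V) ∨
      ∃ D, SPCtx D ∧ plug D W = V ∧ ∀ X, plug C X = par U (plug D X) := by
  -- If one component is empty, the whole context serves as the context for the other.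
  have triv : ∀ {C : Pom (Option α)} {U V : Pom α}, SPCtx C → plug C W = par U V →
      U = one ∨ V = one → (∃ D, SPCtx D ∧ plug D W = U ∧ ∀ X, plug C X = par (plug D X) V) ∨
      ∃ D, SPCtx D ∧ plug D W = V ∧ ∀ X, plug C X = par U (plug D X) := by
    rintro C U V hC h (rfl | rfl)
    · exact Or.inr ⟨C, hC, by rw [h, one_par], fun X => (one_par _).symm⟩
    · exact Or.inl ⟨C, hC, by rw [h, par_one], fun X => (par_one _).symm⟩
  induction hC with
  | gap =>
    intro U V h
    exact triv SPCtx.gap h (eq_one_of_isWord_par (by rwa [← h, plug_gap]))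
  | @seq_right C Z hC hZ ih =>
    intro U V h
    have h' := h
    rw [plug_seq, plug_lift hZ] at h'
    rcases eq_one_of_par_eq_seq h'.symm with hU | hV | h1 | rfl
    · exact triv (SPCtx.seq_right hC hZ) h (Or.inl hU)
    · exact triv (SPCtx.seq_right hC hZ) h (Or.inr hV)
    · exact absurd h1 (plug_ne_one hC hW1)
    · rw [lift_one, seq_one] at h ⊢
      exact ih h
  | @seq_left Z C hZ hC ih =>
    intro U V h
    have h' := h
    rw [plug_seq, plug_lift hZ] at h'
    rcases eq_one_of_par_eq_seq h'.symm with hU | hV | rfl | h1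
    · exact triv (SPCtx.seq_left hZ hC) h (Or.inl hU)
    · exact triv (SPCtx.seq_left hZ hC) h (Or.inr hV)
    · rw [lift_one, one_seq] at h ⊢
      exact ih h
    · exact absurd h1 (plug_ne_one hC hW1)
  | @par_right C Z hC hZ ih =>
    intro U V h
    rw [plug_par, plug_lift hZ] at h
    -- Both components consist of a part of the filled context and a part of `Z`. The induction
    -- hypothesis finds the gap in `P` or `Q`, and the matching part of `Z` joins the smaller
    -- context.
    obtain ⟨P, Q, R, S, hP, rfl, rfl, rfl⟩ := riesz h
    obtain ⟨hR, hS⟩ := hZ.of_par rfl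
    rcases ih hP with ⟨D, hD, hDP, hX⟩ | ⟨D, hD, hDQ, hX⟩
    · refine Or.inl ⟨par D (lift R), SPCtx.par_right hD hR, ?_, fun X => ?_⟩
      · rw [plug_par, plug_lift hR, hDP]
      · rw [plug_par, plug_par, plug_lift hR, plug_lift hZ, hX, par_assoc, par_assoc,
          ← par_assoc Q, par_comm Q, par_assoc R]
    · refine Or.inr ⟨par D (lift S), SPCtx.par_right hD hS, ?_, fun X => ?_⟩
      · rw [plug_par, plug_lift hS, hDQ]
      · rw [plug_par, plug_par, plug_lift hS, plug_lift hZ, hX, par_assoc, par_assoc,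
          ← par_assoc _ R, par_comm _ R, par_assoc R]

/-- If a nonempty word is plugged into a context and the result is a sequential composition, then
either the gap lies in one of the two components, or the word straddles the cut. -/
theorem plug_eq_seq {C : Pom (Option α)} {W : Pom α} (hC : SPCtx C) (hW : IsWord W)
    (hW1 : W ≠ one) : ∀ {Y Z : Pom α}, plug C W = seq Y Z →
      (∃ D, SPCtx D ∧ plug D W = Y ∧ ∀ X, plug C X = seq (plug D X) Z) ∨
      (∃ D, SPCtx D ∧ plug D W = Z ∧ ∀ X, plug C X = seq Y (plug D X)) ∨
      ∃ Y' Z' W₁ W₂, IsWord W₁ ∧ IsWord W₂ ∧ W₁ ≠ one ∧ W₂ ≠ one ∧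
        Y = seq Y' W₁ ∧ Z = seq W₂ Z' := by
  have triv : ∀ {C : Pom (Option α)} {Y Z : Pom α}, SPCtx C → plug C W = seq Y Z →
      Y = one ∨ Z = one → (∃ D, SPCtx D ∧ plug D W = Y ∧ ∀ X, plug C X = seq (plug D X) Z) ∨
      (∃ D, SPCtx D ∧ plug D W = Z ∧ ∀ X, plug C X = seq Y (plug D X)) ∨
      ∃ Y' Z' W₁ W₂, IsWord W₁ ∧ IsWord W₂ ∧ W₁ ≠ one ∧ W₂ ≠ one ∧
        Y = seq Y' W₁ ∧ Z = seq W₂ Z' := by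
    rintro C U V hC h (rfl | rfl)
    · exact Or.inr (Or.inl ⟨C, hC, by rw [h, one_seq], fun X => (one_seq _).symm⟩)
    · exact Or.inl ⟨C, hC, by rw [h, seq_one], fun X => (seq_one _).symm⟩
  induction hC with
  | gap =>
    intro Y Z h
    by_cases hYZ : Y = one ∨ Z = one
    · exact triv SPCtx.gap h hYZ
    · rw [not_or] at hYZ
      rw [plug_gap] at h
      rw [h, isWord_seq] at hW
      exact Or.inr (Or.inr ⟨one, one, Y, Z, hW.1, hW.2, hYZ.1, hYZ.2, (one_seq _).symm,
        (seq_one _).symm⟩)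
  | @seq_right C Z₀ hC hZ ih =>
    intro Y Z h
    rw [plug_seq, plug_lift hZ] at h
    -- The cut falls either within the filled context, where induction applies, or within `Z₀`, so
    -- that the gap lies before it.
    rcases levi h with ⟨M, h1, rfl⟩ | ⟨M, rfl, rfl⟩
    · rcases ih h1 with ⟨D, hD, hDY, hX⟩ | ⟨D, hD, hDM, hX⟩ | ⟨Y', Z', W₁, W₂, a, b, c, d, e, f⟩
      · exact Or.inl ⟨D, hD, hDY, fun X => by rw [plug_seq, plug_lift hZ, hX, seq_assoc]⟩
      · refine Or.inr (Or.inl ⟨seq D (lift Z₀), SPCtx.seq_right hD hZ, ?_, fun X => ?_⟩)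
        · rw [plug_seq, plug_lift hZ, hDM]
        · rw [plug_seq, plug_seq, plug_lift hZ, hX, seq_assoc]
      · exact Or.inr (Or.inr ⟨Y', seq Z' Z₀, W₁, W₂, a, b, c, d, e, by rw [f, seq_assoc]⟩)
    · obtain ⟨hM, -⟩ := hZ.of_seq rfl
      refine Or.inl ⟨seq C (lift M), SPCtx.seq_right hC hM, ?_, fun X => ?_⟩
      · rw [plug_seq, plug_lift hM]
      · rw [plug_seq, plug_seq, plug_lift hM, plug_lift hZ, seq_assoc]
  | @seq_left Z₀ C hZ hC ih =>
    intro Y Z h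
    rw [plug_seq, plug_lift hZ] at h
    rcases levi h with ⟨M, rfl, rfl⟩ | ⟨M, rfl, h1⟩
    · obtain ⟨-, hM⟩ := hZ.of_seq rfl
      refine Or.inr (Or.inl ⟨seq (lift M) C, SPCtx.seq_left hM hC, ?_, fun X => ?_⟩)
      · rw [plug_seq, plug_lift hM]
      · rw [plug_seq, plug_seq, plug_lift hM, plug_lift hZ, seq_assoc]
    · rcases ih h1 with ⟨D, hD, hDM, hX⟩ | ⟨D, hD, hDZ, hX⟩ | ⟨Y', Z', W₁, W₂, a, b, c, d, e, f⟩
      · refine Or.inl ⟨seq (lift Z₀) D, SPCtx.seq_left hZ hD, ?_, fun X => ?_⟩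
        · rw [plug_seq, plug_lift hZ, hDM]
        · rw [plug_seq, plug_seq, plug_lift hZ, hX, seq_assoc]
      · exact Or.inr (Or.inl ⟨D, hD, hDZ, fun X => by
          rw [plug_seq, plug_lift hZ, hX, seq_assoc]⟩)
      · exact Or.inr (Or.inr ⟨seq Z₀ Y', Z', W₁, W₂, a, b, c, d, by rw [e, seq_assoc], f⟩)
  | @par_right C Z₀ hC hZ ih =>
    intro Y Z h
    have h' := h
    rw [plug_par, plug_lift hZ] at h'
    rcases eq_one_of_par_eq_seq h' with h1 | rfl | hY | hZ'
    · exact absurd h1 (plug_ne_one hC hW1)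
    · rw [lift_one, par_one] at h ⊢
      exact ih h
    · exact triv (SPCtx.par_right hC hZ) h (Or.inl hY)
    · exact triv (SPCtx.par_right hC hZ) h (Or.inr hZ')

end Pom

/-! ### Composition of contexts, and the algebra of pomset languages -/

namespace Pom

variable {α : Type u}

/-- Only the action of the composite context matters, so it is built by recursion on the outer one
rather than as a substitution of contexts. -/
theorem exists_comp {D C : Pom (Option α)} (hD : SPCtx D) (hC : SPCtx C) :
    ∃ E, SPCtx E ∧ ∀ U, plug E U = plug D (plug C U) := by
  induction hD with
  | gap => exact ⟨C, hC, fun U => (plug_gap _).symm⟩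
  | @seq_right _ Z _ hZ ih =>
    obtain ⟨E, hE, h⟩ := ih
    exact ⟨_, SPCtx.seq_right hE hZ, fun U => by
      rw [plug_seq, plug_seq, plug_lift hZ, plug_lift hZ, h]⟩
  | seq_left hZ _ ih =>
    obtain ⟨E, hE, h⟩ := ih
    exact ⟨_, SPCtx.seq_left hZ hE, fun U => by
      rw [plug_seq, plug_seq, plug_lift hZ, plug_lift hZ, h]⟩
  | par_right _ hZ ih =>
    obtain ⟨E, hE, h⟩ := ih
    exact ⟨_, SPCtx.par_right hE hZ, fun U => by
      rw [plug_par, plug_par, plug_lift hZ, plug_lift hZ, h]⟩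

theorem seqL_assoc (L K M : Set (Pom α)) : seqL (seqL L K) M = seqL L (seqL K M) :=
  Set.image2_assoc seq_assoc

theorem seqL_one (L : Set (Pom α)) : seqL L {one} = L := by
  rw [seqL, Set.image2_singleton_right]
  simp [seq_one]

theorem one_seqL (L : Set (Pom α)) : seqL {one} L = L := by
  rw [seqL, Set.image2_singleton_left]
  simp [one_seq]

theorem powL_succ' (L : Set (Pom α)) (n : ℕ) : powL L (n + 1) = seqL L (powL L n) := by
  induction n with
  | zero => exact (one_seqL L).trans (seqL_one L).symm
  | succ n ih =>
    calc seqL (powL L (n + 1)) L = seqL (seqL L (powL L n)) L := by rw [ih]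
      _ = seqL L (powL L (n + 1)) := seqL_assoc _ _ _

theorem one_mem_starL (L : Set (Pom α)) : one ∈ starL L := Set.mem_iUnion.mpr ⟨0, rfl⟩

theorem starL_unfold_left (L : Set (Pom α)) : {one} ∪ seqL L (starL L) = starL L := by
  ext X
  constructor
  · rintro (rfl | ⟨A, hA, B, hB, rfl⟩)
    · exact one_mem_starL L
    · obtain ⟨n, hn⟩ := Set.mem_iUnion.mp hB
      exact Set.mem_iUnion.mpr ⟨n + 1, powL_succ' L n ▸ Set.mem_image2_of_mem hA hn⟩
  · intro h
    obtain ⟨n, hn⟩ := Set.mem_iUnion.mp h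
    cases n with
    | zero => exact Or.inl hn
    | succ n =>
      rw [powL_succ'] at hn
      obtain ⟨A, hA, B, hB, rfl⟩ := hn
      exact Or.inr ⟨A, hA, B, Set.mem_iUnion.mpr ⟨n, hB⟩, rfl⟩

theorem starL_unfold_right (L : Set (Pom α)) : {one} ∪ seqL (starL L) L = starL L := by
  ext X
  constructor
  · rintro (rfl | ⟨A, hA, B, hB, rfl⟩)
    · exact one_mem_starL L
    · obtain ⟨n, hn⟩ := Set.mem_iUnion.mp hA
      exact Set.mem_iUnion.mpr ⟨n + 1, Set.mem_image2_of_mem hn hB⟩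
  · intro h
    obtain ⟨n, hn⟩ := Set.mem_iUnion.mp h
    cases n with
    | zero => exact Or.inl hn
    | succ n =>
      obtain ⟨A, hA, B, hB, rfl⟩ := hn
      exact Or.inr ⟨A, Set.mem_iUnion.mpr ⟨n, hA⟩, B, hB, rfl⟩

theorem seqL_starL_le {L K : Set (Pom α)} (h : seqL K L ⊆ K) : seqL K (starL L) ⊆ K := by
  have key : ∀ n, seqL K (powL L n) ⊆ K := by
    intro n
    induction n with
    | zero => exact (seqL_one K).subset
    | succ n ih =>
      rw [powL, ← seqL_assoc]
      exact (Set.image2_subset_right ih).trans h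
  rintro _ ⟨A, hA, B, hB, rfl⟩
  obtain ⟨n, hn⟩ := Set.mem_iUnion.mp hB
  exact key n (Set.mem_image2_of_mem hA hn)

theorem starL_seqL_le {L K : Set (Pom α)} (h : seqL L K ⊆ K) : seqL (starL L) K ⊆ K := by
  have key : ∀ n, seqL (powL L n) K ⊆ K := by
    intro n
    induction n with
    | zero => exact (one_seqL K).subset
    | succ n ih =>
      rw [powL, seqL_assoc]
      exact (Set.image2_subset_left h).trans ih
  rintro _ ⟨A, hA, B, hB, rfl⟩
  obtain ⟨n, hn⟩ := Set.mem_iUnion.mp hA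
  exact key n (Set.mem_image2_of_mem hn hB)

end Pom

section StrongReduction

open Pom Computability

/-! ### Closure, and soundness of provable equivalence -/

section Closure

variable {α : Type u}

theorem sp_of_mem_powL {L : Set (Pom α)} (hL : ∀ X ∈ L, SP X) (n : ℕ) : ∀ X ∈ powL L n, SP X := by
  induction n with
  | zero => rintro _ rfl; exact SP.one
  | succ n ih => rintro _ ⟨A, hA, B, hB, rfl⟩; exact SP.seq (ih A hA) (hL B hB)

theorem Term.sp_of_mem_sem (e : Term α) : ∀ X ∈ e.sem, SP X := by
  induction e with
  | zero => rintro _ ⟨⟩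
  | one => rintro _ rfl; exact SP.one
  | letter a => rintro _ rfl; exact SP.letter a
  | add e f ihe ihf => exact fun X hX => hX.elim (ihe X) (ihf X)
  | seq e f ihe ihf => rintro _ ⟨A, hA, B, hB, rfl⟩; exact SP.seq (ihe A hA) (ihf B hB)
  | par e f ihe ihf => rintro _ ⟨A, hA, B, hB, rfl⟩; exact SP.par (ihe A hA) (ihf B hB)
  | star e ih =>
    intro X hX
    obtain ⟨n, hn⟩ := Set.mem_iUnion.mp hX
    exact sp_of_mem_powL ih n X hn

theorem KATerm.isWord_of_mem_sem (e : KATerm α) : ∀ X ∈ e.toTerm.sem, IsWord X := by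
  induction e with
  | zero => rintro _ ⟨⟩
  | one => rintro _ rfl; exact isWord_one
  | letter a => rintro _ rfl; exact isWord_letter a
  | add e f ihe ihf => exact fun X hX => hX.elim (ihe X) (ihf X)
  | seq e f ihe ihf =>
    rintro _ ⟨A, hA, B, hB, rfl⟩
    exact isWord_seq.mpr ⟨ihe A hA, ihf B hB⟩
  | star e ih =>
    intro X hX
    obtain ⟨n, hn⟩ := Set.mem_iUnion.mp hX
    induction n generalizing X with
    | zero => obtain rfl := hn; exact isWord_one
    | succ n ihn =>
      obtain ⟨A, hA, B, hB, rfl⟩ := hn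
      exact isWord_seq.mpr ⟨ihn A (Set.mem_iUnion.mpr ⟨n, hA⟩) hA, ih B hB⟩

variable {H H' : Hyps α} {L K M : Set (Pom α)}

theorem subset_hypClosure : L ⊆ Closure H L := fun _ h => Closure.base h

theorem hypClosure_min (h : L ⊆ Closure H K) : Closure H L ⊆ Closure H K := by
  intro X hX
  induction hX with
  | base hU => exact h hU
  | step hef hC _ hU ih => exact Closure.step hef hC ih hU

theorem hypClosure_mono (h : L ⊆ K) : Closure H L ⊆ Closure H K :=
  hypClosure_min (h.trans subset_hypClosure)

theorem hypClosure_congr (h : L ⊆ Closure H K) (k : K ⊆ Closure H L) : Closure H L = Closure H K :=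
  (hypClosure_min h).antisymm (hypClosure_min k)

theorem subset_hypClosure_of_eq (h : Closure H L = Closure H K) : L ⊆ Closure H K :=
  h ▸ subset_hypClosure

theorem sp_of_mem_closure (hL : ∀ X ∈ L, SP X) : ∀ X ∈ Closure H L, SP X := by
  intro X hX
  induction hX with
  | base hU => exact hL _ hU
  | step _ hC _ hU _ => exact SP.plug (isSPContext_iff.mp hC) (Term.sp_of_mem_sem _ _ hU)

/-- A derivation can be carried out inside `D`, because the composite of two series-parallel
contexts is one again. -/
theorem plug_mem_closure {D : Pom (Option α)} (hD : SPCtx D)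
    (h : ∀ Y ∈ L, plug D Y ∈ Closure H K) {X : Pom α} (hX : X ∈ Closure H L) :
    plug D X ∈ Closure H K := by
  induction hX with
  | base hU => exact h _ hU
  | @step e f C U hef hC _ hU ih =>
    obtain ⟨E, hE, hp⟩ := exists_comp hD (isSPContext_iff.mp hC)
    rw [← hp]
    refine Closure.step hef (isSPContext_iff.mpr hE) (fun V hV => ?_) hU
    rw [hp]
    exact ih V hV

/-- The factors are treated one at a time, the other one serving as a context; this is why
series-parallel elements are required. -/
theorem seq_mem_closure (hL : ∀ X ∈ L, SP X) (hK : ∀ X ∈ K, SP X) {X Z : Pom α}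
    (hX : X ∈ Closure H L) (hZ : Z ∈ Closure H K) : seq X Z ∈ Closure H (seqL L K) := by
  have hXS := sp_of_mem_closure hL X hX
  have := plug_mem_closure (SPCtx.seq_left hXS SPCtx.gap) (K := seqL L K) (fun Y hY => ?_) hZ
  · rwa [plug_seq, plug_lift hXS, plug_gap] at this
  · have := plug_mem_closure (SPCtx.seq_right SPCtx.gap (hK Y hY)) (K := seqL L K)
      (fun A hA => ?_) hX
    · rw [plug_seq, plug_lift (hK Y hY), plug_gap] at this
      rwa [plug_seq, plug_lift hXS, plug_gap]
    · rw [plug_seq, plug_lift (hK Y hY), plug_gap]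
      exact Closure.base (Set.mem_image2_of_mem hA hY)

theorem par_mem_closure (hL : ∀ X ∈ L, SP X) (hK : ∀ X ∈ K, SP X) {X Z : Pom α}
    (hX : X ∈ Closure H L) (hZ : Z ∈ Closure H K) : par X Z ∈ Closure H (parL L K) := by
  have hXS := sp_of_mem_closure hL X hX
  have := plug_mem_closure (SPCtx.par_right SPCtx.gap hXS) (K := parL L K) (fun Y hY => ?_) hZ
  · rwa [plug_par, plug_lift hXS, plug_gap, par_comm] at this
  · have := plug_mem_closure (SPCtx.par_right SPCtx.gap (hK Y hY)) (K := parL L K)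
      (fun A hA => ?_) hX
    · rw [plug_par, plug_lift (hK Y hY), plug_gap] at this
      rwa [plug_par, plug_lift hXS, plug_gap, par_comm]
    · rw [plug_par, plug_lift (hK Y hY), plug_gap]
      exact Closure.base (Set.mem_image2_of_mem hA hY)

theorem seqL_subset_closure {L' K' : Set (Pom α)} (hL : ∀ X ∈ L, SP X) (hK : ∀ X ∈ K, SP X)
    (h : L' ⊆ Closure H L) (k : K' ⊆ Closure H K) : seqL L' K' ⊆ Closure H (seqL L K) := by
  rintro _ ⟨A, hA, B, hB, rfl⟩
  exact seq_mem_closure hL hK (h hA) (k hB)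

theorem parL_subset_closure {L' K' : Set (Pom α)} (hL : ∀ X ∈ L, SP X) (hK : ∀ X ∈ K, SP X)
    (h : L' ⊆ Closure H L) (k : K' ⊆ Closure H K) : parL L' K' ⊆ Closure H (parL L K) := by
  rintro _ ⟨A, hA, B, hB, rfl⟩
  exact par_mem_closure hL hK (h hA) (k hB)

theorem starL_subset_closure {L' : Set (Pom α)} (hL : ∀ X ∈ L, SP X) (h : L' ⊆ Closure H L) :
    starL L' ⊆ Closure H (starL L) := by
  have key : ∀ n, powL L' n ⊆ Closure H (powL L n) := by
    intro n
    induction n with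
    | zero => exact subset_hypClosure
    | succ n ih => exact seqL_subset_closure (sp_of_mem_powL hL n) hL ih h
  exact Set.iUnion_subset fun n => (key n).trans (hypClosure_mono (Set.subset_iUnion _ n))

/-- Provable equivalence is sound for closed languages. -/
theorem TermEquiv.closure_sem_eq {e f : Term α} (h : TermEquiv H e f) :
    Closure H e.sem = Closure H f.sem := by
  induction h with
  | refl => rfl
  | symm _ ih => exact ih.symm
  | trans _ _ ih ih' => exact ih.trans ih'
  | congr_add _ _ ih ih' =>
    exact hypClosure_congr
      (Set.union_subset ((subset_hypClosure_of_eq ih).trans (hypClosure_mono Set.subset_union_left))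
        ((subset_hypClosure_of_eq ih').trans (hypClosure_mono Set.subset_union_right)))
      (Set.union_subset
        ((subset_hypClosure_of_eq ih.symm).trans (hypClosure_mono Set.subset_union_left))
        ((subset_hypClosure_of_eq ih'.symm).trans (hypClosure_mono Set.subset_union_right)))
  | congr_seq _ _ ih ih' =>
    exact hypClosure_congr
      (seqL_subset_closure (Term.sp_of_mem_sem _) (Term.sp_of_mem_sem _)
        (subset_hypClosure_of_eq ih) (subset_hypClosure_of_eq ih'))
      (seqL_subset_closure (Term.sp_of_mem_sem _) (Term.sp_of_mem_sem _)
        (subset_hypClosure_of_eq ih.symm) (subset_hypClosure_of_eq ih'.symm))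
  | congr_par _ _ ih ih' =>
    exact hypClosure_congr
      (parL_subset_closure (Term.sp_of_mem_sem _) (Term.sp_of_mem_sem _)
        (subset_hypClosure_of_eq ih) (subset_hypClosure_of_eq ih'))
      (parL_subset_closure (Term.sp_of_mem_sem _) (Term.sp_of_mem_sem _)
        (subset_hypClosure_of_eq ih.symm) (subset_hypClosure_of_eq ih'.symm))
  | congr_star _ ih =>
    exact hypClosure_congr
      (starL_subset_closure (Term.sp_of_mem_sem _) (subset_hypClosure_of_eq ih))
      (starL_subset_closure (Term.sp_of_mem_sem _) (subset_hypClosure_of_eq ih.symm))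
  | add_zero e => exact congrArg _ (Set.union_empty _)
  | add_idem e => exact congrArg _ (Set.union_self _)
  | add_comm e f => exact congrArg _ (Set.union_comm _ _)
  | add_assoc e f g => exact congrArg _ (Set.union_assoc _ _ _).symm
  | seq_assoc e f g => exact congrArg _ (seqL_assoc _ _ _).symm
  | seq_add e f g => exact congrArg _ Set.image2_union_right
  | add_seq e f g => exact congrArg _ Set.image2_union_left
  | seq_one e => exact congrArg _ (seqL_one _)
  | one_seq e => exact congrArg _ (one_seqL _)
  | seq_zero e => exact congrArg _ Set.image2_empty_right
  | zero_seq e => exact congrArg _ Set.image2_empty_left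
  | par_comm e f => exact congrArg _ (Set.image2_comm Pom.par_comm)
  | par_one e =>
    refine congrArg _ ?_
    simp [Term.sem, parL, Set.image2_singleton_right, Pom.par_one]
  | par_zero e => exact congrArg _ Set.image2_empty_right
  | par_assoc e f g => exact congrArg _ (Set.image2_assoc Pom.par_assoc).symm
  | par_add e f g => exact congrArg _ Set.image2_union_right
  | star_unfold_left e => exact congrArg _ (starL_unfold_left _)
  | star_unfold_right e => exact congrArg _ (starL_unfold_right _)
  | @lfp_left e f g _ ih =>
    have h := subset_hypClosure_of_eq ih
    -- The closed language of `g` absorbs the language of `f` on the left, hence also all its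
    -- powers.
    have hfg : seqL f.sem (Closure H g.sem) ⊆ Closure H g.sem :=
      (seqL_subset_closure (Term.sp_of_mem_sem _) (Term.sp_of_mem_sem _) subset_hypClosure
        subset_rfl).trans
        (hypClosure_min (Set.subset_union_right.trans (Set.subset_union_left.trans h)))
    refine hypClosure_congr (Set.union_subset ?_ subset_hypClosure)
      (Set.subset_union_right.trans subset_hypClosure)
    exact (Set.image2_subset_left
      (Set.subset_union_left.trans (Set.subset_union_left.trans h))).trans (starL_seqL_le hfg)
  | @lfp_right e f g _ ih =>
    have h := subset_hypClosure_of_eq ih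
    have hfg : seqL (Closure H f.sem) g.sem ⊆ Closure H f.sem :=
      (seqL_subset_closure (Term.sp_of_mem_sem _) (Term.sp_of_mem_sem _) subset_rfl
        subset_hypClosure).trans
        (hypClosure_min (Set.subset_union_right.trans (Set.subset_union_left.trans h)))
    refine hypClosure_congr (Set.union_subset ?_ subset_hypClosure)
      (Set.subset_union_right.trans subset_hypClosure)
    exact (Set.image2_subset_right
      (Set.subset_union_left.trans (Set.subset_union_left.trans h))).trans (seqL_starL_le hfg)
  | @hyp e f hef =>
    refine hypClosure_congr (Set.union_subset (fun U hU => ?_) subset_hypClosure)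
      (Set.subset_union_right.trans subset_hypClosure)
    rw [← plug_gap U]
    exact Closure.step hef (isSPContext_iff.mpr SPCtx.gap)
      (fun V hV => by rw [plug_gap]; exact Closure.base hV) hU

theorem TermLE.sem_subset {e f : Term α} (h : TermLE H e f) : e.sem ⊆ Closure H f.sem :=
  Set.subset_union_left.trans (subset_hypClosure_of_eq (TermEquiv.closure_sem_eq h))

/-- By soundness, a step of `H'` is a derivation in the `H`-closure, and this derivation can be
carried out inside the context of the step. -/
theorem Implies.closure_subset (h : Implies H H') : Closure H' L ⊆ Closure H L := by
  intro X hX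
  induction hX with
  | base hU => exact Closure.base hU
  | step hef hC _ hU ih =>
    exact plug_mem_closure (isSPContext_iff.mp hC) ih (TermLE.sem_subset (h _ _ hef) hU)

theorem seqClosure_subset_hypClosure : SeqClosure H L ⊆ Closure H L := by
  intro X hX
  induction hX with
  | base hU => exact Closure.base hU
  | step hef hC _ hU ih => exact Closure.step hef hC.1 ih hU

end Closure

/-! ### Terms modulo provable equivalence as a Kleene algebra -/

section Quotient

variable {α : Type u}

/-- These operations let Kleene's algorithm run on both kinds of terms as well as on classes and
languages. -/
instance : One (Term α) := ⟨Term.one⟩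
instance : Add (Term α) := ⟨Term.add⟩
instance : Mul (Term α) := ⟨Term.seq⟩
instance : KStar (Term α) := ⟨Term.star⟩
instance : One (KATerm α) := ⟨KATerm.one⟩
instance : Add (KATerm α) := ⟨KATerm.add⟩
instance : Mul (KATerm α) := ⟨KATerm.seq⟩
instance : KStar (KATerm α) := ⟨KATerm.star⟩

/-- Provable equivalence as a setoid. -/
def termSetoid (H : Hyps α) : Setoid (Term α) :=
  ⟨TermEquiv H, TermEquiv.refl, TermEquiv.symm, TermEquiv.trans⟩

/-- Terms modulo provable equivalence. -/
def TermQuot (H : Hyps α) : Type u := Quotient (termSetoid H)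

namespace TermQuot

variable {H : Hyps α}

/-- The class of a term. -/
def mk (H : Hyps α) (e : Term α) : TermQuot H := Quotient.mk (termSetoid H) e

theorem mk_eq {e f : Term α} : mk H e = mk H f ↔ TermEquiv H e f :=
  Quotient.eq (r := termSetoid H)

instance : Zero (TermQuot H) := ⟨mk H Term.zero⟩
instance : One (TermQuot H) := ⟨mk H 1⟩
instance : Add (TermQuot H) :=
  ⟨Quotient.map₂ Term.add fun _ _ h _ _ k => TermEquiv.congr_add h k⟩
instance : Mul (TermQuot H) :=
  ⟨Quotient.map₂ Term.seq fun _ _ h _ _ k => TermEquiv.congr_seq h k⟩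
instance : KStar (TermQuot H) := ⟨Quotient.map Term.star fun _ _ h => TermEquiv.congr_star h⟩

/-- Parallel composition of classes. -/
def par : TermQuot H → TermQuot H → TermQuot H :=
  Quotient.map₂ Term.par fun _ _ h _ _ k => TermEquiv.congr_par h k

theorem mk_zero : mk H Term.zero = 0 := rfl
theorem mk_add (e f : Term α) : mk H (e + f) = mk H e + mk H f := rfl
theorem mk_par (e f : Term α) : mk H (Term.par e f) = par (mk H e) (mk H f) := rfl

theorem exists_mk (x : TermQuot H) : ∃ e, x = mk H e := by
  induction x using Quotient.ind with | _ e => exact ⟨e, rfl⟩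

instance : Semiring (TermQuot H) where
  add_assoc x y z := by
    obtain ⟨e, rfl⟩ := exists_mk x
    obtain ⟨f, rfl⟩ := exists_mk y
    obtain ⟨g, rfl⟩ := exists_mk z
    exact mk_eq.mpr (TermEquiv.add_assoc e f g).symm
  zero_add x := by
    obtain ⟨e, rfl⟩ := exists_mk x
    exact mk_eq.mpr ((TermEquiv.add_comm _ e).trans (TermEquiv.add_zero e))
  add_zero x := by
    obtain ⟨e, rfl⟩ := exists_mk x
    exact mk_eq.mpr (TermEquiv.add_zero e)
  add_comm x y := by
    obtain ⟨e, rfl⟩ := exists_mk x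
    obtain ⟨f, rfl⟩ := exists_mk y
    exact mk_eq.mpr (TermEquiv.add_comm e f)
  nsmul := nsmulRec
  left_distrib x y z := by
    obtain ⟨e, rfl⟩ := exists_mk x
    obtain ⟨f, rfl⟩ := exists_mk y
    obtain ⟨g, rfl⟩ := exists_mk z
    exact mk_eq.mpr (TermEquiv.seq_add e f g)
  right_distrib x y z := by
    obtain ⟨e, rfl⟩ := exists_mk x
    obtain ⟨f, rfl⟩ := exists_mk y
    obtain ⟨g, rfl⟩ := exists_mk z
    exact mk_eq.mpr (TermEquiv.add_seq e f g)
  zero_mul x := by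
    obtain ⟨e, rfl⟩ := exists_mk x
    exact mk_eq.mpr (TermEquiv.zero_seq e)
  mul_zero x := by
    obtain ⟨e, rfl⟩ := exists_mk x
    exact mk_eq.mpr (TermEquiv.seq_zero e)
  mul_assoc x y z := by
    obtain ⟨e, rfl⟩ := exists_mk x
    obtain ⟨f, rfl⟩ := exists_mk y
    obtain ⟨g, rfl⟩ := exists_mk z
    exact mk_eq.mpr (TermEquiv.seq_assoc e f g).symm
  one_mul x := by
    obtain ⟨e, rfl⟩ := exists_mk x
    exact mk_eq.mpr (TermEquiv.one_seq e)
  mul_one x := by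
    obtain ⟨e, rfl⟩ := exists_mk x
    exact mk_eq.mpr (TermEquiv.seq_one e)

instance : IdemSemiring (TermQuot H) := IdemSemiring.ofSemiring fun x => by
  obtain ⟨e, rfl⟩ := exists_mk x
  exact mk_eq.mpr (TermEquiv.add_idem e)

/-- `IdemSemiring.ofSemiring` defines its order by `a + b = b`, which is how `TermLE` is defined. -/
theorem mk_le {e f : Term α} : mk H e ≤ mk H f ↔ TermLE H e f := mk_eq

theorem one_add_mul_kstar (x : TermQuot H) : 1 + x * x∗ = x∗ := by
  obtain ⟨e, rfl⟩ := exists_mk x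
  exact mk_eq.mpr (TermEquiv.star_unfold_left e)

theorem one_add_kstar_mul (x : TermQuot H) : 1 + x∗ * x = x∗ := by
  obtain ⟨e, rfl⟩ := exists_mk x
  exact mk_eq.mpr (TermEquiv.star_unfold_right e)

instance : KleeneAlgebra (TermQuot H) where
  one_le_kstar x := by
    conv_rhs => rw [← one_add_mul_kstar]
    rw [add_eq_sup]
    exact le_sup_left
  mul_kstar_le_kstar x := by
    conv_rhs => rw [← one_add_mul_kstar]
    rw [add_eq_sup]
    exact le_sup_right
  kstar_mul_le_kstar x := by
    conv_rhs => rw [← one_add_kstar_mul]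
    rw [add_eq_sup]
    exact le_sup_right
  mul_kstar_le_self x y h := by
    -- The induction axiom for terms carries an additive part; here that part is `y` itself.
    have h' : y + y * x ≤ y := by
      rw [add_eq_sup]
      exact sup_le le_rfl h
    obtain ⟨e, rfl⟩ := exists_mk x
    obtain ⟨f, rfl⟩ := exists_mk y
    exact mk_le.mpr (TermEquiv.lfp_right (mk_le.mp h'))
  kstar_mul_le_self x y h := by
    have h' : y + x * y ≤ y := by
      rw [add_eq_sup]
      exact sup_le le_rfl h
    obtain ⟨e, rfl⟩ := exists_mk x
    obtain ⟨f, rfl⟩ := exists_mk y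
    exact mk_le.mpr (TermEquiv.lfp_left (mk_le.mp h'))

theorem par_add (x y z : TermQuot H) : par x (y + z) = par x y + par x z := by
  obtain ⟨e, rfl⟩ := exists_mk x
  obtain ⟨f, rfl⟩ := exists_mk y
  obtain ⟨g, rfl⟩ := exists_mk z
  exact mk_eq.mpr (TermEquiv.par_add e f g)

theorem par_comm (x y : TermQuot H) : par x y = par y x := by
  obtain ⟨e, rfl⟩ := exists_mk x
  obtain ⟨f, rfl⟩ := exists_mk y
  exact mk_eq.mpr (TermEquiv.par_comm e f)

theorem par_assoc (x y z : TermQuot H) : par (par x y) z = par x (par y z) := by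
  obtain ⟨e, rfl⟩ := exists_mk x
  obtain ⟨f, rfl⟩ := exists_mk y
  obtain ⟨g, rfl⟩ := exists_mk z
  exact mk_eq.mpr (TermEquiv.par_assoc e f g).symm

theorem par_one (x : TermQuot H) : par x 1 = x := by
  obtain ⟨e, rfl⟩ := exists_mk x
  exact mk_eq.mpr (TermEquiv.par_one e)

theorem one_par (x : TermQuot H) : par 1 x = x := by rw [par_comm, par_one]

theorem par_zero (x : TermQuot H) : par x 0 = 0 := by
  obtain ⟨e, rfl⟩ := exists_mk x
  exact mk_eq.mpr (TermEquiv.par_zero e)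

theorem par_le_par {x x' y y' : TermQuot H} (h : x ≤ x') (k : y ≤ y') :
    par x y ≤ par x' y' := by
  have mono : ∀ {a b b' : TermQuot H}, b ≤ b' → par a b ≤ par a b' := by
    intro a b b' hb
    rw [← add_eq_right_iff_le] at hb ⊢
    rw [← par_add, hb]
  refine (mono k).trans ?_
  rw [par_comm x, par_comm x']
  exact mono h

end TermQuot

end Quotient

/-! ### Pomsets as terms, and provability of membership in the closure -/

section PomTerm

variable {α : Type u} {H : Hyps α}

open TermQuot

/-- `PomTerm X t`: the term `t` is built from `1` and letters with the two compositions, and it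
denotes the pomset `X`. -/
inductive PomTerm : Pom α → Term α → Prop
  | one : PomTerm one Term.one
  | letter (a : α) : PomTerm (letter a) (Term.letter a)
  | seq {U V t s} : PomTerm U t → PomTerm V s → PomTerm (seq U V) (Term.seq t s)
  | par {U V t s} : PomTerm U t → PomTerm V s → PomTerm (par U V) (Term.par t s)

namespace PomTerm

theorem mk_eq_one {X : Pom α} {t : Term α} (h : PomTerm X t) : X = Pom.one → mk H t = 1 := by
  induction h with
  | one => exact fun _ => rfl
  | letter a => exact fun h => absurd h (letter_ne_one a)
  | @seq U V t s _ _ iht ihs =>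
    intro h
    change mk H t * mk H s = 1
    rw [iht (seq_eq_one.mp h).1, ihs (seq_eq_one.mp h).2, one_mul]
  | @par U V t s _ _ iht ihs =>
    intro h
    rw [mk_par, iht (par_eq_one.mp h).1, ihs (par_eq_one.mp h).2, TermQuot.par_one]

/-- Any factorisation of the pomset can be followed by provable rewriting of its term. Levi's lemma
serves the sequential case; in the parallel case some factor is empty and its term is provably `1`.
-/
theorem split_seq {X : Pom α} {t : Term α} (h : PomTerm X t) : ∀ {Y Z}, X = Pom.seq Y Z →
    ∃ s r, PomTerm Y s ∧ PomTerm Z r ∧ mk H t = mk H s * mk H r := by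
  induction h with
  | one =>
    intro Y Z h
    obtain ⟨rfl, rfl⟩ := seq_eq_one.mp h.symm
    exact ⟨_, _, one, one, (mul_one _).symm⟩
  | letter a =>
    intro Y Z h
    rcases letter_eq_seq h with ⟨rfl, rfl⟩ | ⟨rfl, rfl⟩
    · exact ⟨_, _, letter a, one, (mul_one _).symm⟩
    · exact ⟨_, _, one, letter a, (one_mul _).symm⟩
  | @seq U V t s ht hs iht ihs =>
    intro Y Z h
    rcases levi h with ⟨M, hU, rfl⟩ | ⟨M, rfl, hV⟩
    · obtain ⟨t₁, t₂, h1, h2, h3⟩ := iht hU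
      exact ⟨_, _, h1, h2.seq hs, by
        change mk H t * mk H s = mk H t₁ * (mk H t₂ * mk H s)
        rw [h3, mul_assoc]⟩
    · obtain ⟨s₁, s₂, h1, h2, h3⟩ := ihs hV
      exact ⟨_, _, ht.seq h1, h2, by
        change mk H t * mk H s = (mk H t * mk H s₁) * mk H s₂
        rw [h3, mul_assoc]⟩
  | @par U V t s ht hs iht ihs =>
    intro Y Z h
    rcases eq_one_of_par_eq_seq h with rfl | rfl | rfl | rfl
    · obtain ⟨s₁, s₂, h1, h2, h3⟩ := ihs (by rw [← h, Pom.one_par])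
      exact ⟨s₁, s₂, h1, h2, by rw [mk_par, ht.mk_eq_one rfl, TermQuot.one_par, h3]⟩
    · obtain ⟨s₁, s₂, h1, h2, h3⟩ := iht (by rw [← h, Pom.par_one])
      exact ⟨s₁, s₂, h1, h2, by rw [mk_par, hs.mk_eq_one rfl, TermQuot.par_one, h3]⟩
    · rw [Pom.one_seq] at h
      exact ⟨_, _, one, h ▸ ht.par hs, (one_mul _).symm⟩
    · rw [Pom.seq_one] at h
      exact ⟨_, _, h ▸ ht.par hs, one, (mul_one _).symm⟩

theorem split_par {X : Pom α} {t : Term α} (h : PomTerm X t) : ∀ {Y Z}, X = Pom.par Y Z →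
    ∃ s r, PomTerm Y s ∧ PomTerm Z r ∧ mk H t = TermQuot.par (mk H s) (mk H r) := by
  induction h with
  | one =>
    intro Y Z h
    obtain ⟨rfl, rfl⟩ := par_eq_one.mp h.symm
    exact ⟨_, _, one, one, (TermQuot.par_one _).symm⟩
  | letter a =>
    intro Y Z h
    rcases letter_eq_par h with ⟨rfl, rfl⟩ | ⟨rfl, rfl⟩
    · exact ⟨_, _, letter a, one, (TermQuot.par_one _).symm⟩
    · exact ⟨_, _, one, letter a, (TermQuot.one_par _).symm⟩
  | @par U V t s ht hs iht ihs =>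
    intro Y Z h
    obtain ⟨P, Q, R, S, hU, hV, rfl, rfl⟩ := riesz h
    obtain ⟨t₁, t₂, h1, h2, h3⟩ := iht hU
    obtain ⟨s₁, s₂, k1, k2, k3⟩ := ihs hV
    refine ⟨_, _, h1.par k1, h2.par k2, ?_⟩
    simp only [mk_par, h3, k3]
    rw [TermQuot.par_assoc, TermQuot.par_assoc, ← TermQuot.par_assoc (mk H t₂),
      TermQuot.par_comm (mk H t₂) (mk H s₁), TermQuot.par_assoc (mk H s₁)]
  | @seq U V t s ht hs iht ihs =>
    intro Y Z h
    rcases eq_one_of_par_eq_seq h.symm with rfl | rfl | rfl | rfl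
    · rw [Pom.one_par] at h
      exact ⟨_, _, one, h ▸ ht.seq hs, (TermQuot.one_par _).symm⟩
    · rw [Pom.par_one] at h
      exact ⟨_, _, h ▸ ht.seq hs, one, (TermQuot.par_one _).symm⟩
    · obtain ⟨s₁, s₂, h1, h2, h3⟩ := ihs (by rw [← h, Pom.one_seq])
      refine ⟨s₁, s₂, h1, h2, ?_⟩
      change mk H t * mk H s = _
      rw [ht.mk_eq_one rfl, one_mul, h3]
    · obtain ⟨s₁, s₂, h1, h2, h3⟩ := iht (by rw [← h, Pom.seq_one])
      refine ⟨s₁, s₂, h1, h2, ?_⟩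
      change mk H t * mk H s = _
      rw [hs.mk_eq_one rfl, mul_one, h3]

theorem mk_eq_letter {X : Pom α} {t : Term α} (h : PomTerm X t) {a : α} :
    X = Pom.letter a → mk H t = mk H (Term.letter a) := by
  induction h with
  | one => exact fun h => absurd h.symm (letter_ne_one a)
  | letter b =>
    intro h
    obtain ⟨k, kl⟩ := iso_of_mk_eq (x := LPoset.letter b) (y := LPoset.letter a) h
    obtain rfl : a = b := kl ()
    rfl
  | @seq U V t s ht hs iht ihs =>
    intro h
    change mk H t * mk H s = _
    rcases letter_eq_seq h.symm with ⟨hU, hV⟩ | ⟨hU, hV⟩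
    · rw [iht hU, hs.mk_eq_one hV, mul_one]
    · rw [ht.mk_eq_one hU, ihs hV, one_mul]
  | @par U V t s ht hs iht ihs =>
    intro h
    rw [mk_par]
    rcases letter_eq_par h.symm with ⟨hU, hV⟩ | ⟨hU, hV⟩
    · rw [iht hU, hs.mk_eq_one hV, TermQuot.par_one]
    · rw [ht.mk_eq_one hU, ihs hV, TermQuot.one_par]

/-- All terms for the same pomset are provably equivalent. -/
theorem mk_eq_mk {X : Pom α} {t t' : Term α} (h : PomTerm X t) (h' : PomTerm X t') :
    mk H t = mk H t' := by
  induction h generalizing t' with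
  | one => exact (h'.mk_eq_one rfl).symm
  | letter a => exact (h'.mk_eq_letter rfl).symm
  | @seq U V t s ht hs iht ihs =>
    obtain ⟨t₁, s₁, h1, h2, h3⟩ := h'.split_seq (H := H) rfl
    rw [h3, ← iht h1, ← ihs h2]
    rfl
  | @par U V t s ht hs iht ihs =>
    obtain ⟨t₁, s₁, h1, h2, h3⟩ := h'.split_par (H := H) rfl
    rw [h3, ← iht h1, ← ihs h2]
    rfl

theorem exists_of_sp {X : Pom α} (h : SP X) : ∃ t, PomTerm X t := by
  induction h with
  | one => exact ⟨_, one⟩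
  | letter a => exact ⟨_, letter a⟩
  | seq _ _ ihU ihV =>
    obtain ⟨t, ht⟩ := ihU
    obtain ⟨s, hs⟩ := ihV
    exact ⟨_, ht.seq hs⟩
  | par _ _ ihU ihV =>
    obtain ⟨t, ht⟩ := ihU
    obtain ⟨s, hs⟩ := ihV
    exact ⟨_, ht.par hs⟩

theorem exists_le_of_mem_powL {L : Set (Pom α)} {x : TermQuot H}
    (h : ∀ X ∈ L, ∃ t, PomTerm X t ∧ mk H t ≤ x) (n : ℕ) :
    ∀ X ∈ powL L n, ∃ t, PomTerm X t ∧ mk H t ≤ x∗ := by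
  induction n with
  | zero =>
    rintro _ rfl
    exact ⟨_, one, one_le_kstar⟩
  | succ n ih =>
    rintro _ ⟨A, hA, B, hB, rfl⟩
    obtain ⟨t, ht, hte⟩ := ih A hA
    obtain ⟨s, hs, hse⟩ := h B hB
    exact ⟨_, ht.seq hs, (mul_le_mul' hte hse).trans kstar_mul_le_kstar⟩

theorem exists_le_of_mem_sem (e : Term α) :
    ∀ X ∈ e.sem, ∃ t, PomTerm X t ∧ mk H t ≤ mk H e := by
  induction e with
  | zero => rintro _ ⟨⟩
  | one => rintro _ rfl; exact ⟨_, one, le_rfl⟩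
  | letter a => rintro _ rfl; exact ⟨_, letter a, le_rfl⟩
  | add e f ihe ihf =>
    rintro X (hX | hX)
    · obtain ⟨t, ht, hte⟩ := ihe X hX
      exact ⟨t, ht, hte.trans (add_le_iff.mp (le_refl (TermQuot.mk H e + TermQuot.mk H f))).1⟩
    · obtain ⟨t, ht, hte⟩ := ihf X hX
      exact ⟨t, ht, hte.trans (add_le_iff.mp (le_refl (TermQuot.mk H e + TermQuot.mk H f))).2⟩
  | seq e f ihe ihf =>
    rintro _ ⟨A, hA, B, hB, rfl⟩
    obtain ⟨t, ht, hte⟩ := ihe A hA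
    obtain ⟨s, hs, hse⟩ := ihf B hB
    exact ⟨_, ht.seq hs, mul_le_mul' hte hse⟩
  | par e f ihe ihf =>
    rintro _ ⟨A, hA, B, hB, rfl⟩
    obtain ⟨t, ht, hte⟩ := ihe A hA
    obtain ⟨s, hs, hse⟩ := ihf B hB
    exact ⟨_, ht.par hs, par_le_par hte hse⟩
  | star e ih =>
    intro X hX
    obtain ⟨n, hn⟩ := Set.mem_iUnion.mp hX
    exact exists_le_of_mem_powL ih n X hn

theorem mk_le_of_mem_sem {X : Pom α} {t e : Term α} (h : PomTerm X t) (hX : X ∈ e.sem) :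
    mk H t ≤ mk H e := by
  obtain ⟨s, hs, hse⟩ := exists_le_of_mem_sem (H := H) e X hX
  exact (h.mk_eq_mk hs).trans_le hse

/-- Contexts act on classes of terms. -/
theorem exists_plug {C : Pom (Option α)} (hC : SPCtx C) : ∃ c : TermQuot H → TermQuot H,
    Monotone c ∧ ∀ V v, PomTerm V v → ∃ t, PomTerm (plug C V) t ∧ mk H t = c (mk H v) := by
  induction hC with
  | gap => exact ⟨id, monotone_id, fun V v hv => ⟨v, (plug_gap V).symm ▸ hv, rfl⟩⟩
  | seq_right _ hZ ih =>
    obtain ⟨c, hc, h⟩ := ih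
    obtain ⟨z, hz⟩ := exists_of_sp hZ
    refine ⟨fun x => c x * mk H z, fun x y hxy => mul_le_mul' (hc hxy) le_rfl, fun V v hv => ?_⟩
    obtain ⟨t, ht, hte⟩ := h V v hv
    rw [plug_seq, plug_lift hZ]
    exact ⟨_, ht.seq hz, congrArg (· * mk H z) hte⟩
  | seq_left hZ _ ih =>
    obtain ⟨c, hc, h⟩ := ih
    obtain ⟨z, hz⟩ := exists_of_sp hZ
    refine ⟨fun x => mk H z * c x, fun x y hxy => mul_le_mul' le_rfl (hc hxy), fun V v hv => ?_⟩
    obtain ⟨t, ht, hte⟩ := h V v hv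
    rw [plug_seq, plug_lift hZ]
    exact ⟨_, hz.seq ht, congrArg (mk H z * ·) hte⟩
  | par_right _ hZ ih =>
    obtain ⟨c, hc, h⟩ := ih
    obtain ⟨z, hz⟩ := exists_of_sp hZ
    refine ⟨fun x => TermQuot.par (c x) (mk H z), fun x y hxy => par_le_par (hc hxy) le_rfl,
      fun V v hv => ?_⟩
    obtain ⟨t, ht, hte⟩ := h V v hv
    rw [plug_par, plug_lift hZ]
    exact ⟨_, ht.par hz, congrArg (TermQuot.par · (mk H z)) hte⟩

end PomTerm

/-! Terms denoting a single word -/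

namespace Pom

/-- The number of points. -/
noncomputable def size : Pom α → ℕ :=
  Quotient.lift (fun x : LPoset α => Nat.card x.carrier)
    fun _ _ ⟨h, _⟩ => Nat.card_congr h.toEquiv

theorem size_seq (U V : Pom α) : size (seq U V) = size U + size V := by
  obtain ⟨u, rfl⟩ := exists_mk U
  obtain ⟨v, rfl⟩ := exists_mk V
  exact Nat.card_sum (α := u.carrier) (β := v.carrier)

theorem eq_one_of_size {U : Pom α} (h : size U = 0) : U = one := by
  obtain ⟨u, rfl⟩ := exists_mk U
  have : IsEmpty u.carrier := (Nat.card_eq_zero.mp h).resolve_right fun h => h.not_finite u.fin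
  exact mk_eq (LPoset.iso_of_surjective (v := LPoset.empty) (fun s => isEmptyElim s)
    (by rintro ⟨⟩) (fun s => isEmptyElim s) fun s => isEmptyElim s)

theorem seq_right_cancel {A B C : Pom α} (h : seq A C = seq B C) : A = B := by
  rcases levi h with ⟨M, hA, hM⟩ | ⟨M, hB, hM⟩
  · have h := congrArg size hM
    rw [size_seq] at h
    rw [hA, eq_one_of_size (by omega : size M = 0), seq_one]
  · have h := congrArg size hM
    rw [size_seq] at h
    rw [hB, eq_one_of_size (by omega : size M = 0), seq_one]

theorem seq_left_cancel {A B C : Pom α} (h : seq C A = seq C B) : A = B := by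
  rcases levi h with ⟨M, hA, hM⟩ | ⟨M, hB, hM⟩
  · have h := congrArg size hA
    rw [size_seq] at h
    rw [hM, eq_one_of_size (by omega : size M = 0), one_seq]
  · have h := congrArg size hB
    rw [size_seq] at h
    rw [hM, eq_one_of_size (by omega : size M = 0), one_seq]

end Pom

/-- Covers the products without elements in `KATerm.mk_le_of_sem_subset`, where there is no pomset
from which to read off the factors. -/
theorem KATerm.mk_le_of_sem_empty (e : KATerm α) (h : e.toTerm.sem = ∅) :
    TermQuot.mk H e.toTerm ≤ 0 := by
  induction e with
  | zero => exact le_rfl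
  | one => exact absurd h (Set.singleton_ne_empty _)
  | letter a => exact absurd h (Set.singleton_ne_empty _)
  | add e f ihe ihf =>
    obtain ⟨he, hf⟩ := Set.union_empty_iff.mp h
    exact add_le_iff.mpr ⟨ihe he, ihf hf⟩
  | seq e f ihe ihf =>
    rcases Set.image2_eq_empty_iff.mp h with h | h
    · exact (mul_le_mul' (ihe h) le_rfl).trans_eq (zero_mul (TermQuot.mk H f.toTerm))
    · exact (mul_le_mul' le_rfl (ihf h)).trans_eq (mul_zero (TermQuot.mk H e.toTerm))
  | star e ih => exact (h.subset (one_mem_starL e.toTerm.sem)).elim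

/-- A Kleene algebra term that denotes at most one pomset lies below the term for it. -/
theorem KATerm.mk_le_of_sem_subset (e : KATerm α) : ∀ {W : Pom α} {w : Term α}, PomTerm W w →
    e.toTerm.sem ⊆ {W} → TermQuot.mk H e.toTerm ≤ TermQuot.mk H w := by
  induction e with
  | zero => exact fun _ _ => bot_le
  | one =>
    intro W w hw h
    obtain rfl : Pom.one = W := h rfl
    exact (PomTerm.one.mk_eq_mk hw).le
  | letter a =>
    intro W w hw h
    obtain rfl : Pom.letter a = W := h rfl
    exact ((PomTerm.letter a).mk_eq_mk hw).le
  | add e f ihe ihf =>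
    intro W w hw h
    exact add_le_iff.mpr ⟨ihe hw (Set.subset_union_left.trans h),
      ihf hw (Set.subset_union_right.trans h)⟩
  | seq e f ihe ihf =>
    intro W w hw h
    -- If the product has an element `A · B`, then cancellation confines each factor to at most one
    -- pomset.
    rcases (KATerm.seq e f).toTerm.sem.eq_empty_or_nonempty with h0 | ⟨_, A, hA, B, hB, rfl⟩
    · exact (KATerm.mk_le_of_sem_empty _ h0).trans bot_le
    · obtain rfl : Pom.seq A B = W := h (Set.mem_image2_of_mem hA hB)
      obtain ⟨t, s, ht, hs, hts⟩ := hw.split_seq (H := H) rfl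
      rw [hts]
      exact mul_le_mul'
        (ihe ht fun A' hA' => seq_right_cancel (h (Set.mem_image2_of_mem hA' hB)))
        (ihf hs fun B' hB' => seq_left_cancel (h (Set.mem_image2_of_mem hA hB')))
  | star e ih =>
    intro W w hw h
    -- A star contains `1`, so `W = 1`. Then `e ≤ 1`, and star induction gives the same bound for
    -- the star.
    obtain rfl : Pom.one = W := h (one_mem_starL _)
    have h1 : TermQuot.mk H e.toTerm ≤ 1 := ih PomTerm.one fun A hA =>
      h (Set.mem_iUnion.mpr ⟨1, Pom.one, rfl, A, hA, one_seq A⟩)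
    rw [hw.mk_eq_one rfl]
    exact (mul_one _).symm.trans_le (kstar_mul_le_self ((mul_one _).trans_le h1))

/-- Every pomset in the closure of the language of `e` lies provably below `e`. -/
theorem PomTerm.mk_le_of_mem_closure (hH : Grounded H) {X : Pom α} {e : Term α}
    (hX : X ∈ Closure H e.sem) : ∀ {t}, PomTerm X t → mk H t ≤ mk H e := by
  induction hX with
  | base hU => exact fun ht => ht.mk_le_of_mem_sem hU
  | @step d f C U hdf hC _ hU ih =>
    intro t ht
    obtain ⟨-, ⟨k, rfl⟩, W, -, -, hk⟩ := hH _ _ hdf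
    obtain ⟨c, hc, hp⟩ := exists_plug (H := H) (isSPContext_iff.mp hC)
    obtain ⟨u, hu, hud⟩ := exists_le_of_mem_sem (H := H) d U hU
    obtain ⟨t', ht', hte⟩ := hp U u hu
    have hW : W ∈ k.toTerm.sem := hk ▸ Set.mem_singleton W
    obtain ⟨w, hw⟩ := exists_of_sp (Term.sp_of_mem_sem _ W hW)
    obtain ⟨s, hs, hse⟩ := hp W w hw
    -- The step is replayed in the context: `u` is below `d`, which is below `k` by the hypothesis,
    -- which is below `w` because `k` denotes only `W`. The induction hypothesis for the filled
    -- context concludes.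
    calc mk H t = c (mk H u) := (ht.mk_eq_mk ht').trans hte
      _ ≤ c (mk H w) := hc (hud.trans ((mk_le.mpr (TermEquiv.hyp hdf)).trans
        (k.mk_le_of_sem_subset hw hk.subset)))
      _ = mk H s := hse.symm
      _ ≤ mk H e := ih W hW hs

end PomTerm

/-! ### Kleene's algorithm in an arbitrary Kleene algebra -/

section KleeneStar

/-- Kleene's algorithm: the regular expressions for the paths of an automaton with transition
labels `B` whose intermediate states belong to the given list. -/
def kleeneStar {T Q : Type*} [One T] [Add T] [Mul T] [KStar T] [DecidableEq Q] (B : Q → Q → T) :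
    List Q → Q → Q → T
  | [], p, q => if p = q then 1 + B p q else B p q
  | k :: l, p, q =>
    kleeneStar B l p q + kleeneStar B l p k * (kleeneStar B l k k)∗ * kleeneStar B l k q

/-- No axioms are involved, only compatibility with the operations; so the same expression can be
evaluated in terms, classes and languages. -/
theorem map_kleeneStar {T S Q : Type*} [One T] [Add T] [Mul T] [KStar T] [One S] [Add S] [Mul S]
    [KStar S] [DecidableEq Q] (φ : T → S) (h1 : φ 1 = 1) (hadd : ∀ x y, φ (x + y) = φ x + φ y)
    (hmul : ∀ x y, φ (x * y) = φ x * φ y) (hstar : ∀ x, φ (x∗) = (φ x)∗) (B : Q → Q → T)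
    (l : List Q) (p q : Q) :
    φ (kleeneStar B l p q) = kleeneStar (fun p q => φ (B p q)) l p q := by
  induction l generalizing p q with
  | nil =>
    simp only [kleeneStar]
    split_ifs
    · rw [hadd, h1]
    · rfl
  | cons k l ih => simp only [kleeneStar, hadd, hmul, hstar, ih]

variable {K Q : Type*} [KleeneAlgebra K] [DecidableEq Q] (B : Q → Q → K)

theorem one_le_kleeneStar (l : List Q) (p : Q) : 1 ≤ kleeneStar B l p p := by
  induction l with
  | nil => simp [kleeneStar]
  | cons k l ih => exact ih.trans (add_le_iff.mp le_rfl).1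

theorem le_kleeneStar (l : List Q) (p q : Q) : B p q ≤ kleeneStar B l p q := by
  induction l with
  | nil =>
    simp only [kleeneStar]
    split_ifs <;> simp
  | cons k l ih => exact ih.trans (add_le_iff.mp le_rfl).1

/-- Paths may be joined at `m` only if `m` is admitted as an intermediate state. For the full list
of states this is transitivity. -/
theorem kleeneStar_mul_le (l : List Q) {m : Q} (hm : m ∈ l) (p q : Q) :
    kleeneStar B l p m * kleeneStar B l m q ≤ kleeneStar B l p q := by
  induction l generalizing m p q with
  | nil => exact absurd hm List.not_mem_nil
  | cons k l ih =>
    simp only [kleeneStar]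
    set R := kleeneStar B l
    rcases List.mem_cons.mp hm with rfl | hm
    -- At the newly admitted state itself, loops on either side of the junction are absorbed into
    -- the star.
    · have e1 : R p m + R p m * (R m m)∗ * R m m ≤ R p m * (R m m)∗ := by
        refine add_le_iff.mpr ⟨?_, ?_⟩
        · exact (mul_one _).symm.trans_le (mul_le_mul' le_rfl one_le_kstar)
        · rw [mul_assoc]
          exact mul_le_mul' le_rfl kstar_mul_le_kstar
      have e2 : R m q + R m m * (R m m)∗ * R m q ≤ (R m m)∗ * R m q := by
        refine add_le_iff.mpr ⟨?_, ?_⟩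
        · exact (one_mul _).symm.trans_le (mul_le_mul' one_le_kstar le_rfl)
        · exact mul_le_mul' mul_kstar_le_kstar le_rfl
      refine (mul_le_mul' e1 e2).trans (le_trans ?_ (add_le_iff.mp le_rfl).2)
      rw [mul_assoc, ← mul_assoc (R m m)∗, kstar_mul_kstar, ← mul_assoc]
    · have e : ∀ p q, R p m * R m q ≤ R p q := fun p q => ih hm p q
      have a := (add_le_iff.mp (le_refl (R p q + R p k * (R k k)∗ * R k q)))
      rw [add_mul, mul_add, mul_add]
      refine add_le_iff.mpr ⟨add_le_iff.mpr ⟨(e p q).trans a.1, le_trans ?_ a.2⟩,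
        add_le_iff.mpr ⟨le_trans ?_ a.2, le_trans ?_ a.2⟩⟩
      · rw [← mul_assoc, ← mul_assoc]
        exact mul_le_mul' (mul_le_mul' (e p k) le_rfl) le_rfl
      · rw [mul_assoc]
        exact mul_le_mul' le_rfl (e k q)
      · calc R p k * (R k k)∗ * R k m * (R m k * (R k k)∗ * R k q)
            = R p k * (R k k)∗ * (R k m * R m k) * (R k k)∗ * R k q := by simp only [mul_assoc]
          _ ≤ R p k * (R k k)∗ * R k k * (R k k)∗ * R k q :=
            mul_le_mul' (mul_le_mul' (mul_le_mul' le_rfl (e k k)) le_rfl) le_rfl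
          _ = R p k * ((R k k)∗ * R k k) * (R k k)∗ * R k q := by simp only [mul_assoc]
          _ ≤ R p k * (R k k)∗ * (R k k)∗ * R k q :=
            mul_le_mul' (mul_le_mul' (mul_le_mul' le_rfl kstar_mul_le_kstar) le_rfl) le_rfl
          _ = R p k * (R k k)∗ * R k q := by rw [mul_assoc (R p k), kstar_mul_kstar]

/-- Minimality of the result: any vector that absorbs single transitions absorbs all paths, by star
induction at each newly admitted state. -/
theorem kleeneStar_mul_le_of_le {Y : Q → K} (hY : ∀ p q, B p q * Y q ≤ Y p) (l : List Q)
    (p q : Q) : kleeneStar B l p q * Y q ≤ Y p := by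
  induction l generalizing p q with
  | nil =>
    simp only [kleeneStar]
    split_ifs with h
    · subst h
      rw [add_mul, one_mul]
      exact add_le_iff.mpr ⟨le_rfl, hY p p⟩
    · exact hY p q
  | cons k l ih =>
    simp only [kleeneStar]
    rw [add_mul, mul_assoc, mul_assoc]
    exact add_le_iff.mpr ⟨ih p q, (mul_le_mul' le_rfl ((mul_le_mul' le_rfl (ih k q)).trans
      (kstar_mul_le_self (ih k k)))).trans (ih p k)⟩

end KleeneStar

/-! ### Kleene's algorithm for pomset languages and terms -/

section Languages

variable {α : Type u}

/-- With this product, `SetSemiring (Pom α)` is the semiring of pomset languages, to which the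
lemmas on `kleeneStar` apply. -/
instance : Monoid (Pom α) where
  mul := Pom.seq
  one := Pom.one
  mul_assoc := Pom.seq_assoc
  one_mul := Pom.one_seq
  mul_one := Pom.seq_one

noncomputable instance : KleeneAlgebra (SetSemiring (Pom α)) where
  kstar L := Set.up (starL (SetSemiring.down L))
  one_le_kstar _ := Set.singleton_subset_iff.mpr (one_mem_starL _)
  mul_kstar_le_kstar _ := Set.subset_union_right.trans (starL_unfold_left _).subset
  kstar_mul_le_kstar _ := Set.subset_union_right.trans (starL_unfold_right _).subset
  mul_kstar_le_self _ _ h := seqL_starL_le h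
  kstar_mul_le_self _ _ h := starL_seqL_le h

variable {Q : Type} [DecidableEq Q] (B : Q → Q → Term α)

theorem up_sem_kleeneStar (l : List Q) (p q : Q) :
    Set.up (kleeneStar B l p q).sem = kleeneStar (fun p q => Set.up (B p q).sem) l p q :=
  map_kleeneStar (fun e : Term α => Set.up e.sem) rfl (fun _ _ => rfl) (fun _ _ => rfl)
    (fun _ => rfl) B l p q

theorem mk_kleeneStar {H : Hyps α} (l : List Q) (p q : Q) :
    TermQuot.mk H (kleeneStar B l p q) = kleeneStar (fun p q => TermQuot.mk H (B p q)) l p q :=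
  map_kleeneStar (TermQuot.mk H) rfl (fun _ _ => rfl) (fun _ _ => rfl) (fun _ => rfl) B l p q

theorem toTerm_kleeneStar (A : Q → Q → KATerm α) (l : List Q) (p q : Q) :
    (kleeneStar A l p q).toTerm = kleeneStar (fun p q => (A p q).toTerm) l p q :=
  map_kleeneStar KATerm.toTerm rfl (fun _ _ => rfl) (fun _ _ => rfl) (fun _ => rfl) A l p q

theorem one_mem_sem_kleeneStar (l : List Q) (p : Q) : Pom.one ∈ (kleeneStar B l p p).sem := by
  have h := one_le_kleeneStar (fun p q => Set.up (B p q).sem) l p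
  rw [← up_sem_kleeneStar] at h
  exact h rfl

theorem sem_subset_sem_kleeneStar (l : List Q) (p q : Q) :
    (B p q).sem ⊆ (kleeneStar B l p q).sem := by
  have h := le_kleeneStar (fun p q => Set.up (B p q).sem) l p q
  rwa [← up_sem_kleeneStar] at h

theorem seqL_sem_kleeneStar_subset (l : List Q) {m : Q} (hm : m ∈ l) (p q : Q) :
    seqL (kleeneStar B l p m).sem (kleeneStar B l m q).sem ⊆ (kleeneStar B l p q).sem := by
  have h := kleeneStar_mul_le (fun p q => Set.up (B p q).sem) l hm p q
  rwa [← up_sem_kleeneStar, ← up_sem_kleeneStar, ← up_sem_kleeneStar] at h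

/-- Each column of `R` absorbs single transitions, hence all paths; the path is then followed by the
empty pomset in `R q q`. -/
theorem sem_kleeneStar_subset {R : Q → Q → Set (Pom α)} (h1 : ∀ p, Pom.one ∈ R p p)
    (hR : ∀ p q t, seqL (B p q).sem (R q t) ⊆ R p t) (l : List Q) (p q : Q) :
    (kleeneStar B l p q).sem ⊆ R p q := by
  have h := kleeneStar_mul_le_of_le (fun p q => Set.up (B p q).sem) (Y := fun p => Set.up (R p q))
    (fun p m => hR p m q) l p q
  rw [← up_sem_kleeneStar] at h
  intro X hX
  exact h ⟨X, hX, Pom.one, h1 q, Pom.seq_one X⟩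

end Languages

/-! ### Automata with parallel transitions: runs, normal form, representation of terms -/

section Automata

variable {α : Type u} {H H' : Hyps α}

theorem KAEquiv.toTerm {e f : KATerm α} (h : KAEquiv H e f) : TermEquiv H e.toTerm f.toTerm := by
  induction h with
  | refl => exact .refl _
  | symm _ ih => exact ih.symm
  | trans _ _ ih ih' => exact ih.trans ih'
  | congr_add _ _ ih ih' => exact ih.congr_add ih'
  | congr_seq _ _ ih ih' => exact ih.congr_seq ih'
  | congr_star _ ih => exact ih.congr_star
  | add_zero => exact .add_zero _
  | add_idem => exact .add_idem _
  | add_comm => exact .add_comm _ _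
  | add_assoc => exact .add_assoc _ _ _
  | seq_assoc => exact .seq_assoc _ _ _
  | seq_add => exact .seq_add _ _ _
  | add_seq => exact .add_seq _ _ _
  | seq_one => exact .seq_one _
  | one_seq => exact .one_seq _
  | seq_zero => exact .seq_zero _
  | zero_seq => exact .zero_seq _
  | star_unfold_left => exact .star_unfold_left _
  | star_unfold_right => exact .star_unfold_right _
  | lfp_left _ ih => exact .lfp_left ih
  | lfp_right _ ih => exact .lfp_right ih
  | hyp h => exact .hyp h

/-- A finite automaton with two kinds of transitions between states `p` and `q`: one labelled by
the Kleene algebra term `word p q`, and one labelled by the parallel composition of `left p q`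
and `right p q`. -/
structure ParAut (α : Type u) where
  State : Type
  [fintype : Fintype State]
  [decEq : DecidableEq State]
  word : State → State → KATerm α
  left : State → State → Term α
  right : State → State → Term α

attribute [instance] ParAut.fintype ParAut.decEq

namespace ParAut

variable (M : ParAut α)

/-- The words on paths without parallel transitions. -/
inductive Path : M.State → M.State → Pom α → Prop
  | nil (p) : Path p p one
  | cons {p q t U X} : U ∈ (M.word p q).toTerm.sem → Path q t X → Path p t (seq U X)

/-- The closure of the words on paths without parallel transitions. -/
def Seg (H : Hyps α) (p q : M.State) : Set (Pom α) := SeqClosure H {X | M.Path p q X}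

/-- Closed segments alternating with proper parallel compositions from closed languages. -/
inductive Run (H : Hyps α) : M.State → M.State → Pom α → Prop
  | seg {p q s} : s ∈ M.Seg H p q → Run H p q s
  | par {p q m t s U V X} : s ∈ M.Seg H p q → U ∈ Closure H (M.left q m).sem →
      V ∈ Closure H (M.right q m).sem → U ≠ one → V ≠ one → Run H m t X →
      Run H p t (seq s (seq (par U V) X))

/-- If one component of a parallel transition can vanish, then the automaton can run through
the other one. -/
def Saturated (H : Hyps α) (p q : M.State) : Prop :=
  (one ∈ Closure H (M.left p q).sem → ∀ V ∈ Closure H (M.right p q).sem, M.Run H p q V) ∧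
  (one ∈ Closure H (M.right p q).sem → ∀ U ∈ Closure H (M.left p q).sem, M.Run H p q U)

variable {M}

theorem Path.trans {p q t : M.State} {X Z : Pom α} (h : M.Path p q X) (k : M.Path q t Z) :
    M.Path p t (seq X Z) := by
  induction h with
  | nil => rwa [one_seq]
  | cons hU _ ih => rw [seq_assoc]; exact .cons hU (ih k)

theorem Path.isWord {p q : M.State} {X : Pom α} (h : M.Path p q X) : IsWord X := by
  induction h with
  | nil => exact isWord_one
  | cons hU _ ih => exact isWord_seq.mpr ⟨KATerm.isWord_of_mem_sem _ _ hU, ih⟩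

theorem Path.sp {p q : M.State} {X : Pom α} (h : M.Path p q X) : SP X := by
  induction h with
  | nil => exact SP.one
  | cons hU _ ih => exact SP.seq (Term.sp_of_mem_sem _ _ hU) ih

theorem isSeqContext_iff {C : Pom (Option α)} : IsSeqContext C ↔ SPCtx C ∧ IsWord C :=
  and_congr_left' isSPContext_iff

/-- The left-hand sides of grounded hypotheses are Kleene algebra terms, so sequential steps insert
only words. -/
theorem isWord_sp_of_mem_seg (hH : Grounded H) {p q : M.State} {X : Pom α}
    (hX : X ∈ M.Seg H p q) : IsWord X ∧ SP X := by
  induction hX with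
  | base h => exact ⟨Path.isWord h, Path.sp h⟩
  | step hef hC _ hU _ =>
    rw [isSeqContext_iff] at hC
    obtain ⟨⟨e, rfl⟩, -⟩ := hH _ _ hef
    exact ⟨isWord_plug hC.1 hC.2 (KATerm.isWord_of_mem_sem _ _ hU),
      SP.plug hC.1 (Term.sp_of_mem_sem _ _ hU)⟩

/-- As for `seq_mem_closure`, but the factor that serves as a context must be a word. Derivation
steps of `X` come first; what remains is a path, after which the steps of `Z` are carried out. -/
theorem seq_mem_seg (hH : Grounded H) {p q t : M.State} {X Z : Pom α} (hX : X ∈ M.Seg H p q)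
    (hZ : Z ∈ M.Seg H q t) : seq X Z ∈ M.Seg H p t := by
  induction hX with
  | @base X h =>
    induction hZ with
    | base k => exact .base (Path.trans h k)
    | @step e f C U hef hC _ hU ih =>
      rw [isSeqContext_iff] at hC
      have hp : ∀ V, plug (seq (lift X) C) V = seq X (plug C V) := fun V => by
        rw [plug_seq, plug_lift (Path.sp h)]
      rw [← hp]
      refine SeqClosure.step hef (isSeqContext_iff.mpr ⟨SPCtx.seq_left (Path.sp h) hC.1,
        isWord_seq.mpr ⟨isWord_lift.mpr (Path.isWord h), hC.2⟩⟩) (fun V hV => ?_) hU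
      rw [hp]
      exact ih V hV
  | @step e f C U hef hC _ hU ih =>
    rw [isSeqContext_iff] at hC
    obtain ⟨hw, hs⟩ := isWord_sp_of_mem_seg hH hZ
    have hp : ∀ V, plug (seq C (lift Z)) V = seq (plug C V) Z := fun V => by
      rw [plug_seq, plug_lift hs]
    rw [← hp]
    refine SeqClosure.step hef (isSeqContext_iff.mpr ⟨SPCtx.seq_right hC.1 hs,
      isWord_seq.mpr ⟨hC.2, isWord_lift.mpr hw⟩⟩) (fun V hV => ?_) hU
    rw [hp]
    exact ih V hV

theorem one_mem_seg (p : M.State) : one ∈ M.Seg H p p := .base (Path.nil p)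

/-- Where the two runs meet, the last segment of one and the first segment of the other merge into a
single segment. -/
theorem Run.trans (hH : Grounded H) {p q t : M.State} {X Z : Pom α} (h : M.Run H p q X)
    (k : M.Run H q t Z) : M.Run H p t (seq X Z) := by
  induction h with
  | seg hs =>
    cases k with
    | seg hs' => exact .seg (seq_mem_seg hH hs hs')
    | par hs' hU hV hU1 hV1 hX =>
      rw [← seq_assoc]
      exact .par (seq_mem_seg hH hs hs') hU hV hU1 hV1 hX
  | par hs hU hV hU1 hV1 _ ih =>
    rw [seq_assoc, seq_assoc]
    exact .par hs hU hV hU1 hV1 (ih k)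

theorem run_one (p : M.State) : M.Run H p p one := .seg (one_mem_seg p)

/-- In a saturated automaton, parallel transitions may be taken with arbitrary elements of the
closed languages. -/
theorem Saturated.run_par {p q : M.State} (hM : M.Saturated H p q) {U V : Pom α}
    (hU : U ∈ Closure H (M.left p q).sem) (hV : V ∈ Closure H (M.right p q).sem) :
    M.Run H p q (Pom.par U V) := by
  by_cases hU1 : U = one
  · subst hU1
    rw [one_par]
    exact hM.1 hU V hV
  by_cases hV1 : V = one
  · subst hV1
    rw [par_one]
    exact hM.2 hV U hU
  rw [← one_seq (Pom.par U V), ← seq_one (Pom.par U V)]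
  exact .par (one_mem_seg p) hU hV hU1 hV1 (run_one q)

/-- The context is automatically sequential: filled with a nonempty pomset, it becomes a word. -/
theorem mem_seg_step (hH : Grounded H) {e f : Term α} (hef : (e, f) ∈ H) {W : Pom α}
    (hf : f.sem = {W}) (hW1 : W ≠ one) {p q : M.State} {C : Pom (Option α)} (hC : SPCtx C)
    (h : plug C W ∈ M.Seg H p q) {V : Pom α} (hV : V ∈ e.sem) : plug C V ∈ M.Seg H p q := by
  refine SeqClosure.step hef (isSeqContext_iff.mpr
    ⟨hC, isWord_of_isWord_plug hC hW1 (isWord_sp_of_mem_seg hH h).1⟩) (fun V' hV' => ?_) hV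
  rw [hf] at hV'
  rw [hV']
  exact h

theorem mem_hypClosure_step {e f : Term α} (hef : (e, f) ∈ H) {W : Pom α}
    (hf : f.sem = {W}) {L : Set (Pom α)} {C : Pom (Option α)} (hC : SPCtx C)
    (h : plug C W ∈ Closure H L) {V : Pom α} (hV : V ∈ e.sem) : plug C V ∈ Closure H L := by
  refine Closure.step hef (isSPContext_iff.mpr hC) (fun V' hV' => ?_) hV
  rw [hf] at hV'
  rw [hV']
  exact h

/-- The runs of a saturated automaton are closed under the hypotheses. -/
theorem Run.step (hH : Grounded H) (hM : ∀ p q, M.Saturated H p q) {e f : Term α}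
    (hef : (e, f) ∈ H) {W : Pom α} (hW : IsWord W) (hW1 : W ≠ one) (hf : f.sem = {W}) {V : Pom α}
    (hV : V ∈ e.sem) {p t : M.State} {X : Pom α} (hX : M.Run H p t X) :
    ∀ {C}, SPCtx C → X = plug C W → M.Run H p t (plug C V) := by
  induction hX with
  | seg hs =>
    rintro C hC rfl
    exact .seg (mem_seg_step hH hef hf hW1 hC hs hV)
  | @par p q m t s A B X hs hA hB hA1 hB1 hX ih =>
    intro C hC h
    -- Cut after the leading segment. If `W` straddled this cut, a nonempty word would be a prefix
    -- of a pomset that starts with the proper parallel composition of `A` and `B`.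
    rcases plug_eq_seq hC hW hW1 h.symm with ⟨D, hD, hDs, hp⟩ | ⟨D, hD, hDX, hp⟩ |
      ⟨Y', Z', W₁, W₂, -, hw, -, hw1, -, hZ⟩
    · rw [hp]
      exact .par (mem_seg_step hH hef hf hW1 hD (hDs ▸ hs) hV) hA hB hA1 hB1 hX
    · rw [hp]
      refine (Run.seg hs).trans hH ?_
      -- Cut after the parallel composition. Straddling would make a nonempty word a sequential
      -- suffix of it.
      rcases plug_eq_seq hD hW hW1 hDX with ⟨E, hE, hEp, hq⟩ | ⟨E, hE, hEX, hq⟩ |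
        ⟨Y', Z', W₁, W₂, hw, -, hw1, -, hY, -⟩
      · rw [hq]
        refine Run.trans hH ?_ hX
        -- The replacement may leave this component empty, so that the result need no longer be a
        -- proper parallel composition; saturation covers that case.
        rcases plug_eq_par hE hW hW1 hEp with ⟨F, hF, hFA, hr⟩ | ⟨F, hF, hFB, hr⟩
        · rw [hr]
          exact (hM q m).run_par (mem_hypClosure_step hef hf hF (hFA ▸ hA) hV) hB
        · rw [hr]
          exact (hM q m).run_par hA (mem_hypClosure_step hef hf hF (hFB ▸ hB) hV)
      · rw [hq]
        exact ((hM q m).run_par hA hB).trans hH (ih hE hEX.symm)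
      · exact absurd hY (seq_word_ne_par hw hw1 hA1 hB1)
    · exact absurd hZ.symm (word_seq_ne_par_seq hw hw1 hA1 hB1)

theorem hypClosure_subset_run (hH : Grounded H) (hM : ∀ p q, M.Saturated H p q) {p q : M.State}
    {L : Set (Pom α)} (hL : L ⊆ {X | M.Run H p q X}) : Closure H L ⊆ {X | M.Run H p q X} := by
  intro X hX
  induction hX with
  | base hU => exact hL hU
  | step hef hC _ hU ih =>
    obtain ⟨-, -, W, hW, hW1, hf⟩ := hH _ _ hef
    exact Run.step hH hM hef hW hW1 hf hU (ih W (hf ▸ Set.mem_singleton W))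
      (isSPContext_iff.mp hC) rfl

/-! The normal form -/

variable (M)

/-- The term for the paths without parallel transitions. -/
noncomputable def wordStar (p q : M.State) : KATerm α := kleeneStar M.word Finset.univ.toList p q

/-- The term for all paths, where the reduction `r` is applied to the segments without parallel
transitions. -/
noncomputable def normal (r : KATerm α → KATerm α) (p q : M.State) : Term α :=
  kleeneStar (fun p q => (r (M.wordStar p q)).toTerm + Term.par (M.left p q) (M.right p q))
    Finset.univ.toList p q

theorem sem_wordStar (p q : M.State) : (M.wordStar p q).toTerm.sem = {X | M.Path p q X} := by
  rw [wordStar, toTerm_kleeneStar]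
  refine Set.Subset.antisymm (sem_kleeneStar_subset _ (R := fun p q => {X | M.Path p q X})
    Path.nil ?_ _ p q) ?_
  · rintro p q t _ ⟨A, hA, B, hB, rfl⟩
    exact Path.cons hA hB
  · intro X hX
    induction hX with
    | nil p => exact one_mem_sem_kleeneStar _ _ p
    | cons hU _ ih =>
      exact seqL_sem_kleeneStar_subset _ _ (Finset.mem_toList.mpr (Finset.mem_univ _)) _ _
        (Set.mem_image2_of_mem (sem_subset_sem_kleeneStar _ _ _ _ hU) ih)

variable {M} {r : KATerm α → KATerm α}

/-- The single point at which the closure property of the sequential reduction enters. -/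
theorem seqClosure_wordStar (hr : IsSeqReduction H H' r) (p q : M.State) :
    SeqClosure H' (r (M.wordStar p q)).toTerm.sem = M.Seg H p q := by
  rw [← hr.closure_eq, sem_wordStar, Seg]

theorem sem_normal_subset (hH : Grounded H) (hr : IsSeqReduction H H' r)
    (hM : ∀ p q, M.Saturated H p q) (p q : M.State) :
    (M.normal r p q).sem ⊆ {X | M.Run H p q X} := by
  refine sem_kleeneStar_subset _ (R := fun p q => {X | M.Run H p q X}) run_one ?_ _ p q
  rintro p q t _ ⟨A, hA, B, hB, rfl⟩
  refine Run.trans hH ?_ hB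
  rcases hA with hA | ⟨U, hU, V, hV, rfl⟩
  · refine .seg ?_
    rw [← seqClosure_wordStar hr]
    exact .base hA
  · exact (hM p q).run_par (.base hU) (.base hV)

theorem step_subset_normal (p q : M.State) :
    (r (M.wordStar p q)).toTerm.sem ∪ parL (M.left p q).sem (M.right p q).sem ⊆
      (M.normal r p q).sem :=
  sem_subset_sem_kleeneStar (fun p q => (r (M.wordStar p q)).toTerm +
    Term.par (M.left p q) (M.right p q)) _ p q

/-- The segments are transferred by the sequential reduction and the parallel components by
assumption on their labels; the normal form is closed under joining paths. -/
theorem run_subset_normal (hr : IsSeqReduction H H' r)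
    (hl : ∀ p q, Closure H (M.left p q).sem ⊆ Closure H' (M.left p q).sem)
    (hr' : ∀ p q, Closure H (M.right p q).sem ⊆ Closure H' (M.right p q).sem) {p q : M.State}
    {X : Pom α} (hX : M.Run H p q X) : X ∈ Closure H' (M.normal r p q).sem := by
  have hseg : ∀ {p q}, M.Seg H p q ⊆ Closure H' (M.normal r p q).sem := by
    intro p q
    rw [← seqClosure_wordStar hr]
    exact seqClosure_subset_hypClosure.trans (hypClosure_mono (Set.subset_union_left.trans
      (step_subset_normal _ _)))
  have hseq : ∀ {p q t X Z}, X ∈ Closure H' (M.normal r p q).sem →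
      Z ∈ Closure H' (M.normal r q t).sem → seq X Z ∈ Closure H' (M.normal r p t).sem :=
    fun hX hZ => hypClosure_mono
      (seqL_sem_kleeneStar_subset _ _ (Finset.mem_toList.mpr (Finset.mem_univ _)) _ _)
      (seq_mem_closure (Term.sp_of_mem_sem _) (Term.sp_of_mem_sem _) hX hZ)
  induction hX with
  | seg hs => exact hseg hs
  | par hs hU hV _ _ _ ih =>
    refine hseq (hseg hs) (hseq ?_ ih)
    exact hypClosure_mono (Set.subset_union_right.trans (step_subset_normal _ _))
      (par_mem_closure (Term.sp_of_mem_sem _) (Term.sp_of_mem_sem _) (hl _ _ hU) (hr' _ _ hV))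

variable (M)

/-- The label, modulo provable equivalence, of all transitions between two states. -/
def label (H : Hyps α) (p q : M.State) : TermQuot H :=
  TermQuot.mk H (M.word p q).toTerm + TermQuot.mk H (Term.par (M.left p q) (M.right p q))

/-- The automaton with initial state `s` and final state `t` represents the term `e`: the class
of `e` is the least solution for `s` of the linear system given by the automaton. -/
structure Represents (H : Hyps α) (s t : M.State) (e : Term α) : Prop where
  lower : ∃ Y : M.State → TermQuot H, Y s ≤ TermQuot.mk H e ∧ 1 ≤ Y t ∧
    ∀ p q, M.label H p q * Y q ≤ Y p
  upper : ∀ X : M.State → M.State → TermQuot H, (∀ p, 1 ≤ X p p) → (∀ p q, M.label H p q ≤ X p q) →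
    (∀ p q m, X p q * X q m ≤ X p m) → TermQuot.mk H e ≤ X s t

variable {M}

/-- Provably, the normal form is the reflexive transitive closure of the labels: the reduced
segments are equivalent to the unreduced ones, and running Kleene's algorithm on them again adds
nothing. The vector in `lower` absorbs it, and `upper` applies to it. -/
theorem Represents.mk_normal (hr : IsSeqReduction H H' r) {s t : M.State} {e : Term α}
    (h : M.Represents H s t e) : TermQuot.mk H (M.normal r s t) = TermQuot.mk H e := by
  have hw : ∀ p q, TermQuot.mk H (r (M.wordStar p q)).toTerm =
      kleeneStar (fun p q => TermQuot.mk H (M.word p q).toTerm) Finset.univ.toList p q := by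
    intro p q
    rw [← mk_kleeneStar, ← toTerm_kleeneStar]
    exact (TermQuot.mk_eq.mpr (hr.equiv _).toTerm).symm
  apply le_antisymm
  · obtain ⟨Y, hs, ht, hY⟩ := h.lower
    have hY' := fun p q => add_le_iff.mp ((add_mul _ _ (Y q)).symm.trans_le (hY p q))
    refine le_trans ?_ hs
    refine (mul_one _).symm.trans_le ((mul_le_mul' le_rfl ht).trans ?_)
    rw [normal, mk_kleeneStar]
    refine kleeneStar_mul_le_of_le _ (fun p q => ?_) _ s t
    rw [TermQuot.mk_add, add_mul, hw]
    exact add_le_iff.mpr ⟨kleeneStar_mul_le_of_le _ (fun p q => (hY' p q).1) _ p q, (hY' p q).2⟩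
  · refine h.upper (fun p q => TermQuot.mk H (M.normal r p q)) (fun p => ?_) (fun p q => ?_)
      fun p q m => ?_
    · simp only [normal, mk_kleeneStar]
      exact one_le_kleeneStar _ _ p
    · simp only [normal, mk_kleeneStar]
      refine le_trans ?_ (le_kleeneStar _ _ p q)
      rw [TermQuot.mk_add, hw, label]
      have h := add_le_iff.mp (le_refl (kleeneStar (fun p q => TermQuot.mk H (M.word p q).toTerm)
        Finset.univ.toList p q + TermQuot.mk H (Term.par (M.left p q) (M.right p q))))
      exact add_le_iff.mpr ⟨(le_kleeneStar _ _ p q).trans h.1, h.2⟩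
    · simp only [normal, mk_kleeneStar]
      exact kleeneStar_mul_le _ _ (Finset.mem_toList.mpr (Finset.mem_univ q)) p m

end ParAut

end Automata

/-! ### Construction of an automaton for every term -/

section Construction

variable {α : Type u} {H H' : Hyps α}

theorem seqClosure_mono {L K : Set (Pom α)} (h : L ⊆ K) : SeqClosure H L ⊆ SeqClosure H K := by
  intro X hX
  induction hX with
  | base hU => exact .base (h hU)
  | step hef hC _ hU ih => exact SeqClosure.step hef hC ih hU

/-- A step presupposes that its right-hand side, which contains a word, is already present. A
right-hand side with empty language would break this. -/
theorem notMem_hypClosure_zero (hH : Grounded H) (X : Pom α) :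
    X ∉ Closure H (Term.zero : Term α).sem := by
  intro hX
  induction hX with
  | base hU => exact hU
  | step hef _ _ _ ih =>
    obtain ⟨-, -, W, -, -, hf⟩ := hH _ _ hef
    exact ih W (hf ▸ Set.mem_singleton W)

theorem TermQuot.mk_toTerm_add_le {k l : KATerm α} {x : TermQuot H}
    (h : TermQuot.mk H (k + l).toTerm ≤ x) :
    TermQuot.mk H k.toTerm ≤ x ∧ TermQuot.mk H l.toTerm ≤ x :=
  (add_le_iff (a := TermQuot.mk H k.toTerm) (b := TermQuot.mk H l.toTerm)).mp h

namespace ParAut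

theorem saturated_of_zero (hH : Grounded H) {M : ParAut α} {p q : M.State}
    (hl : M.left p q = Term.zero) (hr : M.right p q = Term.zero) : M.Saturated H p q := by
  rw [Saturated, hl, hr]
  exact ⟨fun h => absurd h (notMem_hypClosure_zero hH _),
    fun h => absurd h (notMem_hypClosure_zero hH _)⟩

/-- The automaton for a single word transition. -/
def ofKATerm (k : KATerm α) : ParAut α where
  State := Bool
  word p q := match p, q with
    | false, true => k
    | _, _ => .zero
  left _ _ := .zero
  right _ _ := .zero

theorem represents_ofKATerm (k : KATerm α) :
    (ofKATerm k).Represents H false true k.toTerm where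
  lower := by
    refine ⟨fun p => match p with
      | false => TermQuot.mk H k.toTerm
      | true => 1, le_rfl, le_rfl, ?_⟩
    have h0 : TermQuot.mk H (Term.par Term.zero Term.zero) = 0 := by
      rw [TermQuot.mk_par, TermQuot.mk_zero, TermQuot.par_zero]
    rintro (_ | _) (_ | _) <;>
      simp [label, ofKATerm, h0, KATerm.toTerm, TermQuot.mk_zero]
  upper X _ h _ := (add_le_iff.mp (h false true)).1

/-- Two automata side by side, with a new initial and a new final state, a parallel transition
between these, and additional empty transitions. -/
noncomputable def glue (M₁ M₂ : ParAut α) (f g : Term α)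
    (E : Bool ⊕ M₁.State ⊕ M₂.State → Bool ⊕ M₁.State ⊕ M₂.State → Prop) : ParAut α where
  State := Bool ⊕ M₁.State ⊕ M₂.State
  word p q := (match p, q with
    | .inr (.inl p), .inr (.inl q) => M₁.word p q
    | .inr (.inr p), .inr (.inr q) => M₂.word p q
    | _, _ => .zero) + (open Classical in if E p q then .one else .zero)
  left p q := match p, q with
    | .inl false, .inl true => f
    | .inr (.inl p), .inr (.inl q) => M₁.left p q
    | .inr (.inr p), .inr (.inr q) => M₂.left p q
    | _, _ => .zero
  right p q := match p, q with
    | .inl false, .inl true => g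
    | .inr (.inl p), .inr (.inl q) => M₁.right p q
    | .inr (.inr p), .inr (.inr q) => M₂.right p q
    | _, _ => .zero

theorem Path.map {M₁ M : ParAut α} (j : M₁.State → M.State)
    (hw : ∀ p q, (M₁.word p q).toTerm.sem ⊆ (M.word (j p) (j q)).toTerm.sem)
    {p q : M₁.State} {X : Pom α} (h : M₁.Path p q X) : M.Path (j p) (j q) X := by
  induction h with
  | nil p => exact .nil _
  | cons hU _ ih => exact .cons (hw _ _ hU) ih

/-- Inclusion suffices for the word labels, so that the embedding of a component tolerates the empty
transitions added by `glue`. -/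
theorem Run.map {M₁ M : ParAut α} (j : M₁.State → M.State)
    (hw : ∀ p q, (M₁.word p q).toTerm.sem ⊆ (M.word (j p) (j q)).toTerm.sem)
    (hl : ∀ p q, M.left (j p) (j q) = M₁.left p q)
    (hr : ∀ p q, M.right (j p) (j q) = M₁.right p q)
    {p q : M₁.State} {X : Pom α} (h : M₁.Run H p q X) : M.Run H (j p) (j q) X := by
  have hseg : ∀ {p q}, M₁.Seg H p q ⊆ M.Seg H (j p) (j q) := by
    intro p q
    exact seqClosure_mono fun _ => Path.map j hw
  induction h with
  | seg hs => exact .seg (hseg hs)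
  | par hs hU hV hU1 hV1 _ ih =>
    exact .par (hseg hs) (by rwa [hl]) (by rwa [hr]) hU1 hV1 ih

theorem Saturated.map {M₁ M : ParAut α} (j : M₁.State → M.State)
    (hw : ∀ p q, (M₁.word p q).toTerm.sem ⊆ (M.word (j p) (j q)).toTerm.sem)
    (hl : ∀ p q, M.left (j p) (j q) = M₁.left p q)
    (hr : ∀ p q, M.right (j p) (j q) = M₁.right p q)
    {p q : M₁.State} (h : M₁.Saturated H p q) : M.Saturated H (j p) (j q) := by
  rw [Saturated, hl, hr]
  exact ⟨fun h1 V hV => (h.1 h1 V hV).map j hw hl hr, fun h1 V hV => (h.2 h1 V hV).map j hw hl hr⟩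

section Glue

variable {M₁ M₂ : ParAut α} {f g : Term α}
  {E : Bool ⊕ M₁.State ⊕ M₂.State → Bool ⊕ M₁.State ⊕ M₂.State → Prop}

theorem Run.glue_left {p q : M₁.State} {X : Pom α} (h : M₁.Run H p q X) :
    (glue M₁ M₂ f g E).Run H (.inr (.inl p)) (.inr (.inl q)) X :=
  h.map (M := glue M₁ M₂ f g E) (fun p => .inr (.inl p)) (fun _ _ => Set.subset_union_left)
    (fun _ _ => rfl) (fun _ _ => rfl)

theorem Run.glue_right {p q : M₂.State} {X : Pom α} (h : M₂.Run H p q X) :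
    (glue M₁ M₂ f g E).Run H (.inr (.inr p)) (.inr (.inr q)) X :=
  h.map (M := glue M₁ M₂ f g E) (fun p => .inr (.inr p)) (fun _ _ => Set.subset_union_left)
    (fun _ _ => rfl) (fun _ _ => rfl)

theorem glue_run_one {p q : (glue M₁ M₂ f g E).State} (h : E p q) :
    (glue M₁ M₂ f g E).Run H p q one := by
  refine .seg (.base ?_)
  have := Path.cons (M := glue M₁ M₂ f g E) (p := p) (q := q) (U := one)
    (Or.inr (by rw [if_pos h]; rfl)) (Path.nil q)
  rwa [one_seq] at this

/-- Saturation of the parts is inherited because adding transitions only adds runs; transitions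
between different blocks have no parallel part. -/
theorem glue_saturated (hH : Grounded H) (h₁ : ∀ p q, M₁.Saturated H p q)
    (h₂ : ∀ p q, M₂.Saturated H p q)
    (h : (glue M₁ M₂ f g E).Saturated H (.inl false) (.inl true)) :
    ∀ p q, (glue M₁ M₂ f g E).Saturated H p q := by
  rintro ((_ | _) | p | p) ((_ | _) | q | q)
  case inl.false.inl.true => exact h
  case inr.inl.inr.inl =>
    exact (h₁ p q).map (M := glue M₁ M₂ f g E) (fun p => .inr (.inl p))
      (fun _ _ => Set.subset_union_left) (fun _ _ => rfl) (fun _ _ => rfl)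
  case inr.inr.inr.inr =>
    exact (h₂ p q).map (M := glue M₁ M₂ f g E) (fun p => .inr (.inr p))
      (fun _ _ => Set.subset_union_left) (fun _ _ => rfl) (fun _ _ => rfl)
  all_goals exact saturated_of_zero hH rfl rfl

/-- A solution for the glued automaton is assembled from solutions for the parts; only the new
transitions impose further conditions. -/
theorem glue_label_mul_le {Y : (glue M₁ M₂ f g E).State → TermQuot H}
    (h₁ : ∀ p q, M₁.label H p q * Y (.inr (.inl q)) ≤ Y (.inr (.inl p)))
    (h₂ : ∀ p q, M₂.label H p q * Y (.inr (.inr q)) ≤ Y (.inr (.inr p)))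
    (hE : ∀ p q, E p q → Y q ≤ Y p)
    (hfg : TermQuot.mk H (Term.par f g) * Y (.inl true) ≤ Y (.inl false)) :
    ∀ p q, (glue M₁ M₂ f g E).label H p q * Y q ≤ Y p := by
  classical
  have hE' : ∀ p q, TermQuot.mk H (if E p q then KATerm.one else .zero).toTerm * Y q ≤ Y p := by
    intro p q
    split_ifs with h
    · exact (one_mul (Y q)).trans_le (hE p q h)
    · exact (zero_mul (Y q)).trans_le bot_le
  have key : ∀ (p q) (b : KATerm α) (x : TermQuot H),
      (TermQuot.mk H b.toTerm + x) * Y q ≤ Y p →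
      (TermQuot.mk H b.toTerm + TermQuot.mk H (if E p q then KATerm.one else .zero).toTerm + x) *
        Y q ≤ Y p := by
    intro p q b x h
    rw [add_mul] at h
    rw [add_mul, add_mul]
    have h := add_le_iff.mp h
    exact add_le_iff.mpr ⟨add_le_iff.mpr ⟨h.1, hE' p q⟩, h.2⟩
  have h0 : TermQuot.mk H (Term.par Term.zero Term.zero) = 0 := by
      rw [TermQuot.mk_par, TermQuot.mk_zero, TermQuot.par_zero]
  have hz : TermQuot.mk H (KATerm.zero : KATerm α).toTerm = 0 := rfl
  have cross : ∀ p q, (TermQuot.mk H (KATerm.zero : KATerm α).toTerm +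
      TermQuot.mk H (Term.par Term.zero Term.zero)) * Y q ≤ Y p := by
    intro p q
    rw [h0, hz, zero_add, zero_mul]
    exact bot_le
  rintro ((_ | _) | p | p) ((_ | _) | q | q)
  case inl.false.inl.true =>
    refine key _ _ .zero _ ?_
    rw [hz, zero_add]
    exact hfg
  case inr.inl.inr.inl => exact key _ _ _ _ (h₁ p q)
  case inr.inr.inr.inr => exact key _ _ _ _ (h₂ p q)
  all_goals exact key _ _ .zero _ (cross _ _)

variable {X : (glue M₁ M₂ f g E).State → (glue M₁ M₂ f g E).State → TermQuot H}

theorem Represents.le_glue_left {s t : M₁.State} {e : Term α} (h : M₁.Represents H s t e)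
    (h1 : ∀ p, 1 ≤ X p p) (hX : ∀ p q, (glue M₁ M₂ f g E).label H p q ≤ X p q)
    (hm : ∀ p q m, X p q * X q m ≤ X p m) :
    TermQuot.mk H e ≤ X (.inr (.inl s)) (.inr (.inl t)) := by
  refine h.upper (fun p q => X (.inr (.inl p)) (.inr (.inl q))) (fun p => h1 _) (fun p q => ?_)
    fun p q m => hm _ _ _
  have h := add_le_iff.mp (hX (.inr (.inl p)) (.inr (.inl q)))
  exact add_le_iff.mpr ⟨(TermQuot.mk_toTerm_add_le h.1).1, h.2⟩

theorem Represents.le_glue_right {s t : M₂.State} {e : Term α} (h : M₂.Represents H s t e)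
    (h1 : ∀ p, 1 ≤ X p p) (hX : ∀ p q, (glue M₁ M₂ f g E).label H p q ≤ X p q)
    (hm : ∀ p q m, X p q * X q m ≤ X p m) :
    TermQuot.mk H e ≤ X (.inr (.inr s)) (.inr (.inr t)) := by
  refine h.upper (fun p q => X (.inr (.inr p)) (.inr (.inr q))) (fun p => h1 _) (fun p q => ?_)
    fun p q m => hm _ _ _
  have h := add_le_iff.mp (hX (.inr (.inr p)) (.inr (.inr q)))
  exact add_le_iff.mpr ⟨(TermQuot.mk_toTerm_add_le h.1).1, h.2⟩

theorem one_le_of_edge (hX : ∀ p q, (glue M₁ M₂ f g E).label H p q ≤ X p q)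
    {p q : (glue M₁ M₂ f g E).State} (h : E p q) : 1 ≤ X p q := by
  classical
  have h' := (TermQuot.mk_toTerm_add_le (add_le_iff.mp (hX p q)).1).2
  refine le_trans (le_of_eq ?_) h'
  rw [if_pos h]
  rfl

end Glue

/-- The conditions under which the normal form of `M` has an `H`-closed language. -/
structure Adequate (H H' : Hyps α) (M : ParAut α) : Prop where
  saturated : ∀ p q, M.Saturated H p q
  left : ∀ p q, Closure H (M.left p q).sem ⊆ Closure H' (M.left p q).sem
  right : ∀ p q, Closure H (M.right p q).sem ⊆ Closure H' (M.right p q).sem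

theorem adequate_ofKATerm (hH : Grounded H) (k : KATerm α) : (ofKATerm k).Adequate H H' where
  saturated _ _ := saturated_of_zero hH rfl rfl
  left _ _ X hX := absurd hX (notMem_hypClosure_zero hH X)
  right _ _ X hX := absurd hX (notMem_hypClosure_zero hH X)

theorem Adequate.glue (hH : Grounded H) {M₁ M₂ : ParAut α} {f g : Term α}
    {E : Bool ⊕ M₁.State ⊕ M₂.State → Bool ⊕ M₁.State ⊕ M₂.State → Prop}
    (h₁ : M₁.Adequate H H') (h₂ : M₂.Adequate H H')
    (h : (glue M₁ M₂ f g E).Saturated H (.inl false) (.inl true))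
    (hf : Closure H f.sem ⊆ Closure H' f.sem) (hg : Closure H g.sem ⊆ Closure H' g.sem) :
    (glue M₁ M₂ f g E).Adequate H H' where
  saturated := glue_saturated hH h₁.saturated h₂.saturated h
  left := by
    rintro ((_ | _) | p | p) ((_ | _) | q | q)
    case inl.false.inl.true => exact hf
    case inr.inl.inr.inl => exact h₁.left p q
    case inr.inr.inr.inr => exact h₂.left p q
    all_goals exact fun X hX => absurd hX (notMem_hypClosure_zero hH X)
  right := by
    rintro ((_ | _) | p | p) ((_ | _) | q | q)
    case inl.false.inl.true => exact hg
    case inr.inl.inr.inl => exact h₁.right p q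
    case inr.inr.inr.inr => exact h₂.right p q
    all_goals exact fun X hX => absurd hX (notMem_hypClosure_zero hH X)

theorem Adequate.glue_zero (hH : Grounded H) {M₁ M₂ : ParAut α}
    {E : Bool ⊕ M₁.State ⊕ M₂.State → Bool ⊕ M₁.State ⊕ M₂.State → Prop}
    (h₁ : M₁.Adequate H H') (h₂ : M₂.Adequate H H') :
    (ParAut.glue M₁ M₂ .zero .zero E).Adequate H H' :=
  h₁.glue hH h₂ (saturated_of_zero hH rfl rfl)
    (fun X hX => absurd hX (notMem_hypClosure_zero hH X))
    (fun X hX => absurd hX (notMem_hypClosure_zero hH X))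

variable {r : KATerm α → KATerm α} {M : ParAut α}

/-- The closure of a term represented by an adequate automaton consists of the runs. -/
theorem Represents.closure_subset_run (hH : Grounded H) (hr : IsSeqReduction H H' r)
    (hM : M.Adequate H H') {s t : M.State} {e : Term α} (h : M.Represents H s t e) :
    Closure H e.sem ⊆ {X | M.Run H s t X} := by
  rw [← (TermQuot.mk_eq.mp (h.mk_normal hr)).closure_sem_eq]
  exact hypClosure_subset_run hH hM.saturated (sem_normal_subset hH hr hM.saturated s t)

/-- Allows the normal form to serve as the label of a parallel transition in a larger automaton. -/
theorem Represents.closure_subset_normal (hH : Grounded H) (hr : IsSeqReduction H H' r)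
    (hM : M.Adequate H H') {s t : M.State} {e : Term α} (h : M.Represents H s t e) :
    Closure H e.sem ⊆ Closure H' (M.normal r s t).sem :=
  (h.closure_subset_run hH hr hM).trans fun _ => run_subset_normal hr hM.left hM.right

variable {M₁ M₂ : ParAut α} {e f : Term α}

/-- The solution for a continuation: `z` is what remains to be done after the final state. -/
theorem Represents.mul_right {s t : M.State} (h : M.Represents H s t e) (z : TermQuot H) :
    ∃ Y : M.State → TermQuot H, Y s ≤ TermQuot.mk H e * z ∧ z ≤ Y t ∧
      ∀ p q, M.label H p q * Y q ≤ Y p := by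
  obtain ⟨Y, hs, ht, hY⟩ := h.lower
  refine ⟨fun p => Y p * z, mul_le_mul' hs le_rfl,
    (one_mul z).symm.trans_le (mul_le_mul' ht le_rfl), fun p q => ?_⟩
  rw [← mul_assoc]
  exact mul_le_mul' (hY p q) le_rfl

theorem represents_add {s₁ t₁ : M₁.State} {s₂ t₂ : M₂.State} (h₁ : M₁.Represents H s₁ t₁ e)
    (h₂ : M₂.Represents H s₂ t₂ f) :
    (glue M₁ M₂ .zero .zero fun p q => (p = .inl false ∧ q = .inr (.inl s₁)) ∨
      (p = .inl false ∧ q = .inr (.inr s₂)) ∨ (p = .inr (.inl t₁) ∧ q = .inl true) ∨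
      (p = .inr (.inr t₂) ∧ q = .inl true)).Represents H (.inl false) (.inl true)
      (Term.add e f) where
  lower := by
    obtain ⟨Y₁, hs₁, ht₁, hY₁⟩ := h₁.lower
    obtain ⟨Y₂, hs₂, ht₂, hY₂⟩ := h₂.lower
    have hle := add_le_iff.mp (le_refl (TermQuot.mk H e + TermQuot.mk H f))
    refine ⟨Sum.elim (fun b => match b with
      | false => TermQuot.mk H e + TermQuot.mk H f
      | true => 1) (Sum.elim Y₁ Y₂), le_rfl, le_rfl, glue_label_mul_le hY₁ hY₂ ?_ ?_⟩
    · rintro p q (⟨rfl, rfl⟩ | ⟨rfl, rfl⟩ | ⟨rfl, rfl⟩ | ⟨rfl, rfl⟩)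
      · exact hs₁.trans hle.1
      · exact hs₂.trans hle.2
      · exact ht₁
      · exact ht₂
    · rw [TermQuot.mk_par, TermQuot.mk_zero, TermQuot.par_zero, zero_mul]
      exact bot_le
  upper X h1 hX hm := by
    refine (add_le_iff (a := TermQuot.mk H e) (b := TermQuot.mk H f)).mpr ⟨?_, ?_⟩
    · refine (h₁.le_glue_left h1 hX hm).trans ?_
      refine le_trans ?_ (hm _ (.inr (.inl t₁)) _)
      refine le_trans ?_ (mul_le_mul' (hm _ (.inr (.inl s₁)) _) le_rfl)
      have a := one_le_of_edge hX (p := .inl false) (q := .inr (.inl s₁)) (by simp)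
      have b := one_le_of_edge hX (p := .inr (.inl t₁)) (q := .inl true) (by simp)
      exact (one_mul _).symm.trans_le ((mul_le_mul' a le_rfl).trans
        ((mul_one _).symm.trans_le (mul_le_mul' le_rfl b)))
    · refine (h₂.le_glue_right h1 hX hm).trans ?_
      refine le_trans ?_ (hm _ (.inr (.inr t₂)) _)
      refine le_trans ?_ (mul_le_mul' (hm _ (.inr (.inr s₂)) _) le_rfl)
      have a := one_le_of_edge hX (p := .inl false) (q := .inr (.inr s₂)) (by simp)
      have b := one_le_of_edge hX (p := .inr (.inr t₂)) (q := .inl true) (by simp)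
      exact (one_mul _).symm.trans_le ((mul_le_mul' a le_rfl).trans
        ((mul_one _).symm.trans_le (mul_le_mul' le_rfl b)))

theorem represents_seq {s₁ t₁ : M₁.State} {s₂ t₂ : M₂.State} (h₁ : M₁.Represents H s₁ t₁ e)
    (h₂ : M₂.Represents H s₂ t₂ f) :
    (glue M₁ M₂ .zero .zero fun p q =>
      p = .inr (.inl t₁) ∧ q = .inr (.inr s₂)).Represents H (.inr (.inl s₁)) (.inr (.inr t₂))
      (Term.seq e f) where
  lower := by
    obtain ⟨Y₂, hs₂, ht₂, hY₂⟩ := h₂.lower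
    obtain ⟨Y₁, hs₁, ht₁, hY₁⟩ := h₁.mul_right (TermQuot.mk H f)
    -- The first part carries the continuation `f`. The two fresh states play no role here and get
    -- the value `0`.
    refine ⟨Sum.elim (fun _ => 0) (Sum.elim Y₁ Y₂), hs₁, ht₂, glue_label_mul_le hY₁ hY₂ ?_ ?_⟩
    · rintro p q ⟨rfl, rfl⟩
      exact hs₂.trans ht₁
    · exact (mul_zero _).trans_le bot_le
  upper X h1 hX hm := by
    have a := one_le_of_edge hX (p := .inr (.inl t₁)) (q := .inr (.inr s₂)) ⟨rfl, rfl⟩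
    refine (mul_le_mul' ((h₁.le_glue_left h1 hX hm).trans ?_) (h₂.le_glue_right h1 hX hm)).trans
      (hm _ _ _)
    exact (mul_one _).symm.trans_le ((mul_le_mul' le_rfl a).trans (hm _ _ _))

/-- One fresh state is both initial and final, and every round through `M` returns to it. The second
copy of `M` is idle and only fills the place required by `glue`. -/
theorem represents_star {s t : M.State} (h : M.Represents H s t e) :
    (glue M M .zero .zero fun p q => (p = .inl false ∧ q = .inr (.inl s)) ∨
      (p = .inr (.inl t) ∧ q = .inl false)).Represents H (.inl false) (.inl false)
      (Term.star e) where
  lower := by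
    obtain ⟨Y, hs, ht, hY⟩ := h.mul_right (TermQuot.mk H e)∗
    refine ⟨Sum.elim (fun _ => (TermQuot.mk H e)∗) (Sum.elim Y fun _ => 0), le_rfl,
      one_le_kstar, glue_label_mul_le hY (fun _ _ => (mul_zero _).trans_le bot_le) ?_ ?_⟩
    · rintro p q (⟨rfl, rfl⟩ | ⟨rfl, rfl⟩)
      · exact hs.trans mul_kstar_le_kstar
      · exact ht
    · rw [TermQuot.mk_par, TermQuot.mk_zero, TermQuot.par_zero, zero_mul]
      exact bot_le
  upper X h1 hX hm := by
    have a := one_le_of_edge hX (p := .inl false) (q := .inr (.inl s)) (by simp)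
    have b := one_le_of_edge hX (p := .inr (.inl t)) (q := .inl false) (by simp)
    have he : TermQuot.mk H e ≤ X (.inl false) (.inl false) := by
      refine (h.le_glue_left h1 hX hm).trans ?_
      refine le_trans ?_ (hm _ (.inr (.inl t)) _)
      refine le_trans ?_ (mul_le_mul' (hm _ (.inr (.inl s)) _) le_rfl)
      exact (one_mul _).symm.trans_le ((mul_le_mul' a le_rfl).trans
        ((mul_one _).symm.trans_le (mul_le_mul' le_rfl b)))
    have hk : (TermQuot.mk H e)∗ * X (.inl false) (.inl false) ≤ X (.inl false) (.inl false) :=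
      kstar_mul_le_self ((mul_le_mul' he le_rfl).trans (hm _ _ _))
    exact (mul_one _).symm.trans_le ((mul_le_mul' le_rfl (h1 _)).trans hk)

/-- The empty transitions in the automaton for a parallel composition: if one component can
vanish, then the automaton for the other one may be entered. -/
def ParEdge (H : Hyps α) (e f : Term α) (s₁ t₁ : M₁.State) (s₂ t₂ : M₂.State)
    (p q : Bool ⊕ M₁.State ⊕ M₂.State) : Prop :=
  (one ∈ Closure H f.sem ∧ p = .inl false ∧ q = .inr (.inl s₁)) ∨
  (one ∈ Closure H e.sem ∧ p = .inl false ∧ q = .inr (.inr s₂)) ∨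
  (p = .inr (.inl t₁) ∧ q = .inl true) ∨ (p = .inr (.inr t₂) ∧ q = .inl true)

/-- The labels `e'` and `f'` stand for normal forms, which are only provably equivalent to `e` and
`f`. -/
theorem represents_par (hH : Grounded H) {s₁ t₁ : M₁.State} {s₂ t₂ : M₂.State}
    (h₁ : M₁.Represents H s₁ t₁ e) (h₂ : M₂.Represents H s₂ t₂ f) {e' f' : Term α}
    (he : TermQuot.mk H e' = TermQuot.mk H e) (hf : TermQuot.mk H f' = TermQuot.mk H f) :
    (glue M₁ M₂ e' f' (ParEdge H e f s₁ t₁ s₂ t₂)).Represents H (.inl false) (.inl true)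
      (Term.par e f) where
  lower := by
    obtain ⟨Y₁, hs₁, ht₁, hY₁⟩ := h₁.lower
    obtain ⟨Y₂, hs₂, ht₂, hY₂⟩ := h₂.lower
    refine ⟨Sum.elim (fun b => match b with
      | false => TermQuot.mk H (Term.par e f)
      | true => 1) (Sum.elim Y₁ Y₂), le_rfl, le_rfl, glue_label_mul_le hY₁ hY₂ ?_ ?_⟩
    · rintro p q (⟨h1, rfl, rfl⟩ | ⟨h1, rfl, rfl⟩ | ⟨rfl, rfl⟩ | ⟨rfl, rfl⟩)
      -- The empty transition is sound: `1` in the closure of `f` gives `1 ≤ f` provably, hence `e =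
      -- e ∥ 1 ≤ e ∥ f`.
      · exact hs₁.trans ((TermQuot.par_one _).symm.trans_le
          (TermQuot.par_le_par le_rfl (PomTerm.one.mk_le_of_mem_closure hH h1)))
      · exact hs₂.trans ((TermQuot.one_par _).symm.trans_le
          (TermQuot.par_le_par (PomTerm.one.mk_le_of_mem_closure hH h1) le_rfl))
      · exact ht₁
      · exact ht₂
    · rw [TermQuot.mk_par, he, hf]
      exact (mul_one _).le
  upper X h1 hX hm := by
    rw [TermQuot.mk_par, ← he, ← hf]
    exact (add_le_iff.mp (hX (.inl false) (.inl true))).2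

/-- If one component can vanish, an empty transition enters the part for the other one, whose runs
exhaust the closure of that component, and another one leaves it again. -/
theorem adequate_par (hH : Grounded H) (hr : IsSeqReduction H H' r) (hM₁ : M₁.Adequate H H')
    (hM₂ : M₂.Adequate H H') {s₁ t₁ : M₁.State} {s₂ t₂ : M₂.State}
    (h₁ : M₁.Represents H s₁ t₁ e) (h₂ : M₂.Represents H s₂ t₂ f) :
    (glue M₁ M₂ (M₁.normal r s₁ t₁) (M₂.normal r s₂ t₂)
      (ParEdge H e f s₁ t₁ s₂ t₂)).Adequate H H' := by
  have he := (TermQuot.mk_eq.mp (h₁.mk_normal hr)).closure_sem_eq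
  have hf := (TermQuot.mk_eq.mp (h₂.mk_normal hr)).closure_sem_eq
  refine hM₁.glue hH hM₂ ⟨fun h1 V hV => ?_, fun h1 U hU => ?_⟩
    (he.subset.trans (h₁.closure_subset_normal hH hr hM₁))
    (hf.subset.trans (h₂.closure_subset_normal hH hr hM₂))
  · have hrun := Run.glue_right (M₁ := M₁) (f := M₁.normal r s₁ t₁) (g := M₂.normal r s₂ t₂)
      (E := ParEdge H e f s₁ t₁ s₂ t₂) (h₂.closure_subset_run hH hr hM₂ (hf.subset hV))
    have := ((glue_run_one (Or.inr (Or.inl ⟨he.subset h1, rfl, rfl⟩))).trans hH hrun).trans hH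
      (glue_run_one (Or.inr (Or.inr (Or.inr ⟨rfl, rfl⟩))))
    rwa [one_seq, seq_one] at this
  · have hrun := Run.glue_left (M₂ := M₂) (f := M₁.normal r s₁ t₁) (g := M₂.normal r s₂ t₂)
      (E := ParEdge H e f s₁ t₁ s₂ t₂) (h₁.closure_subset_run hH hr hM₁ (he.subset hU))
    have := ((glue_run_one (Or.inl ⟨hf.subset h1, rfl, rfl⟩)).trans hH hrun).trans hH
      (glue_run_one (Or.inr (Or.inr (Or.inl ⟨rfl, rfl⟩))))
    rwa [one_seq, seq_one] at this

/-- Adequacy has to be carried through the induction, since the parallel case labels its new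
transition with the normal forms of the two parts. -/
theorem exists_represents (hH : Grounded H) (hr : IsSeqReduction H H' r) (e : Term α) :
    ∃ (M : ParAut α) (s t : M.State), M.Adequate H H' ∧ M.Represents H s t e := by
  induction e with
  | zero => exact ⟨_, _, _, adequate_ofKATerm hH .zero, represents_ofKATerm .zero⟩
  | one => exact ⟨_, _, _, adequate_ofKATerm hH .one, represents_ofKATerm .one⟩
  | letter a => exact ⟨_, _, _, adequate_ofKATerm hH (.letter a), represents_ofKATerm (.letter a)⟩
  | add e f ihe ihf =>
    obtain ⟨M₁, s₁, t₁, hM₁, h₁⟩ := ihe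
    obtain ⟨M₂, s₂, t₂, hM₂, h₂⟩ := ihf
    exact ⟨_, _, _, hM₁.glue_zero hH hM₂, represents_add h₁ h₂⟩
  | seq e f ihe ihf =>
    obtain ⟨M₁, s₁, t₁, hM₁, h₁⟩ := ihe
    obtain ⟨M₂, s₂, t₂, hM₂, h₂⟩ := ihf
    exact ⟨_, _, _, hM₁.glue_zero hH hM₂, represents_seq h₁ h₂⟩
  | par e f ihe ihf =>
    obtain ⟨M₁, s₁, t₁, hM₁, h₁⟩ := ihe
    obtain ⟨M₂, s₂, t₂, hM₂, h₂⟩ := ihf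
    exact ⟨_, _, _, adequate_par hH hr hM₁ hM₂ h₁ h₂,
      represents_par hH h₁ h₂ (h₁.mk_normal hr) (h₂.mk_normal hr)⟩
  | star e ih =>
    obtain ⟨M, s, t, hM, h⟩ := ih
    exact ⟨_, _, _, hM.glue_zero hH hM, represents_star h⟩

end ParAut

/-- Every term has a provably equivalent one whose closure under `H'` is the closure under `H` of
the language of the given term. -/
theorem IsSeqReduction.exists_term (hH : Grounded H) {r : KATerm α → KATerm α}
    (hr : IsSeqReduction H H' r) (e : Term α) :
    ∃ e', TermEquiv H e e' ∧ Closure H e.sem = Closure H' e'.sem := by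
  obtain ⟨M, s, t, hM, h⟩ := ParAut.exists_represents hH hr e
  have he := TermQuot.mk_eq.mp (h.mk_normal hr)
  -- For the second inclusion, steps of `H'` are derivable in `H`, and by soundness the normal form
  -- has the same `H`-closure as `e`.
  exact ⟨_, he.symm, (h.closure_subset_normal hH hr hM).antisymm
    (hr.imp.closure_subset.trans he.closure_sem_eq.subset)⟩

end Construction

end StrongReduction

theorem mainTheorem8 {α : Type u} (H H' : Hyps α)
    (hred : SequentiallyReduces H H') (hH : Grounded H) (hH' : Grounded H') :
    StronglyReduces H H' := by
  obtain ⟨r, hr⟩ := hred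
  choose s hs using hr.exists_term hH
  exact ⟨s, ⟨hr.imp, fun e => (hs e).1, fun e f h => by rw [← (hs e).2, ← (hs f).2, h]⟩,
    fun e => (hs e).2⟩
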